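/- Let $n\ge 1$, and consider the root system of type $B_n$ with roots $\pm e_i$, $\pm e_i\pm e_j$ ($i\ne j$), Weyl group $W$ (signed permutations of $e_1,\dots,e_n$), Weyl vector $\rho=\frac12\sum_{j=1}^n(2n-2j+1)e_j$ and set of dominant weights $\Pi^+$. For $\lambda\in\Pi^+$ let $\chi(\lambda)$ be the irreducible character of highest weight $\lambda$, and define $C_\lambda(q,t)$ by the expansion $$\prod_{i\ge 0}\Big[\Big(\frac{1-q^{i+1}}{1-tq^i}\Big)^{n}\prod_{\alpha}\frac{1-q^{i+1}e^{\alpha}}{1-tq^ie^{\alpha}}\Big]=\sum_{\lambda\in\Pi^+}C_\lambda(q,t)\,\chi(\lambda)$$ of the Macdonald kernel ($\alpha$ runs over all roots). For $0\le m\le n$ put $\lambda_m=e_1+\dots+e_m$ (so $\lambda_0=0$, $\lambda_m=\omega_m$ for $1\le m<n$, and $\lambda_n=2\omega_n$) and $C_m=C_{\lambda_m}(-q,q^2)$. Set $$c_m=\frac{1-q^{2m}}{1-q^2}\,q^{-2n+1}(1+q^{4n-2m+1}),\qquad b_m=(q+1)\,q^{-2m+2}\,\frac{1-q^{4m-2}}{1-q^2}.$$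 Let $1\le m\le n$. (1) The following identity holds: $$C_mc_m=\sum_{i=1}^{\lfloor (m+1)/2\rfloor}C_{m-2i+1}\,b_i+\sum_{i=1}^{\lfloor m/2\rfloor}C_{m-2i}\,b_{n-m+i+1}.$$ (2) This identity is a simplification of the specialized minuscule recurrence, in the following sense. Let $(a_\lambda)_{\lambda\in\Pi^+}$ be any family of formal Laurent series in $q$ over $\mathbb C$. Extend it to all weights by $a_\mu=(-1)^{\ell(\sigma)}a_\lambda$ if $\sigma(\mu+\rho)=\lambda+\rho$ with $\sigma\in W$, $\lambda\in\Pi^+$, and $a_\mu=0$ if $\mu+\rho$ is not regular. Then the minuscule recurrences (for the minuscule coweight $e_1$, specialized at $q\mapsto -q$, $t\mapsto q^2$) $$\sum_{w\in W/W_{\lambda}}a_{w\lambda}\sum_{\psi\in W_{\lambda}e_1}\big(q^{-2(\rho,w\psi)}+q^{1+2(\rho,w\psi)}\big)=0\qquad\text{for }\lambda=\lambda_1,\dots,\lambda_m$$ all hold if and only if $$a_{\lambda_k}c_k=\sum_{i=1}^{\lfloor (k+1)/2\rfloor}a_{\lambda_{k-2i+1}}\,b_i+\sum_{i=1}^{\lfloor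 k/2\rfloor}a_{\lambda_{k-2i}}\,b_{n-k+i+1}\qquad\text{for all }1\le k\le m,$$ where $W_\lambda$ is the stabilizer of $\lambda$ in $W$ and $(\cdot,\cdot)$ is the inner product with orthonormal basis $e_1,\dots,e_n$. -/

import Mathlib

namespace TypeB

open Finset

/-! ### The root system, the weights and the Weyl group of type `B_n` -/

/-- The ambient Euclidean space of the weights, in coordinates with respect to `e_1, …, e_n`
(position `i : Fin n` is the coordinate of `e_{i+1}`). -/
abbrev Vec (n : ℕ) := Fin n → ℚ

/-- The Weyl group of type `B_n` as the set of all signed permutations of the coordinates: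
a tuple of signs together with a permutation. -/
abbrev SignedPerm (n : ℕ) := (Fin n → ℤˣ) × Equiv.Perm (Fin n)

/-- The action of a signed permutation on coordinate vectors. -/
def SignedPerm.act {n : ℕ} {R : Type*} [CommRing R] (w : SignedPerm n) (v : Fin n → R) :
    Fin n → R :=
  fun i => (((w.1 i : ℤˣ) : ℤ) : R) * v (w.2 i)

/-- The sign `(-1)^{ℓ(w)}` of an element of the Weyl group, that is, the determinant of the
signed permutation. -/
def SignedPerm.sgn {n : ℕ} (w : SignedPerm n) : ℤˣ :=
  (∏ i, w.1 i) * Equiv.Perm.sign w.2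

/-- The roots `± e_i` and `± e_i ± e_j` (`i ≠ j`) of `B_n`. -/
def roots (n : ℕ) : Finset (Vec n) :=
  (univ.image fun p : Fin n × ℤˣ => (Pi.single p.1 ((p.2 : ℤ) : ℚ) : Vec n)) ∪
  ((univ.filter fun p : (Fin n × Fin n) × (ℤˣ × ℤˣ) => p.1.1 ≠ p.1.2).image fun p =>
    (Pi.single p.1.1 ((p.2.1 : ℤ) : ℚ) + Pi.single p.1.2 ((p.2.2 : ℤ) : ℚ) : Vec n))

/-- The vector `2ρ = ∑_{j=1}^n (2n - 2j + 1) e_j`. -/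
def twoRho (n : ℕ) : Fin n → ℤ := fun i => 2 * ((n : ℤ) - (i : ℤ)) - 1

/-- The Weyl vector `ρ = ½ ∑_{j=1}^n (2n - 2j + 1) e_j`. -/
def rho (n : ℕ) : Vec n := fun i => (twoRho n i : ℚ) / 2

/-- Dominant weights of `B_n`: the coordinates are all integers or all half-odd integers, and
they are weakly decreasing and non-negative. -/
def IsDominantWeight {n : ℕ} (μ : Vec n) : Prop :=
  ((∀ i, ∃ z : ℤ, μ i = z) ∨ (∀ i, ∃ z : ℤ, μ i = z + 1 / 2)) ∧ Antitone μ ∧ ∀ i, 0 ≤ μ i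

/-- The set `Π⁺` of dominant weights. -/
abbrev DominantWeight (n : ℕ) := {μ : Vec n // IsDominantWeight μ}

/-- The vector `e_1 + ⋯ + e_m`. -/
def firstOnes (n m : ℕ) (R : Type*) [Zero R] [One R] : Fin n → R :=
  fun i => if (i : ℕ) < m then 1 else 0

theorem isDominantWeight_firstOnes (n m : ℕ) : IsDominantWeight (firstOnes n m ℚ) := by
  refine ⟨Or.inl fun i => ?_, fun i j hij => ?_, fun i => ?_⟩
  · by_cases h : (i : ℕ) < m
    · exact ⟨1, by simp [firstOnes, h]⟩
    · exact ⟨0, by simp [firstOnes, h]⟩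
  · have : (i : ℕ) ≤ j := hij
    by_cases h : (j : ℕ) < m
    · have h' : (i : ℕ) < m := by omega
      simp [firstOnes, h, h']
    · by_cases h' : (i : ℕ) < m <;> simp [firstOnes, h, h']
  · by_cases h : (i : ℕ) < m <;> simp [firstOnes, h]

/-- The dominant weight `e_1 + ⋯ + e_m`. It is `ω_m` for `m < n` (with `ω_0 = 0`), and `2 ω_n`
for `m = n`. -/
def omega (n m : ℕ) : DominantWeight n := ⟨firstOnes n m ℚ, isDominantWeight_firstOnes n m⟩

/-! ### Weyl characters -/

/-- The group algebra of formal exponentials `e^μ`. -/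
abbrev GroupAlg (n : ℕ) := AddMonoidAlgebra ℂ (Vec n)

/-- The formal exponential `e^μ`. -/
noncomputable def fexp {n : ℕ} (μ : Vec n) : GroupAlg n := AddMonoidAlgebra.single μ 1

/-- The alternating sum `∑_w (-1)^{ℓ(w)} e^{w ν}`. -/
noncomputable def alternant {n : ℕ} (ν : Vec n) : GroupAlg n :=
  ∑ w : SignedPerm n, ((w.sgn : ℤ) : ℂ) • fexp (w.act ν)

/-- The character `χ(λ)` of the irreducible representation of highest weight `λ`, by Weyl's
character formula, as an element of the field of fractions of the group algebra. -/
noncomputable def weylCharacter {n : ℕ} (lam : DominantWeight n) : FractionRing (GroupAlg n) :=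
  algebraMap (GroupAlg n) _ (alternant (lam.1 + rho n)) /
    algebraMap (GroupAlg n) _ (alternant (rho n))

/-! ### The Macdonald kernel -/

/-- Formal power series in `q = X 0` and `t = X 1` over the group algebra. -/
abbrev KernelRing (n : ℕ) := MvPowerSeries (Fin 2) (GroupAlg n)

/-- The series `(1 - q^{i+1} e^α) / (1 - t q^i e^α)`. -/
noncomputable def rootFactor {n : ℕ} (i : ℕ) (α : Vec n) : KernelRing n :=
  (1 - MvPowerSeries.C (fexp α) * MvPowerSeries.X 0 ^ (i + 1)) *
    MvPowerSeries.invOfUnit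
      (1 - MvPowerSeries.C (fexp α) * (MvPowerSeries.X 1 * MvPowerSeries.X 0 ^ i)) 1

/-- The `i`-th factor of the Macdonald kernel: the product of
`(1 - q^{i+1} e^α) / (1 - t q^i e^α)` over all weights `α` of the adjoint representation with
multiplicities, that is, over the zero weight (`n` times) and over the roots. -/
noncomputable def kernelFactor (n i : ℕ) : KernelRing n :=
  rootFactor i 0 ^ n * ∏ α ∈ roots n, rootFactor i α

/-- The Macdonald kernel `Δ(q, t) = ∏_{i ≥ 0} ∏_α (1 - q^{i+1} e^α) / (1 - t q^i e^α)`.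
The `i`-th factor is `1` modulo `q^i`, so that the coefficient of `q^a t^b` in the infinite
product is the one in the product of the first `a + 1` factors; see `coeff_prod_kernelFactor`. -/
noncomputable def macdonaldKernel (n : ℕ) : KernelRing n :=
  fun d => MvPowerSeries.coeff d (∏ i ∈ range (d 0 + 1), kernelFactor n i)

/-- `C` is the family of coefficients in the expansion `Δ(q,t) = ∑_λ C_λ(q,t) χ(λ)` of the
Macdonald kernel, `λ` running over the dominant weights: for each monomial in `q, t`, only
finitely many `λ` contribute, and the coefficients of this monomial agree. -/
def IsKernelExpansion (n : ℕ) (C : DominantWeight n → MvPowerSeries (Fin 2) ℂ) : Prop :=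
  ∀ d : Fin 2 →₀ ℕ, {lam | MvPowerSeries.coeff d (C lam) ≠ 0}.Finite ∧
    algebraMap (GroupAlg n) (FractionRing (GroupAlg n))
        (MvPowerSeries.coeff d (macdonaldKernel n)) =
      ∑ᶠ lam, algebraMap ℂ (FractionRing (GroupAlg n)) (MvPowerSeries.coeff d (C lam)) *
        weylCharacter lam

/-! ### The kernel as an infinite product, and existence and uniqueness of its expansion -/

section Expansion

variable {n : ℕ}

theorem constantCoeff_denominator (i : ℕ) (α : Vec n) :
    MvPowerSeries.constantCoeff (1 - MvPowerSeries.C (fexp α) *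
      (MvPowerSeries.X 1 * MvPowerSeries.X 0 ^ i) : KernelRing n) =
      ((1 : (GroupAlg n)ˣ) : GroupAlg n) := by
  simp

theorem denominator_mul (i : ℕ) (α : Vec n) :
    (1 - MvPowerSeries.C (fexp α) *
      (MvPowerSeries.X 1 * MvPowerSeries.X 0 ^ i) : KernelRing n) * rootFactor i α =
      1 - MvPowerSeries.C (fexp α) * MvPowerSeries.X 0 ^ (i + 1) := by
  have h := MvPowerSeries.mul_invOfUnit _ 1 (constantCoeff_denominator i α)
  rw [rootFactor, mul_left_comm, h, mul_one]

theorem dvd_rootFactor_sub_one (i : ℕ) (α : Vec n) :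
    (MvPowerSeries.X 0 ^ i : KernelRing n) ∣ rootFactor i α - 1 := by
  have h := MvPowerSeries.invOfUnit_mul _ 1 (constantCoeff_denominator i α)
  have h2 := denominator_mul i α
  refine ⟨MvPowerSeries.invOfUnit (1 - MvPowerSeries.C (fexp α) *
      (MvPowerSeries.X 1 * MvPowerSeries.X 0 ^ i) : KernelRing n) 1 *
      MvPowerSeries.C (fexp α) * (MvPowerSeries.X 1 - MvPowerSeries.X 0), ?_⟩
  unfold rootFactor
  linear_combination (1 : KernelRing n) * h

theorem dvd_mul_sub_one {R : Type*} [CommRing R] {x a b : R} (ha : x ∣ a - 1) (hb : x ∣ b - 1) :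
    x ∣ a * b - 1 := by
  have : a * b - 1 = a * (b - 1) + (a - 1) := by ring
  rw [this]
  exact dvd_add (Dvd.dvd.mul_left hb a) ha

theorem dvd_kernelFactor_sub_one (n i : ℕ) :
    (MvPowerSeries.X 0 ^ i : KernelRing n) ∣ kernelFactor n i - 1 := by
  refine dvd_mul_sub_one ?_ ?_
  · have key : ∀ M : ℕ, (MvPowerSeries.X 0 ^ i : KernelRing n) ∣
        rootFactor i (0 : Vec n) ^ M - 1 := by
      intro M
      induction M with
      | zero => simp
      | succ M ih => rw [pow_succ]; exact dvd_mul_sub_one ih (dvd_rootFactor_sub_one i 0)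
    exact key n
  · refine Finset.prod_induction _ (fun F => (MvPowerSeries.X 0 ^ i : KernelRing n) ∣ F - 1)
      (fun a b => dvd_mul_sub_one) (by simp) (fun α _ => dvd_rootFactor_sub_one i α)

theorem coeff_mul_kernelFactor (F : KernelRing n) (i : ℕ) (d : Fin 2 →₀ ℕ) (h : d 0 < i) :
    MvPowerSeries.coeff d (F * kernelFactor n i) = MvPowerSeries.coeff d F := by
  obtain ⟨G, hG⟩ := dvd_kernelFactor_sub_one n i
  have : F * kernelFactor n i = F + MvPowerSeries.X 0 ^ i * (F * G) := by
    linear_combination F * hG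
  rw [this, map_add, add_eq_left]
  have hd : (MvPowerSeries.X 0 ^ i : KernelRing n) ∣ MvPowerSeries.X 0 ^ i * (F * G) :=
    dvd_mul_right _ _
  exact (MvPowerSeries.X_pow_dvd_iff.mp hd) d h

/-- All sufficiently long finite products have the same coefficient as `macdonaldKernel`. -/
theorem coeff_prod_kernelFactor (n : ℕ) (d : Fin 2 →₀ ℕ) (N : ℕ) (hN : d 0 < N) :
    MvPowerSeries.coeff d (∏ i ∈ range N, kernelFactor n i) =
      MvPowerSeries.coeff d (macdonaldKernel n) := by
  induction N, hN using Nat.le_induction with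
  | base => rfl
  | succ N hN ih => rw [prod_range_succ, coeff_mul_kernelFactor _ _ _ hN, ih]

namespace SignedPerm

/-- Composition of signed permutations. -/
def comp (w w' : SignedPerm n) : SignedPerm n := (fun i => w.1 i * w'.1 (w.2 i), w'.2 * w.2)

theorem act_comp {R : Type*} [CommRing R] (w w' : SignedPerm n) (v : Fin n → R) :
    (w.comp w').act v = w.act (w'.act v) := by
  funext i
  simp [act, comp, mul_assoc]

theorem sgn_comp (w w' : SignedPerm n) : (w.comp w').sgn = w.sgn * w'.sgn := by
  have : ∏ i, w'.1 (w.2 i) = ∏ i, w'.1 i := Equiv.prod_comp w.2 w'.1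
  simp only [sgn, comp, prod_mul_distrib, this, Equiv.Perm.sign_mul]
  ac_rfl

theorem comp_injective (w : SignedPerm n) : Function.Injective w.comp := by
  rintro ⟨ε, σ⟩ ⟨ε', σ'⟩ h
  simp only [comp, Prod.mk.injEq, mul_left_inj] at h
  obtain ⟨h1, h2⟩ := h
  refine Prod.ext ?_ h2
  funext i
  have := congrFun h1 (w.2.symm i)
  simpa using this

theorem comp_bijective (w : SignedPerm n) : Function.Bijective w.comp :=
  Finite.injective_iff_bijective.mp w.comp_injective

theorem act_injective (w : SignedPerm n) : Function.Injective (w.act : Vec n → Vec n) := by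
  intro u v h
  funext i
  have := congrFun h (w.2.symm i)
  simpa [act] using this

/-- The action as an additive homomorphism. -/
def actHom (w : SignedPerm n) : Vec n →+ Vec n where
  toFun := w.act
  map_zero' := by funext i; simp [act]
  map_add' u v := by funext i; simp [act, mul_add]

/-- The action on the group algebra. -/
noncomputable def algHom (w : SignedPerm n) : GroupAlg n →+* GroupAlg n :=
  AddMonoidAlgebra.mapDomainRingHom ℂ w.actHom

theorem algHom_fexp (w : SignedPerm n) (μ : Vec n) : w.algHom (fexp μ) = fexp (w.act μ) := by
  simp [algHom, fexp, actHom]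

theorem algHom_smul (w : SignedPerm n) (c : ℂ) (f : GroupAlg n) :
    w.algHom (c • f) = c • w.algHom f := by
  ext μ
  simp [algHom]

theorem coeff_algHom (w : SignedPerm n) (f : GroupAlg n) (μ : Vec n) :
    (w.algHom f).coeff (w.act μ) = f.coeff μ := by
  simp only [algHom, AddMonoidAlgebra.mapDomainRingHom_apply, AddMonoidAlgebra.coeff_mapDomain]
  exact Finsupp.mapDomain_apply (f := w.actHom) w.act_injective _ _

theorem sgn_mul_self (w : SignedPerm n) : (((w.sgn : ℤ) : ℂ)) * ((w.sgn : ℤ) : ℂ) = 1 := by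
  rcases Int.units_eq_one_or w.sgn with h | h <;> simp [h]

theorem algHom_alternant (w : SignedPerm n) (ν : Vec n) :
    w.algHom (alternant ν) = ((w.sgn : ℤ) : ℂ) • alternant ν := by
  unfold alternant
  rw [map_sum, Finset.smul_sum, ← (w.comp_bijective).sum_comp
    (fun w' : SignedPerm n => ((w.sgn : ℤ) : ℂ) • ((w'.sgn : ℤ) : ℂ) • fexp (w'.act ν))]
  refine Finset.sum_congr rfl fun w' _ => ?_
  rw [algHom_smul, algHom_fexp, act_comp, sgn_comp, smul_smul]
  congr 1
  push_cast
  rw [← mul_assoc, sgn_mul_self, one_mul]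

theorem act_single (w : SignedPerm n) (i : Fin n) (c : ℚ) :
    w.act (Pi.single i c : Vec n) =
      Pi.single (w.2.symm i) (((w.1 (w.2.symm i) : ℤˣ) : ℤ) * c) := by
  funext j
  by_cases h : j = w.2.symm i
  · subst h; simp [act]
  · have h' : w.2 j ≠ i := fun h' => h (by rw [← h']; simp)
    simp [act, h, h']

theorem act_mem_roots (w : SignedPerm n) {α : Vec n} (h : α ∈ roots n) : w.act α ∈ roots n := by
  simp only [roots, mem_union, mem_image, mem_univ, true_and, mem_filter] at h ⊢
  rcases h with ⟨p, rfl⟩ | ⟨p, hp, rfl⟩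
  · refine Or.inl ⟨(w.2.symm p.1, w.1 (w.2.symm p.1) * p.2), ?_⟩
    simp [act_single]
  · refine Or.inr ⟨((w.2.symm p.1.1, w.2.symm p.1.2),
      (w.1 (w.2.symm p.1.1) * p.2.1, w.1 (w.2.symm p.1.2) * p.2.2)), by simpa using hp, ?_⟩
    have hadd := w.actHom.map_add (Pi.single p.1.1 ((p.2.1 : ℤ) : ℚ))
      (Pi.single p.1.2 ((p.2.2 : ℤ) : ℚ))
    change w.act _ = w.act _ + w.act _ at hadd
    rw [hadd]
    simp [act_single]

end SignedPerm

theorem map_rootFactor {A : Type*} [CommRing A] (h : A →+* GroupAlg n) (x : A) (α : Vec n)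
    (hx : h x = fexp α) (i : ℕ) :
    MvPowerSeries.map h ((1 - MvPowerSeries.C x * MvPowerSeries.X 0 ^ (i + 1)) *
      MvPowerSeries.invOfUnit
        (1 - MvPowerSeries.C x * (MvPowerSeries.X 1 * MvPowerSeries.X 0 ^ i)) 1 :
        MvPowerSeries (Fin 2) A) = rootFactor i α := by
  have h0 : MvPowerSeries.constantCoeff (1 - MvPowerSeries.C x *
      (MvPowerSeries.X 1 * MvPowerSeries.X 0 ^ i) : MvPowerSeries (Fin 2) A) =
      ((1 : Aˣ) : A) := by simp
  have h1 := congrArg (MvPowerSeries.map h) (MvPowerSeries.mul_invOfUnit _ 1 h0)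
  have h2 := MvPowerSeries.mul_invOfUnit _ 1 (constantCoeff_denominator i α)
  rw [rootFactor, map_mul]
  simp only [map_mul, map_sub, map_one, map_pow, MvPowerSeries.map_C, MvPowerSeries.map_X, hx]
    at h1 ⊢
  congr 1
  exact left_inv_eq_right_inv ((mul_comm _ _).trans h1) h2

theorem map_kernelFactor (w : SignedPerm n) (i : ℕ) :
    MvPowerSeries.map w.algHom (kernelFactor n i) = kernelFactor n i := by
  have h0 : ∀ α : Vec n, MvPowerSeries.map w.algHom (rootFactor i α) = rootFactor i (w.act α) :=
    fun α => map_rootFactor w.algHom (fexp α) (w.act α) (w.algHom_fexp α) i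
  have hr : (roots n).image w.act = roots n := by
    refine Finset.eq_of_subset_of_card_le ?_ ?_
    · intro β hβ
      obtain ⟨α, hα, rfl⟩ := mem_image.mp hβ
      exact w.act_mem_roots hα
    · rw [card_image_of_injective _ w.act_injective]
  have hz : w.act (0 : Vec n) = 0 := w.actHom.map_zero
  rw [kernelFactor, map_mul, map_pow, map_prod, h0, hz]
  congr 1
  conv_rhs => rw [← hr, prod_image w.act_injective.injOn]
  exact prod_congr rfl fun α _ => h0 α

/-- The coefficients of the kernel are invariant under the Weyl group. -/
theorem algHom_coeff_macdonaldKernel (w : SignedPerm n) (d : Fin 2 →₀ ℕ) :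
    w.algHom (MvPowerSeries.coeff d (macdonaldKernel n)) =
      MvPowerSeries.coeff d (macdonaldKernel n) := by
  rw [← coeff_prod_kernelFactor n d _ (Nat.lt_succ_self _), ← MvPowerSeries.coeff_map, map_prod]
  simp only [map_kernelFactor]

/-- The inclusion of the lattice `ℤ^n`. -/
def intVec (n : ℕ) : (Fin n → ℤ) →+ Vec n where
  toFun v i := v i
  map_zero' := by funext i; simp
  map_add' u v := by funext i; simp

/-- The exponents that occur in the kernel have integral coordinates. -/
theorem integral_of_coeff_ne_zero (d : Fin 2 →₀ ℕ) (μ : Vec n)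
    (h : (MvPowerSeries.coeff d (macdonaldKernel n)).coeff μ ≠ 0) :
    ∃ z : Fin n → ℤ, μ = intVec n z := by
  set f := AddMonoidAlgebra.mapDomainRingHom ℂ (intVec n) with hf
  have h1 : ∀ (i : ℕ) (z : Fin n → ℤ), rootFactor i (intVec n z) ∈
      (MvPowerSeries.map (σ := Fin 2) f).range := fun i z =>
    ⟨_, map_rootFactor f (AddMonoidAlgebra.single z 1) _ (by simp [hf, fexp]) i⟩
  have h2 : ∀ α ∈ roots n, ∃ z, α = intVec n z := by
    intro α hα
    simp only [roots, mem_union, mem_image, mem_univ, true_and, mem_filter] at hα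
    have hs : ∀ (i : Fin n) (c : ℤ), (Pi.single i (c : ℚ) : Vec n) =
        intVec n (Pi.single i c) := by
      intro i c
      funext j
      by_cases hj : j = i
      · subst hj; simp [intVec]
      · simp [intVec, hj]
    rcases hα with ⟨p, rfl⟩ | ⟨p, -, rfl⟩
    · exact ⟨_, hs _ _⟩
    · exact ⟨_, by rw [hs, hs, ← map_add]⟩
  have h3 : ∀ i, kernelFactor n i ∈ (MvPowerSeries.map (σ := Fin 2) f).range := by
    intro i
    refine Subring.mul_mem _ (Subring.pow_mem _ ?_ _) (Subring.prod_mem _ fun α hα => ?_)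
    · simpa using h1 i 0
    · obtain ⟨z, rfl⟩ := h2 α hα
      exact h1 i z
  obtain ⟨G, hG⟩ := Subring.prod_mem (MvPowerSeries.map (σ := Fin 2) f).range
    (t := range (d 0 + 1)) (f := kernelFactor n) fun i _ => h3 i
  rw [← coeff_prod_kernelFactor n d _ (Nat.lt_succ_self _), ← hG, MvPowerSeries.coeff_map, hf,
    AddMonoidAlgebra.mapDomainRingHom_apply, AddMonoidAlgebra.coeff_mapDomain] at h
  obtain ⟨z, -, hz⟩ := Finset.mem_image.mp
    (Finsupp.mapDomain_support (Finsupp.mem_support_iff.mpr h))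
  exact ⟨z, hz.symm⟩

theorem strictAnti_add_rho (lam : DominantWeight n) : StrictAnti (lam.1 + rho n) := by
  intro i j hij
  have h1 := lam.2.2.1 hij.le
  have h2 : ((i : ℕ) : ℚ) < ((j : ℕ) : ℚ) := by exact_mod_cast hij
  simp only [Pi.add_apply, rho, twoRho]
  push_cast
  linarith

theorem add_rho_pos (lam : DominantWeight n) (i : Fin n) : 0 < (lam.1 + rho n) i := by
  have h1 := lam.2.2.2 i
  have h2 : ((i : ℕ) : ℚ) + 1 ≤ (n : ℚ) := by exact_mod_cast i.2
  simp only [Pi.add_apply, rho, twoRho]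
  push_cast
  linarith

/-- A signed permutation that carries one strictly dominant vector to another is trivial. -/
theorem eq_one_of_act {u v : Vec n} (hu : StrictAnti u) (hu' : ∀ i, 0 < u i) (hv : StrictAnti v)
    (hv' : ∀ i, 0 < v i) (w : SignedPerm n) (h : w.act u = v) : w = (fun _ => 1, 1) := by
  obtain ⟨ε, σ⟩ := w
  have hε : ε = fun _ => 1 := by
    funext i
    rcases Int.units_eq_one_or (ε i) with h1 | h1
    · exact h1
    · exfalso
      have := congrFun h i
      simp only [SignedPerm.act, h1] at this
      have a := hu' (σ i)
      have b := hv' i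
      push_cast at this
      linarith
  subst hε
  have h2 : ∀ i, u (σ i) = v i := fun i => by simpa [SignedPerm.act] using congrFun h i
  have h3 : StrictMono σ := by
    intro i j hij
    have := hv hij
    rw [← h2, ← h2] at this
    exact hu.lt_iff_gt.mp this
  have h4 : (σ : Fin n → Fin n) = id := h3.eq_id
  exact Prod.ext rfl (Equiv.ext fun i => congrFun h4 i)

theorem act_one (v : Vec n) : SignedPerm.act ((fun _ => 1, 1) : SignedPerm n) v = v := by
  funext i; simp [SignedPerm.act]

/-- The inverse of a signed permutation. -/
theorem exists_inv (w : SignedPerm n) : ∃ w' : SignedPerm n, w'.comp w = (fun _ => 1, 1) :=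
  ⟨(fun i => w.1 (w.2.symm i), w.2.symm), by
    refine Prod.ext ?_ ?_
    · funext i
      change w.1 (w.2.symm i) * w.1 (w.2.symm i) = 1
      exact Int.units_mul_self _
    · change w.2 * w.2⁻¹ = 1
      simp⟩

theorem coeff_alternant (ν μ : Vec n) : (alternant ν).coeff μ =
    ∑ w : SignedPerm n, if w.act ν = μ then ((w.sgn : ℤ) : ℂ) else 0 := by
  simp [alternant, fexp, Finsupp.finsetSum_apply, Finsupp.single_apply]

theorem coeff_alternant_dominant (lam mu : DominantWeight n) :
    (alternant (lam.1 + rho n)).coeff (mu.1 + rho n) = if lam = mu then 1 else 0 := by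
  rw [coeff_alternant, Finset.sum_eq_single (fun _ => 1, 1)]
  · rw [act_one]
    have : (lam.1 + rho n = mu.1 + rho n) ↔ lam = mu := by rw [add_left_inj, Subtype.ext_iff]
    simp [this, SignedPerm.sgn]
  · intro w _ hw
    rw [if_neg]
    exact fun h => hw (eq_one_of_act (strictAnti_add_rho lam) (add_rho_pos lam)
      (strictAnti_add_rho mu) (add_rho_pos mu) w h)
  · simp

/-- A skew element with half-odd exponents vanishes if it has no strictly dominant exponent. -/
theorem eq_zero_of_skew (g : GroupAlg n)
    (hskew : ∀ (w : SignedPerm n) (μ : Vec n),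
      g.coeff (w.act μ) = ((w.sgn : ℤ) : ℂ) * g.coeff μ)
    (hsupp : ∀ μ, g.coeff μ ≠ 0 → ∃ z : Fin n → ℤ, ∀ i, μ i = z i + 1 / 2)
    (hdom : ∀ lam : DominantWeight n, g.coeff (lam.1 + rho n) = 0) : g = 0 := by
  have hne : ∀ (w : SignedPerm n) (μ : Vec n), g.coeff μ ≠ 0 → g.coeff (w.act μ) ≠ 0 := by
    intro w μ h
    rw [hskew]
    refine mul_ne_zero ?_ h
    rcases Int.units_eq_one_or w.sgn with h | h <;> simp [h]
  ext ν
  by_contra hν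
  change g.coeff ν ≠ 0 at hν
  -- make all coordinates positive
  obtain ⟨a, ha, ha0⟩ : ∃ a : Vec n, g.coeff a ≠ 0 ∧ ∀ i, 0 < a i := by
    refine ⟨_, hne ((fun i => if 0 < ν i then 1 else -1), 1) ν hν, fun i => ?_⟩
    obtain ⟨z, hz⟩ := hsupp ν hν
    have hi : ν i ≠ 0 := by
      rw [hz]
      intro h
      have h2 : ((2 * z i + 1 : ℤ) : ℚ) = 0 := by push_cast; linarith
      have h3 : 2 * z i + 1 = 0 := by exact_mod_cast h2
      omega
    by_cases h : 0 < ν i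
    · simp [SignedPerm.act, h]
    · have : ν i < 0 := lt_of_le_of_ne (not_lt.mp h) hi
      simp [SignedPerm.act, h, this]
  -- sort the coordinates
  obtain ⟨b, hb, hb0, hba⟩ : ∃ b : Vec n, g.coeff b ≠ 0 ∧ (∀ i, 0 < b i) ∧ Antitone b := by
    have h1 : SignedPerm.act ((fun _ => 1, Tuple.sort (-a)) : SignedPerm n) a =
        a ∘ Tuple.sort (-a) := by
      funext i; simp [SignedPerm.act]
    refine ⟨a ∘ Tuple.sort (-a), ?_, fun i => ha0 _, fun i j hij => ?_⟩
    · rw [← h1]; exact hne _ _ ha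
    · have := Tuple.monotone_sort (-a) hij
      simp only [Function.comp_apply, Pi.neg_apply, neg_le_neg_iff] at this
      exact this
  obtain ⟨z, hz⟩ := hsupp b hb
  by_cases hinj : Function.Injective b
  · have hstep : ∀ (k : ℕ) (i j : Fin n), (j : ℕ) = i + k → b j + k ≤ b i := by
      intro k
      induction k with
      | zero =>
        intro i j h
        have : i = j := Fin.ext (by omega)
        simp [this]
      | succ k ih =>
        intro i j h
        have hj := j.2
        have h1 := ih i ⟨i + k, by omega⟩ rfl
        have hlt : (⟨i + k, by omega⟩ : Fin n) < j := Fin.lt_def.mpr (by simp; omega)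
        have h2 : b j < b ⟨i + k, by omega⟩ :=
          lt_of_le_of_ne (hba hlt.le) fun h => hlt.ne' (hinj h)
        have h3 : b j + 1 ≤ b ⟨i + k, by omega⟩ := by
          rw [hz, hz] at h2 ⊢
          have h4 : z j < z ⟨i + k, by omega⟩ := by
            have : (z j : ℚ) < z ⟨i + k, by omega⟩ := by linarith
            exact_mod_cast this
          have h5 : (z j : ℚ) + 1 ≤ z ⟨i + k, by omega⟩ := by exact_mod_cast h4
          linarith
        push_cast
        linarith
    have hl : IsDominantWeight (b - rho n) := by
      refine ⟨Or.inl fun i => ⟨z i + 1 - (n - i), ?_⟩, fun i j hij => ?_, fun i => ?_⟩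
      · simp only [Pi.sub_apply, hz, rho, twoRho]
        push_cast
        ring
      · have hij' : (i : ℕ) ≤ j := hij
        have h1 := hstep ((j : ℕ) - i) i j (by omega)
        rw [Nat.cast_sub hij'] at h1
        simp only [Pi.sub_apply, rho, twoRho]
        push_cast
        linarith
      · have hi := i.2
        have h1 := hstep (n - 1 - i) i ⟨n - 1, by omega⟩ (by simp; omega)
        have h2 := hb0 ⟨n - 1, by omega⟩
        have h3 : (1 : ℚ) / 2 ≤ b ⟨n - 1, by omega⟩ := by
          rw [hz] at h2 ⊢
          have h4 : (0 : ℚ) < ((2 * z ⟨n - 1, by omega⟩ + 1 : ℤ) : ℚ) := by push_cast; linarith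
          have h5 : 0 < 2 * z ⟨n - 1, by omega⟩ + 1 := by exact_mod_cast h4
          have h6 : 0 ≤ z ⟨n - 1, by omega⟩ := by omega
          have h7 : (0 : ℚ) ≤ z ⟨n - 1, by omega⟩ := by exact_mod_cast h6
          linarith
        have h8 : ((n - 1 - i : ℕ) : ℚ) = (n : ℚ) - 1 - i := by
          rw [Nat.cast_sub (by omega), Nat.cast_sub (by omega)]
          simp
        rw [h8] at h1
        simp only [Pi.sub_apply, rho, twoRho]
        push_cast
        linarith
    exact hb (by simpa using hdom ⟨_, hl⟩)
  · rw [Function.Injective] at hinj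
    push Not at hinj
    obtain ⟨i, j, hij, hne'⟩ := hinj
    have h1 : SignedPerm.act ((fun _ => 1, Equiv.swap i j) : SignedPerm n) b = b := by
      funext k
      rcases eq_or_ne k i with rfl | hki
      · simp [SignedPerm.act, hij]
      · rcases eq_or_ne k j with rfl | hkj
        · simp [SignedPerm.act, hij]
        · simp [SignedPerm.act, Equiv.swap_apply_of_ne_of_ne hki hkj]
    have h2 := hskew (fun _ => 1, Equiv.swap i j) b
    rw [h1] at h2
    simp only [SignedPerm.sgn, prod_const_one, one_mul, Equiv.Perm.sign_swap hne'] at h2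
    apply hb
    have h3 : g.coeff b = -g.coeff b := by simpa using h2
    exact self_eq_neg.mp h3

theorem skew_of_algHom (g : GroupAlg n)
    (h : ∀ w : SignedPerm n, w.algHom g = ((w.sgn : ℤ) : ℂ) • g) (w : SignedPerm n) (μ : Vec n) :
    g.coeff (w.act μ) = ((w.sgn : ℤ) : ℂ) * g.coeff μ := by
  have h1 := w.coeff_algHom g μ
  rw [h w] at h1
  simp only [AddMonoidAlgebra.coeff_smul, Finsupp.smul_apply, smul_eq_mul] at h1
  rw [← h1, ← mul_assoc, w.sgn_mul_self, one_mul]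

theorem exists_of_coeff_alternant_ne_zero (ν μ : Vec n) (h : (alternant ν).coeff μ ≠ 0) :
    ∃ w : SignedPerm n, w.act ν = μ := by
  by_contra hc
  push Not at hc
  exact h (by rw [coeff_alternant]; exact Finset.sum_eq_zero fun w _ => if_neg (hc w))

theorem half_act (w : SignedPerm n) (ν : Vec n) (h : ∃ z : Fin n → ℤ, ∀ i, ν i = z i + 1 / 2) :
    ∃ z : Fin n → ℤ, ∀ i, w.act ν i = z i + 1 / 2 := by
  obtain ⟨z, hz⟩ := h
  have : ∀ i, ∃ y : ℤ, w.act ν i = y + 1 / 2 := by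
    intro i
    rcases Int.units_eq_one_or (w.1 i) with h | h
    · exact ⟨z (w.2 i), by simp [SignedPerm.act, h, hz]⟩
    · exact ⟨-z (w.2 i) - 1, by simp [SignedPerm.act, h, hz]; ring⟩
  exact ⟨fun i => (this i).choose, fun i => (this i).choose_spec⟩

theorem half_rho (n : ℕ) : ∃ z : Fin n → ℤ, ∀ i, rho n i = z i + 1 / 2 :=
  ⟨fun i => n - i - 1, fun i => by simp only [rho, twoRho]; push_cast; ring⟩

theorem half_of_coeff_mul_ne_zero (d : Fin 2 →₀ ℕ) (μ : Vec n)
    (h : (MvPowerSeries.coeff d (macdonaldKernel n) * alternant (rho n)).coeff μ ≠ 0) :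
    ∃ z : Fin n → ℤ, ∀ i, μ i = z i + 1 / 2 := by
  classical
  obtain ⟨x, hx, y, hy, rfl⟩ := Finset.mem_add.mp
    (AddMonoidAlgebra.support_coeff_mul_subset _ _ (Finsupp.mem_support_iff.mpr h))
  obtain ⟨u, rfl⟩ := integral_of_coeff_ne_zero d x (Finsupp.mem_support_iff.mp hx)
  obtain ⟨w, rfl⟩ := exists_of_coeff_alternant_ne_zero _ _ (Finsupp.mem_support_iff.mp hy)
  obtain ⟨z, hz⟩ := half_act w _ (half_rho n)
  exact ⟨u + z, fun i => by simp [hz, intVec, add_assoc]⟩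

theorem half_dominant (lam : DominantWeight n) (μ : Vec n)
    (h : ∃ z : Fin n → ℤ, ∀ i, (lam.1 + rho n) i = z i + 1 / 2)
    (hμ : (alternant (lam.1 + rho n)).coeff μ ≠ 0) :
    ∃ z : Fin n → ℤ, ∀ i, μ i = z i + 1 / 2 := by
  obtain ⟨w, rfl⟩ := exists_of_coeff_alternant_ne_zero _ _ hμ
  exact half_act w _ h

theorem finite_dominant (g : GroupAlg n) :
    {lam : DominantWeight n | g.coeff (lam.1 + rho n) ≠ 0}.Finite := by
  refine Set.Finite.of_finite_image (f := fun lam => lam.1 + rho n)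
    (g.coeff.support.finite_toSet.subset ?_) ?_
  · rintro _ ⟨lam, h, rfl⟩
    exact Finsupp.mem_support_iff.mpr h
  · intro a _ b _ h
    exact Subtype.ext (add_right_cancel h)

/-- The coefficients of the kernel times the Weyl denominator, in terms of alternants. -/
theorem coeff_kernel_mul_alternant (d : Fin 2 →₀ ℕ) :
    MvPowerSeries.coeff d (macdonaldKernel n) * alternant (rho n) =
      ∑ lam ∈ (finite_dominant
        (MvPowerSeries.coeff d (macdonaldKernel n) * alternant (rho n))).toFinset,
        (MvPowerSeries.coeff d (macdonaldKernel n) * alternant (rho n)).coeff (lam.1 + rho n) •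
          alternant (lam.1 + rho n) := by
  set g := MvPowerSeries.coeff d (macdonaldKernel n) * alternant (rho n) with hg
  set S := (finite_dominant g).toFinset with hS
  rw [← sub_eq_zero]
  apply eq_zero_of_skew
  · apply skew_of_algHom
    intro w
    rw [map_sub, map_sum, smul_sub, smul_sum]
    congr 1
    · rw [hg, map_mul, algHom_coeff_macdonaldKernel, w.algHom_alternant, mul_smul_comm]
    · refine sum_congr rfl fun lam _ => ?_
      rw [w.algHom_smul, w.algHom_alternant, smul_comm]
  · intro μ hμ
    by_cases h1 : g.coeff μ = 0
    · have h2 : ∃ lam ∈ S, (g.coeff (lam.1 + rho n) • alternant (lam.1 + rho n)).coeff μ ≠ 0 := by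
        by_contra hc
        push Not at hc
        apply hμ
        rw [AddMonoidAlgebra.coeff_sub, Finsupp.sub_apply, h1, AddMonoidAlgebra.coeff_sum,
          Finsupp.finsetSum_apply, sum_eq_zero hc, sub_zero]
      obtain ⟨lam, hl, h3⟩ := h2
      have h4 : g.coeff (lam.1 + rho n) ≠ 0 := (finite_dominant g).mem_toFinset.mp hl
      refine half_dominant lam μ (half_of_coeff_mul_ne_zero d _ h4) fun h5 => h3 ?_
      simp [h5]
    · exact half_of_coeff_mul_ne_zero d μ h1
  · intro mu
    rw [AddMonoidAlgebra.coeff_sub, Finsupp.sub_apply, AddMonoidAlgebra.coeff_sum,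
      Finsupp.finsetSum_apply]
    simp only [AddMonoidAlgebra.coeff_smul, Finsupp.smul_apply, coeff_alternant_dominant,
      smul_eq_mul, mul_ite, mul_one, mul_zero, sum_ite_eq']
    by_cases hmu : g.coeff (mu.1 + rho n) = 0
    · simp [hmu]
    · rw [if_pos ((finite_dominant g).mem_toFinset.mpr hmu), sub_self]

theorem alternant_rho_ne_zero (n : ℕ) : alternant (rho n) ≠ 0 := by
  intro h
  have h1 := coeff_alternant_dominant (omega n 0) (omega n 0)
  have h2 : (omega n 0).1 = 0 := by funext i; simp [omega, firstOnes]
  rw [h2, zero_add, h] at h1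
  simp at h1

theorem algebraMap_mul_weylCharacter (c : ℂ) (lam : DominantWeight n) :
    algebraMap ℂ (FractionRing (GroupAlg n)) c * weylCharacter lam =
      algebraMap (GroupAlg n) (FractionRing (GroupAlg n)) (c • alternant (lam.1 + rho n)) /
        algebraMap (GroupAlg n) (FractionRing (GroupAlg n)) (alternant (rho n)) := by
  rw [weylCharacter, Algebra.smul_def, map_mul, ← IsScalarTower.algebraMap_apply, mul_div_assoc]

/-- The expansion of the Macdonald kernel exists, and the coefficients are unique. -/
theorem existsUnique_kernelExpansion (n : ℕ) : ∃! C, IsKernelExpansion n C := by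
  have hρ : algebraMap (GroupAlg n) (FractionRing (GroupAlg n)) (alternant (rho n)) ≠ 0 := by
    rw [Ne, FaithfulSMul.algebraMap_eq_zero_iff]
    exact alternant_rho_ne_zero n
  refine ⟨fun lam d => (MvPowerSeries.coeff d (macdonaldKernel n) * alternant (rho n)).coeff
    (lam.1 + rho n), fun d => ⟨finite_dominant _, ?_⟩, fun C hC => ?_⟩
  · rw [finsum_eq_sum_of_support_subset (s := (finite_dominant
      (MvPowerSeries.coeff d (macdonaldKernel n) * alternant (rho n))).toFinset)]
    · simp only [algebraMap_mul_weylCharacter]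
      rw [← sum_div, ← map_sum, eq_div_iff hρ, ← map_mul]
      exact congrArg _ (coeff_kernel_mul_alternant d)
    · intro lam hl
      rw [Set.Finite.coe_toFinset]
      exact fun h => hl (mul_eq_zero_of_left
        ((congrArg (algebraMap ℂ (FractionRing (GroupAlg n))) h).trans (map_zero _)) _)
  · funext mu
    ext d
    obtain ⟨hfin, h⟩ := hC d
    rw [finsum_eq_sum_of_support_subset (s := hfin.toFinset)] at h
    · simp only [algebraMap_mul_weylCharacter] at h
      rw [← sum_div, ← map_sum, eq_div_iff hρ, ← map_mul] at h
      have h1 := IsFractionRing.injective (GroupAlg n) (FractionRing (GroupAlg n)) h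
      change _ = (MvPowerSeries.coeff d (macdonaldKernel n) * alternant (rho n)).coeff _
      rw [h1, AddMonoidAlgebra.coeff_sum, Finsupp.finsetSum_apply]
      simp only [AddMonoidAlgebra.coeff_smul, Finsupp.smul_apply, coeff_alternant_dominant,
        smul_eq_mul, mul_ite, mul_one, mul_zero, sum_ite_eq']
      by_cases hmu : MvPowerSeries.coeff d (C mu) = 0
      · simp [hmu]
      · rw [if_pos (hfin.mem_toFinset.mpr hmu)]
    · intro lam hl
      rw [Set.Finite.coe_toFinset]
      exact fun h => hl (by
        change algebraMap ℂ _ _ * _ = 0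
        rw [h, map_zero, zero_mul])

end Expansion

/-! ### The specialized coefficients and the recurrences -/

/-- The coefficients `C_λ(q,t)`, `λ ∈ Π⁺`, of the Macdonald kernel `Δ(q,t) = ∑_λ C_λ(q,t) χ(λ)`,
as formal power series in `q` and `t`. -/
noncomputable def macdonaldCoeff (n : ℕ) : DominantWeight n → MvPowerSeries (Fin 2) ℂ :=
  (existsUnique_kernelExpansion n).choose

theorem isKernelExpansion_macdonaldCoeff (n : ℕ) : IsKernelExpansion n (macdonaldCoeff n) :=
  (existsUnique_kernelExpansion n).choose_spec.1

/-- The substitution `q ↦ -q`, `t ↦ q²`. -/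
noncomputable def specialization : Fin 2 → MvPowerSeries Unit ℂ :=
  ![-(PowerSeries.X : PowerSeries ℂ), (PowerSeries.X : PowerSeries ℂ) ^ 2]

theorem hasSubst_specialization : MvPowerSeries.HasSubst specialization := by
  refine MvPowerSeries.hasSubst_of_constantCoeff_zero fun s => ?_
  fin_cases s
  · change PowerSeries.constantCoeff (-(PowerSeries.X : PowerSeries ℂ)) = 0
    simp
  · change PowerSeries.constantCoeff ((PowerSeries.X : PowerSeries ℂ) ^ 2) = 0
    simp

/-- The variable `q` in the field of formal Laurent series. -/
noncomputable def q : LaurentSeries ℂ := HahnSeries.single 1 1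

/-- The specialized coefficient `C_λ(-q, q²)`, viewed in the field of Laurent series in `q`. -/
noncomputable def specializedCoeff (n : ℕ) (lam : DominantWeight n) : LaurentSeries ℂ :=
  ((MvPowerSeries.subst specialization (macdonaldCoeff n lam) : PowerSeries ℂ) : LaurentSeries ℂ)

/-- `c_m = (1 - q^{2m}) / (1 - q²) · q^{-2n+1} (1 + q^{4n-2m+1})`. -/
noncomputable def c (n m : ℕ) : LaurentSeries ℂ :=
  (1 - q ^ (2 * m)) / (1 - q ^ 2) * q ^ (-2 * (n : ℤ) + 1) *
    (1 + q ^ (4 * (n : ℤ) - 2 * (m : ℤ) + 1))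

/-- `b_m = (q + 1) q^{-2m+2} (1 - q^{4m-2}) / (1 - q²)`. -/
noncomputable def b (m : ℕ) : LaurentSeries ℂ :=
  (q + 1) * q ^ (-2 * (m : ℤ) + 2) * ((1 - q ^ (4 * (m : ℤ) - 2)) / (1 - q ^ 2))

open Classical in
/-- The extension of a family `a_λ`, `λ ∈ Π⁺`, to all weights: `a_μ = (-1)^{ℓ(w)} a_λ` if
`w (μ + ρ) = λ + ρ` with `λ` dominant, and `a_μ = 0` if there are no such `w` and `λ`, that is, if
`μ + ρ` is not regular. (At most one summand is non-zero, since `λ + ρ` is strictly dominant.) -/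
noncomputable def extend {n : ℕ} (a : DominantWeight n → LaurentSeries ℂ) (μ : Vec n) :
    LaurentSeries ℂ :=
  ∑ w : SignedPerm n,
    if h : IsDominantWeight (w.act (μ + rho n) - rho n) then
      ((w.sgn : ℤ) : LaurentSeries ℂ) * a ⟨_, h⟩ else 0

/-- The minuscule recurrence for `λ = e_1 + ⋯ + e_k` (`1 ≤ k ≤ n`) and the minuscule coweight
`ω = e_1`, specialized at `q ↦ -q`, `t ↦ q²`:
`∑_i a_{w_i λ} ∑_{ψ ∈ W_λ ω} (q^{-2(ρ, w_i ψ)} + q^{1 + 2(ρ, w_i ψ)}) = 0`,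
where `w_i` runs over coset representatives of `W / W_λ`. As `i` and `ψ` vary, the pair
`(w_i λ, w_i ψ)` runs exactly once through the orbit of `(λ, ω)` under `W`. -/
def MinusculeRecurrence (n : ℕ) (a : DominantWeight n → LaurentSeries ℂ) (k : ℕ) : Prop :=
  ∑ p ∈ univ.image fun w : SignedPerm n => (w.act (firstOnes n k ℚ), w.act (firstOnes n 1 ℤ)),
    extend a p.1 *
      (q ^ (-(∑ i, twoRho n i * p.2 i)) + q ^ (1 + ∑ i, twoRho n i * p.2 i)) = 0

/-- The simplified form of the recurrence, for `λ = e_1 + ⋯ + e_m` (`1 ≤ m ≤ n`):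
`a_m c_m = ∑_{i=1}^{⌊(m+1)/2⌋} a_{m-2i+1} b_i + ∑_{i=1}^{⌊m/2⌋} a_{m-2i} b_{n-m+i+1}`,
where `a_j` is the value of the family at `e_1 + ⋯ + e_j`. -/
def SimplifiedRecurrence (n : ℕ) (a : DominantWeight n → LaurentSeries ℂ) (m : ℕ) : Prop :=
  a (omega n m) * c n m =
    ∑ i ∈ Icc 1 ((m + 1) / 2), a (omega n (m + 1 - 2 * i)) * b i +
      ∑ i ∈ Icc 1 (m / 2), a (omega n (m - 2 * i)) * b (n - m + i + 1)

end TypeB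

/-! Part (2) is a straightening computation. The orbit of (λ_k, e_1) consists of the words in {0, 1,
-1}^n with k non-zero letters, one of which is marked; the pair contributes the extended value of
the word times the weight of the marked letter, `plusWeight d` or `minusWeight d` for d letters
after it. Let y mark the non-zero letters, so that the k-th recurrence says that the coefficient of
y^k in `orbitPolynomial` vanishes. Skewness under the dot action kills a word containing 0 1, -1 0
or -1 -1, and replaces -1 1 by 0 0, and a last -1 by 0, each with a sign. What survives is 1^p
followed by zeros, dominoes (-1, 1) and possibly a last -1, with value ± a_{λ_p}. The weights of the
p initial ones add up to c_p. The weight of a domino is b_{d+1} - b_d, where d letters follow its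
first letter, and that of a last -1 is b_1.

Let Z(N) be the signed generating polynomial of the tails of length N (`signedCount`). Summation by
parts shows that the weighted sum over tails of length N is -∑_j y^j Z(N-j) β_j, where β runs
through b_1, b_N, b_2, b_{N-1}, … (`signedWeight_eq`). Collecting powers of y, `orbitPolynomial`
becomes ∑_j y^j Z(n-j) D_j, where D_j is the difference of the two sides of the j-th simplified
recurrence (`orbitPolynomial_eq`). Since Z has constant term 1 and D_0 = 0, the coefficients of y,
…, y^m vanish if and only if D_1, …, D_m do.

For part (1) it then suffices that the C_λ satisfy the minuscule recurrences. Under q ↦ -q, t ↦ q²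
the kernel telescopes to the finite product of the factors 1 + q e^α. Let F be this product times
the Weyl denominator. Its coefficients are skew, so the extended C_μ is the coefficient of F at μ +
ρ. Summing over W instead of the orbit, the recurrence says that F S(q⁻¹) + q F S(q) has coefficient
0 at λ, where S(c) = ∑_w (-1)^{ℓ(w)} c^{2(wρ)_1} e^{-wρ}. Writing both denominators as products, one
sees that e^μ ↦ (-q)^{μ_1} e^μ carries F S(q) to F S(q⁻¹), because it exchanges factors of the
kernel with factors of the denominators (`headFactor_twist`, `bodyFactor_twist`). As λ has first
coordinate 1, the two coefficients differ by the factor -q, and the sum cancels. -/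

namespace TypeB

open Finset

/-! ### Skew-symmetric functions on the weights -/

section Skew

variable {n : ℕ}

namespace SignedPerm

/-- The inverse of a signed permutation. -/
def inv (w : SignedPerm n) : SignedPerm n := (fun i => w.1 (w.2.symm i), w.2.symm)

theorem inv_inv (w : SignedPerm n) : w.inv.inv = w := by
  ext i <;> simp [inv]

theorem act_act_inv {R : Type*} [CommRing R] (w : SignedPerm n) (v : Fin n → R) :
    w.act (w.inv.act v) = v := by
  funext i
  rcases Int.units_eq_one_or (w.1 i) with h | h <;> simp [act, inv, h]

theorem sgn_inv (w : SignedPerm n) : w.inv.sgn = w.sgn := by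
  have : ∏ i, w.1 (w.2.symm i) = ∏ i, w.1 i := Equiv.prod_comp w.2.symm w.1
  simp [sgn, inv, this]

theorem inv_bijective : Function.Bijective (inv : SignedPerm n → SignedPerm n) :=
  Function.Involutive.bijective inv_inv

theorem comp_right_bijective (w : SignedPerm n) :
    Function.Bijective fun w' : SignedPerm n => w'.comp w := by
  refine Finite.injective_iff_bijective.mp ?_
  rintro ⟨ε, σ⟩ ⟨ε', σ'⟩ h
  simp only [comp, Prod.mk.injEq, mul_right_inj] at h
  obtain ⟨h1, rfl⟩ := h
  refine Prod.ext ?_ rfl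
  funext i
  simpa using congrFun h1 i

theorem act_add {R : Type*} [CommRing R] (w : SignedPerm n) (u v : Fin n → R) :
    w.act (u + v) = w.act u + w.act v := by
  funext i; simp [act, mul_add]

theorem sgn_mul_sgn {R : Type*} [CommRing R] (w : SignedPerm n) :
    ((w.sgn : ℤ) : R) * ((w.sgn : ℤ) : R) = 1 := by
  rcases Int.units_eq_one_or w.sgn with h | h <;> simp [h]

end SignedPerm

open Classical in
/-- The auxiliary function `ν ↦ a_{ν - ρ}` on dominant regular vectors, and zero elsewhere. -/
noncomputable def onDominant (a : DominantWeight n → LaurentSeries ℂ) (ν : Vec n) :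
    LaurentSeries ℂ :=
  if h : IsDominantWeight (ν - rho n) then a ⟨_, h⟩ else 0

/-- Removes the dependent `if`, so that the sum can be reindexed over the group. -/
theorem extend_eq_sum (a : DominantWeight n → LaurentSeries ℂ) (μ : Vec n) :
    extend a μ = ∑ w : SignedPerm n,
      ((w.sgn : ℤ) : LaurentSeries ℂ) * onDominant a (w.act (μ + rho n)) := by
  refine sum_congr rfl fun w _ => ?_
  unfold onDominant
  split_ifs <;> simp

/-- The extension of a family is skew for the dot action of the Weyl group. -/
theorem extend_act (a : DominantWeight n → LaurentSeries ℂ) (w : SignedPerm n) (ν : Vec n) :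
    extend a (w.act ν - rho n) = ((w.sgn : ℤ) : LaurentSeries ℂ) * extend a (ν - rho n) := by
  rw [extend_eq_sum, extend_eq_sum, mul_sum, ← (w.comp_right_bijective).sum_comp
    (fun w' : SignedPerm n => ((w.sgn : ℤ) : LaurentSeries ℂ) *
      (((w'.sgn : ℤ) : LaurentSeries ℂ) * onDominant a (w'.act (ν - rho n + rho n))))]
  refine sum_congr rfl fun w' _ => ?_
  simp only [sub_add_cancel, SignedPerm.act_comp, SignedPerm.sgn_comp]
  push_cast
  linear_combination (-(((w'.sgn : ℤ) : LaurentSeries ℂ) *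
    onDominant a (w'.act (w.act ν)))) * w.sgn_mul_sgn (R := LaurentSeries ℂ)

theorem extend_dominant (a : DominantWeight n → LaurentSeries ℂ) (lam : DominantWeight n) :
    extend a lam.1 = a lam := by
  rw [extend_eq_sum, sum_eq_single (fun _ => 1, 1)]
  · rw [act_one]
    have h : IsDominantWeight (lam.1 + rho n - rho n) := by simpa using lam.2
    rw [onDominant, dif_pos h]
    simp [SignedPerm.sgn]
  · intro w _ hw
    rw [onDominant, dif_neg, mul_zero]
    intro h
    refine hw (eq_one_of_act (strictAnti_add_rho lam) (add_rho_pos lam)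
      (strictAnti_add_rho ⟨_, h⟩) (add_rho_pos ⟨_, h⟩) w ?_)
    simp
  · simp

/-- A half-integral vector is regular, and then conjugate to a strictly dominant one, or it is
fixed by a signed permutation of determinant `-1`. -/
theorem dominant_or_fixed (ν : Vec n) (hν : ∃ z : Fin n → ℤ, ∀ i, ν i = z i + 1 / 2) :
    (∃ (w : SignedPerm n) (lam : DominantWeight n), w.act ν = lam.1 + rho n) ∨
      ∃ w : SignedPerm n, w.act ν = ν ∧ w.sgn = -1 := by
  by_contra hc
  push Not at hc
  obtain ⟨h1, h2⟩ := hc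
  -- If both alternatives fail, the alternant of ν is skew without a strictly dominant exponent,
  -- hence zero. But its coefficient at ν counts the stabilizer of ν, whose elements then all have
  -- sign 1, and the identity is among them.
  have h0 : alternant ν = 0 := by
    refine eq_zero_of_skew _ (skew_of_algHom _ fun w => w.algHom_alternant ν) ?_ ?_
    · intro μ h
      obtain ⟨w, rfl⟩ := exists_of_coeff_alternant_ne_zero _ _ h
      exact half_act w _ hν
    · intro lam
      by_contra h
      obtain ⟨w, hw⟩ := exists_of_coeff_alternant_ne_zero _ _ h
      exact h1 w lam hw
  have h3 := coeff_alternant ν ν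
  rw [h0] at h3
  have h4 : ∀ w : SignedPerm n, (if w.act ν = ν then ((w.sgn : ℤ) : ℂ) else 0) =
      ((if w.act ν = ν then 1 else 0 : ℕ) : ℂ) := by
    intro w
    split_ifs with h
    · rcases Int.units_eq_one_or w.sgn with h5 | h5
      · simp [h5]
      · exact absurd h5 (h2 w h)
    · simp
  rw [sum_congr rfl fun w _ => h4 w, ← Nat.cast_sum] at h3
  have h5 : ∑ w : SignedPerm n, (if w.act ν = ν then 1 else 0 : ℕ) = 0 := by
    refine Nat.cast_injective (R := ℂ) ?_
    rw [← h3]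
    simp
  have h6 := (sum_eq_zero_iff.mp h5) (fun _ => 1, 1) (mem_univ _)
  simp [act_one] at h6

/-- Lets x = -x force x = 0, and lets the multiplicity of an orbit sum be cancelled. -/
instance : CharZero (LaurentSeries ℂ) :=
  charZero_of_injective_algebraMap (algebraMap ℂ (LaurentSeries ℂ)).injective

theorem eq_zero_of_fixed {f : Vec n → LaurentSeries ℂ}
    (hf : ∀ (w : SignedPerm n) ν, f (w.act ν) = ((w.sgn : ℤ) : LaurentSeries ℂ) * f ν)
    {w : SignedPerm n} {ν : Vec n} (hw : w.act ν = ν) (hs : w.sgn = -1) : f ν = 0 := by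
  have h := hf w ν
  rw [hw, hs] at h
  have h3 : (((-1 : ℤˣ) : ℤ) : LaurentSeries ℂ) = -1 := by simp
  rw [h3] at h
  have h4 : (2 : LaurentSeries ℂ) * f ν = 0 := by linear_combination h
  exact (mul_eq_zero.mp h4).resolve_left two_ne_zero

/-- A skew function on the half-integral vectors is the extension of its dominant values. -/
theorem extend_eq_of_skew {f : Vec n → LaurentSeries ℂ}
    (hf : ∀ (w : SignedPerm n) ν, f (w.act ν) = ((w.sgn : ℤ) : LaurentSeries ℂ) * f ν)
    (a : DominantWeight n → LaurentSeries ℂ) (ha : ∀ lam, f (lam.1 + rho n) = a lam)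
    (μ : Vec n) (hμ : ∃ z : Fin n → ℤ, ∀ i, μ i = z i) :
    extend a μ = f (μ + rho n) := by
  have hν : ∃ z : Fin n → ℤ, ∀ i, (μ + rho n) i = z i + 1 / 2 := by
    obtain ⟨z, hz⟩ := hμ
    obtain ⟨y, hy⟩ := half_rho n
    exact ⟨z + y, fun i => by simp [hz, hy, add_assoc]⟩
  have hE : ∀ (w : SignedPerm n) ν, (fun ν => extend a (ν - rho n)) (w.act ν) =
      ((w.sgn : ℤ) : LaurentSeries ℂ) * (fun ν => extend a (ν - rho n)) ν :=
    fun w ν => extend_act a w ν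
  have key : (fun ν => extend a (ν - rho n)) (μ + rho n) = f (μ + rho n) := by
    -- Both functions are skew: they agree at a dominant conjugate, or both vanish at a vector with
    -- an odd stabilizer element.
    rcases dominant_or_fixed _ hν with ⟨w, lam, h⟩ | ⟨w, h, hs⟩
    · have e1 := hE w (μ + rho n)
      have e2 := hf w (μ + rho n)
      rw [h] at e1 e2
      rw [ha, ← extend_dominant a lam] at e2
      simp only [add_sub_cancel_right] at e1 e2 ⊢
      have e3 := e1.symm.trans e2
      have := congrArg (fun x => ((w.sgn : ℤ) : LaurentSeries ℂ) * x) e3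
      simpa only [← mul_assoc, w.sgn_mul_sgn, one_mul] using this
    · rw [eq_zero_of_fixed hf h hs]
      exact eq_zero_of_fixed (f := fun ν => extend a (ν - rho n)) hE h hs
  simpa using key

end Skew

/-! ### Signed counts of words by number of non-zero letters -/

section Counts

variable {R : Type*} [CommRing R]

/-- The generating function `∑ (-1)^{#dominoes + #tails} y^{#non-zero letters}` of the words of
length `N` made of zeros, dominoes `(-1, 1)` and possibly a last letter `-1`. -/
def signedCount (y : R) : ℕ → R
  | 0 => 1
  | 1 => 1 - y
  | N + 2 => signedCount y (N + 1) - y ^ 2 * signedCount y N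

/-- The generating function of the same words, each weighted in addition by the sum of `θ d` over
its dominoes, `d` being the number of letters after the start of the domino, and of `θ 0` for a
last letter `-1`. -/
def signedWeight (y : R) (θ : ℕ → R) : ℕ → R
  | 0 => 0
  | 1 => -(y * θ 0)
  | N + 2 => signedWeight y θ (N + 1) -
      y ^ 2 * (signedWeight y θ N + θ (N + 1) * signedCount y N)

/-- The sum `∑_j y^j Z(N - j) β_j` with `β_{2i+1} = b_{u+i}` and `β_{2i} = b_{v-i+1}`, where `Z` is
`signedCount`. -/
def interlacedSum (y : R) (b : ℤ → R) : ℕ → ℤ → ℤ → R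
  | 0, _, _ => 0
  | 1, u, _ => y * b u
  | N + 2, u, v => y * signedCount y (N + 1) * b u + y ^ 2 * signedCount y N * b v +
      y ^ 2 * interlacedSum y b N (u + 1) (v - 1)

/-- This is, up to sign, the recursion of `signedWeight`. The condition on `u`, `v`, `N` says that
the interlaced sequence exhausts the N consecutive indices from u to v, so the two ends meet in the
middle. Peeling off one index at each end reduces N by two until only the innermost terms are left
to compare. -/
theorem interlacedSum_rec (y : R) (b : ℤ → R) (N : ℕ) : ∀ u v : ℤ, u + N = v + 1 →
    interlacedSum y b (N + 2) u (v + 2) - interlacedSum y b (N + 1) u (v + 1) +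
      y ^ 2 * interlacedSum y b N u v = y ^ 2 * (b (v + 2) - b (v + 1)) * signedCount y N := by
  induction N using Nat.twoStepInduction with
  | zero =>
    intro u v h
    obtain rfl : u = v + 1 := by simpa using h
    simp only [interlacedSum, signedCount]
    ring
  | one =>
    intro u v h
    obtain rfl : u = v := by push_cast at h; omega
    simp only [interlacedSum, signedCount]
    have e1 : u + 1 + 1 = u + 2 := by ring
    ring_nf
  | more N ih _ =>
    intro u v h
    have := ih (u + 1) (v - 1) (by push_cast at h ⊢; omega)
    have e1 : v - 1 + 2 = v + 2 - 1 := by ring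
    have e2 : v - 1 + 1 = v + 1 - 1 := by ring
    have e3 : v + 2 - 1 = v + 1 := by ring
    have e4 : v + 1 - 1 = v := by ring
    rw [e1, e2] at this
    rw [e3, e4] at this
    have i1 : interlacedSum y b (N + 2 + 2) u (v + 2) = y * signedCount y (N + 2 + 1) * b u +
      y ^ 2 * signedCount y (N + 2) * b (v + 2) +
      y ^ 2 * interlacedSum y b (N + 2) (u + 1) (v + 2 - 1) := interlacedSum.eq_3 ..
    have i2 : interlacedSum y b (N + 2 + 1) u (v + 1) = y * signedCount y (N + 2) * b u +
      y ^ 2 * signedCount y (N + 1) * b (v + 1) +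
      y ^ 2 * interlacedSum y b (N + 1) (u + 1) (v + 1 - 1) := interlacedSum.eq_3 ..
    have i3 : interlacedSum y b (N + 2) u v = y * signedCount y (N + 1) * b u +
      y ^ 2 * signedCount y N * b v +
      y ^ 2 * interlacedSum y b N (u + 1) (v - 1) := interlacedSum.eq_3 ..
    have z1 : signedCount y (N + 2 + 1) = signedCount y (N + 2) - y ^ 2 * signedCount y (N + 1) :=
      signedCount.eq_3 ..
    have z2 : signedCount y (N + 2) = signedCount y (N + 1) - y ^ 2 * signedCount y N :=
      signedCount.eq_3 ..
    rw [i1, i2, i3, z1, e3, e4]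
    linear_combination y ^ 2 * this + y ^ 2 * b (v + 1) * z2

/-- A summation by parts: when the domino weights are the differences of b, both sides obey the same
two-step recursion with the same initial values. -/
theorem signedWeight_eq (y : R) (θ : ℕ → R) (b : ℤ → R) (h0 : b 1 = θ 0)
    (hb : ∀ d : ℕ, b (d + 2) - b (d + 1) = θ (d + 1)) (N : ℕ) :
    signedWeight y θ N = -interlacedSum y b N 1 N := by
  induction N using Nat.twoStepInduction with
  | zero => simp [signedWeight, interlacedSum]
  | one => simp [signedWeight, interlacedSum, h0]
  | more N ih1 ih2 =>
    have h := interlacedSum_rec y b N 1 N (by ring)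
    rw [hb] at h
    rw [signedWeight, ih1, ih2]
    push_cast
    linear_combination h

theorem interlacedSum_eq_sum (y : R) (b : ℤ → R) (N : ℕ) : ∀ u v : ℤ,
    interlacedSum y b N u v = ∑ j ∈ range N, y ^ (j + 1) * signedCount y (N - 1 - j) *
      if Even j then b (u + (j / 2 : ℕ)) else b (v - (j / 2 : ℕ)) := by
  induction N using Nat.twoStepInduction with
  | zero => simp [interlacedSum]
  | one => simp [interlacedSum, signedCount]
  | more N ih _ =>
    intro u v
    rw [sum_range_succ', sum_range_succ', interlacedSum, ih, mul_sum]
    have : ∀ j ∈ range N, y ^ 2 * (y ^ (j + 1) * signedCount y (N - 1 - j) *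
        if Even j then b (u + 1 + (j / 2 : ℕ)) else b (v - 1 - (j / 2 : ℕ))) =
        y ^ (j + 1 + 1 + 1) * signedCount y (N + 2 - 1 - (j + 1 + 1)) *
        if Even (j + 1 + 1) then b (u + ((j + 1 + 1) / 2 : ℕ))
          else b (v - ((j + 1 + 1) / 2 : ℕ)) := by
      intro j _
      have e : N + 2 - 1 - (j + 1 + 1) = N - 1 - j := by omega
      have e2 : (j + 1 + 1) / 2 = j / 2 + 1 := by omega
      have e3 : Even (j + 1 + 1) ↔ Even j := by simp [Nat.even_add_one]
      rw [e, e2, if_congr e3 rfl rfl]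
      push_cast
      have e4 : u + 1 + (j : ℤ) / 2 = u + (j / 2 + 1) := by ring
      have e5 : v - 1 - (j : ℤ) / 2 = v - (j / 2 + 1) := by ring
      rw [e4, e5]
      ring
    rw [sum_congr rfl this]
    simp
    ring

/-- Splitting a sum by parity. -/
theorem sum_range_parity {M : Type*} [AddCommMonoid M] (f : ℕ → M) (k : ℕ) :
    ∑ j ∈ range k, f j = ∑ i ∈ Icc 1 ((k + 1) / 2), f (2 * i - 2) +
      ∑ i ∈ Icc 1 (k / 2), f (2 * i - 1) := by
  induction k with
  | zero => simp
  | succ k ih =>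
    rw [sum_range_succ, ih]
    rcases Nat.even_or_odd' k with ⟨r, rfl | rfl⟩
    · have e1 : (2 * r + 1) / 2 = r := by omega
      have e2 : (2 * r + 1 + 1) / 2 = r + 1 := by omega
      have e3 : 2 * r / 2 = r := by omega
      rw [e1, e2, e3, sum_Icc_succ_top (by omega)]
      simp only [show 2 * (r + 1) - 2 = 2 * r by omega]
      abel
    · have e1 : (2 * r + 1) / 2 = r := by omega
      have e2 : (2 * r + 1 + 1) / 2 = r + 1 := by omega
      have e3 : (2 * r + 1 + 1 + 1) / 2 = r + 1 := by omega
      rw [e1, e2, e3, sum_Icc_succ_top (b := r) (f := fun i => f (2 * i - 1)) (by omega)]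
      simp only [show 2 * (r + 1) - 1 = 2 * r + 1 by omega]
      abel

end Counts

/-! ### Straightening of words in the letters `-1`, `0`, `1` -/

section Straightening

variable {n : ℕ}

/-- Reflection in a root `e_i - e_j`. -/
theorem extend_swap (a : DominantWeight n → LaurentSeries ℂ) {i j : Fin n} (hij : i ≠ j)
    (μ μ' : Vec n) (h : ∀ k, k ≠ i → k ≠ j → μ' k = μ k)
    (hi : μ' i = μ j - ((j : ℕ) - (i : ℕ))) (hj : μ' j = μ i + ((j : ℕ) - (i : ℕ))) :
    extend a μ' = -extend a μ := by
  set w : SignedPerm n := (fun _ => 1, Equiv.swap i j) with hw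
  have hs : w.sgn = -1 := by simp [hw, SignedPerm.sgn, Equiv.Perm.sign_swap hij]
  have h1 := extend_act a w (μ + rho n)
  have h2 : w.act (μ + rho n) - rho n = μ' := by
    funext k
    rcases eq_or_ne k i with rfl | hki
    · simp only [hw, SignedPerm.act, Pi.sub_apply, Pi.add_apply, Equiv.swap_apply_left, hi, rho,
        twoRho]
      push_cast
      ring
    · rcases eq_or_ne k j with rfl | hkj
      · simp only [hw, SignedPerm.act, Pi.sub_apply, Pi.add_apply, Equiv.swap_apply_right, hj, rho,
          twoRho]
        push_cast
        ring
      · simp [hw, SignedPerm.act, Equiv.swap_apply_of_ne_of_ne hki hkj, h k hki hkj]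
  have h3 : (((-1 : ℤˣ) : ℤ) : LaurentSeries ℂ) = -1 := by simp
  rw [h2, hs, h3, add_sub_cancel_right] at h1
  linear_combination h1

/-- Reflection in the short simple root. -/
theorem extend_neg_last (a : DominantWeight n → LaurentSeries ℂ) {i : Fin n} (hi : (i : ℕ) + 1 = n)
    (μ μ' : Vec n) (h : ∀ k, k ≠ i → μ' k = μ k) (h' : μ' i = -μ i - 1) :
    extend a μ' = -extend a μ := by
  set w : SignedPerm n := (fun k => if k = i then -1 else 1, 1) with hw
  have hs : w.sgn = -1 := by simp [hw, SignedPerm.sgn]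
  have h1 := extend_act a w (μ + rho n)
  have h2 : w.act (μ + rho n) - rho n = μ' := by
    funext k
    rcases eq_or_ne k i with rfl | hki
    · have h4 : ((n : ℕ) : ℚ) = (k : ℕ) + 1 := by exact_mod_cast hi.symm
      simp only [hw, SignedPerm.act, Pi.sub_apply, Pi.add_apply, h', rho,
        twoRho, if_true, Equiv.Perm.coe_one, id_eq]
      push_cast
      rw [h4]
      ring
    · simp [hw, SignedPerm.act, hki, h k hki]
  have h3 : (((-1 : ℤˣ) : ℤ) : LaurentSeries ℂ) = -1 := by simp
  rw [h2, hs, h3, add_sub_cancel_right] at h1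
  linear_combination h1

/-- The value of the extended family at a weight, given by the list of its coordinates. -/
noncomputable def wordValue (a : DominantWeight n → LaurentSeries ℂ) (l : List ℤ) :
    LaurentSeries ℂ :=
  extend a fun i : Fin n => ((l.getD i 0 : ℤ) : ℚ)

variable (a : DominantWeight n → LaurentSeries ℂ)

theorem getD_append_of_lt (v w : List ℤ) {i : ℕ} (h : i < v.length) :
    (v ++ w).getD i 0 = v.getD i 0 := List.getD_append _ _ _ _ h

theorem getD_append_add (v w : List ℤ) (k : ℕ) :
    (v ++ w).getD (v.length + k) 0 = w.getD k 0 := by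
  rw [List.getD_append_right _ _ _ _ (by omega)]
  simp

/-- Adjacent coordinates of ρ differ by 1, so the dot action of a simple transposition sends (x, y)
to (y - 1, x + 1). -/
theorem wordValue_swap (v w : List ℤ) (x y : ℤ) (h : v.length + 2 ≤ n) :
    wordValue a (v ++ x :: y :: w) = -wordValue a (v ++ (y - 1) :: (x + 1) :: w) := by
  refine extend_swap a (i := ⟨v.length, by omega⟩) (j := ⟨v.length + 1, by omega⟩) ?_ _ _ ?_ ?_ ?_
  · simp [Fin.ext_iff]
  · intro k h1 h2
    rcases lt_or_ge (k : ℕ) v.length with hk | hk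
    · simp only [getD_append_of_lt _ _ hk]
    · obtain ⟨t, ht⟩ := Nat.exists_eq_add_of_le hk
      simp only [ht, getD_append_add]
      match t with
      | 0 => exact absurd (Fin.ext (by simpa using ht)) h1
      | 1 => exact absurd (Fin.ext (by simpa using ht)) h2
      | t + 2 => simp
  · have := getD_append_add v (x :: y :: w) 0
    have := getD_append_add v ((y - 1) :: (x + 1) :: w) 1
    simp_all
  · have := getD_append_add v (x :: y :: w) 1
    have := getD_append_add v ((y - 1) :: (x + 1) :: w) 0
    simp_all

theorem wordValue_swap_two (v w : List ℤ) (x y z : ℤ) (h : v.length + 3 ≤ n) :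
    wordValue a (v ++ x :: z :: y :: w) = -wordValue a (v ++ (y - 2) :: z :: (x + 2) :: w) := by
  refine extend_swap a (i := ⟨v.length, by omega⟩) (j := ⟨v.length + 2, by omega⟩) ?_ _ _ ?_ ?_ ?_
  · simp [Fin.ext_iff]
  · intro k h1 h2
    rcases lt_or_ge (k : ℕ) v.length with hk | hk
    · simp only [getD_append_of_lt _ _ hk]
    · obtain ⟨t, ht⟩ := Nat.exists_eq_add_of_le hk
      simp only [ht, getD_append_add]
      match t with
      | 0 => exact absurd (Fin.ext (by simpa using ht)) h1
      | 1 => simp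
      | 2 => exact absurd (Fin.ext (by simpa using ht)) h2
      | t + 3 => simp
  · have := getD_append_add v (x :: z :: y :: w) 0
    have := getD_append_add v ((y - 2) :: z :: (x + 2) :: w) 2
    simp_all
  · have := getD_append_add v (x :: z :: y :: w) 2
    have := getD_append_add v ((y - 2) :: z :: (x + 2) :: w) 0
    simp_all

/-- The last coordinate of ρ is 1/2, so the short simple reflection acts by x ↦ -x - 1; in
particular it exchanges -1 and 0. -/
theorem wordValue_neg_last (v : List ℤ) (x : ℤ) (h : v.length + 1 = n) :
    wordValue a (v ++ [x]) = -wordValue a (v ++ [-x - 1]) := by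
  refine extend_neg_last a (i := ⟨v.length, by omega⟩) h _ _ ?_ ?_
  · intro k h1
    rcases lt_or_ge (k : ℕ) v.length with hk | hk
    · simp only [getD_append_of_lt _ _ hk]
    · obtain ⟨t, ht⟩ := Nat.exists_eq_add_of_le hk
      have := k.2
      exact absurd (Fin.ext (by simp; omega)) h1
  · have := getD_append_add v [x] 0
    have := getD_append_add v [-x - 1] 0
    simp_all

theorem eq_zero_of_eq_neg {x : LaurentSeries ℂ} (h : x = -x) : x = 0 := by
  have h4 : (2 : LaurentSeries ℂ) * x = 0 := by linear_combination h
  exact (mul_eq_zero.mp h4).resolve_left two_ne_zero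

theorem wordValue_zero_one (v w : List ℤ) (h : v.length + 2 ≤ n) :
    wordValue a (v ++ 0 :: 1 :: w) = 0 :=
  eq_zero_of_eq_neg (wordValue_swap a v w 0 1 h)

theorem wordValue_neg_zero (v w : List ℤ) (h : v.length + 2 ≤ n) :
    wordValue a (v ++ -1 :: 0 :: w) = 0 :=
  eq_zero_of_eq_neg (wordValue_swap a v w (-1) 0 h)

theorem wordValue_neg_one (v w : List ℤ) (h : v.length + 2 ≤ n) :
    wordValue a (v ++ -1 :: 1 :: w) = -wordValue a (v ++ 0 :: 0 :: w) :=
  wordValue_swap a v w (-1) 1 h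

/-- The next letter decides. If there is none, reflecting the last letter produces -1 0; a 0 gives
-1 0 at once; -1 -1 1 is fixed by the reflection that swaps its outer letters; and after another -1
the argument is repeated one place further right. -/
theorem wordValue_neg_neg (w : List ℤ) (hw : ∀ c ∈ w, c = 0 ∨ c = 1 ∨ c = -1) : ∀ v : List ℤ,
    v.length + 2 + w.length = n → wordValue a (v ++ -1 :: -1 :: w) = 0 := by
  induction w with
  | nil =>
    intro v h
    have h1 := wordValue_neg_last a (v ++ [-1]) (-1) (by simpa using h)
    have h2 := wordValue_neg_zero a v [] (by simpa using h.le)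
    simp only [List.append_assoc, List.cons_append, List.nil_append] at h1
    rw [h1, show (-(-1) - 1 : ℤ) = 0 by norm_num, h2, neg_zero]
  | cons c w ih =>
    intro v h
    simp only [List.length_cons] at h
    rcases hw c (by simp) with rfl | rfl | rfl
    · have := wordValue_neg_zero a (v ++ [-1]) w (by simp; omega)
      simpa using this
    · exact eq_zero_of_eq_neg (wordValue_swap_two a v w (-1) 1 (-1) (by omega))
    · have := ih (fun c hc => hw c (by simp [hc])) (v ++ [-1]) (by simp; omega)
      simpa using this

theorem wordValue_replicate (p : ℕ) :
    wordValue a (List.replicate p 1 ++ List.replicate (n - p) 0) = a (omega n p) := by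
  rw [← extend_dominant a]
  unfold wordValue
  congr 1
  funext i
  rcases lt_or_ge (i : ℕ) p with h | h
  · rw [getD_append_of_lt _ _ (by simpa using h)]
    simp [omega, firstOnes, h]
  · obtain ⟨t, ht⟩ := Nat.exists_eq_add_of_le h
    have := getD_append_add (List.replicate p 1) (List.replicate (n - p) 0) t
    rw [List.length_replicate] at this
    rw [ht, this]
    have h2 : (List.replicate (n - p) (0 : ℤ)).getD t 0 = 0 := by simp
    simp [omega, firstOnes, ht]

end Straightening

/-! ### Sums over words -/

section WordSums

variable {R : Type*} [CommRing R]

/-- The sum of `y^{#non-zero letters} f(w)` over the words `w` of length `N` in the letters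
`0, 1, -1`. -/
def wordSum (y : R) : ℕ → (List ℤ → R) → R
  | 0, f => f []
  | N + 1, f => wordSum y N (fun l => f (0 :: l)) + y * wordSum y N (fun l => f (1 :: l)) +
      y * wordSum y N (fun l => f (-1 :: l))

/-- The sum as in `wordSum`, each word weighted in addition by the sum of `hp d` over its letters
`1` and of `hm d` over its letters `-1`, `d` being the number of letters that follow. -/
def weightedWordSum (y : R) (hp hm : ℕ → R) : ℕ → (List ℤ → R) → R
  | 0, _ => 0
  | N + 1, f => weightedWordSum y hp hm N (fun l => f (0 :: l)) +
      y * (weightedWordSum y hp hm N (fun l => f (1 :: l)) +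
        hp N * wordSum y N (fun l => f (1 :: l))) +
      y * (weightedWordSum y hp hm N (fun l => f (-1 :: l)) +
        hm N * wordSum y N (fun l => f (-1 :: l)))

variable (y : R) (hp hm : ℕ → R)

theorem wordSum_congr (N : ℕ) : ∀ f g : List ℤ → R,
    (∀ l : List ℤ, l.length = N → (∀ c ∈ l, c = 0 ∨ c = 1 ∨ c = -1) → f l = g l) →
      wordSum y N f = wordSum y N g ∧
        weightedWordSum y hp hm N f = weightedWordSum y hp hm N g := by
  induction N with
  | zero => intro f g h; simp [wordSum, weightedWordSum, h [] rfl]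
  | succ N ih =>
    intro f g h
    have h' : ∀ c : ℤ, (c = 0 ∨ c = 1 ∨ c = -1) →
        wordSum y N (fun l => f (c :: l)) = wordSum y N (fun l => g (c :: l)) ∧
          weightedWordSum y hp hm N (fun l => f (c :: l)) =
            weightedWordSum y hp hm N (fun l => g (c :: l)) := by
      intro c hc
      refine ih _ _ fun l hl hl' => h _ (by simp [hl]) ?_
      intro d hd
      rcases List.mem_cons.mp hd with rfl | hd
      · exact hc
      · exact hl' d hd
    obtain ⟨h1, h2⟩ := h' 0 (by simp)
    obtain ⟨h3, h4⟩ := h' 1 (by simp)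
    obtain ⟨h5, h6⟩ := h' (-1) (by simp)
    simp only [wordSum, weightedWordSum, h1, h2, h3, h4, h5, h6, and_self]

theorem wordSum_neg (N : ℕ) : ∀ f : List ℤ → R,
    wordSum y N (fun l => -f l) = -wordSum y N f ∧
      weightedWordSum y hp hm N (fun l => -f l) = -weightedWordSum y hp hm N f := by
  induction N with
  | zero => intro f; simp [wordSum, weightedWordSum]
  | succ N ih =>
    intro f
    obtain ⟨h1, h2⟩ := ih fun l => f (0 :: l)
    obtain ⟨h3, h4⟩ := ih fun l => f (1 :: l)
    obtain ⟨h5, h6⟩ := ih fun l => f (-1 :: l)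
    simp only [wordSum, weightedWordSum, h1, h2, h3, h4, h5, h6]
    constructor <;> ring

theorem wordSum_zero (N : ℕ) :
    wordSum y N (fun _ => 0) = 0 ∧ weightedWordSum y hp hm N (fun _ => 0) = 0 := by
  induction N with
  | zero => simp [wordSum, weightedWordSum]
  | succ N ih => simp [wordSum, weightedWordSum, ih]

/-- The letter weights add up to domino weights. -/
def dominoWeight : ℕ → R
  | 0 => hm 0
  | d + 1 => hp d + hm (d + 1)

end WordSums

/-! ### Evaluation of the word sums by straightening -/

section Straightened

variable {n : ℕ} {R : Type*} [CommRing R] (φ : LaurentSeries ℂ →+* R) (y : R) (hp hm : ℕ → R)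
  (a : DominantWeight n → LaurentSeries ℂ)

/-- The vector `(1, …, 1, 0, …, 0)` as the beginning of a word. -/
def onesZeros (p z : ℕ) : List ℤ := List.replicate p 1 ++ List.replicate z 0

theorem length_onesZeros (p z : ℕ) : (onesZeros p z).length = p + z := by simp [onesZeros]

theorem onesZeros_append_zero (p z : ℕ) (l : List ℤ) :
    onesZeros p z ++ 0 :: l = onesZeros p (z + 1) ++ l := by
  simp [onesZeros, List.replicate_succ']

theorem onesZeros_append_one (p : ℕ) (l : List ℤ) :
    onesZeros p 0 ++ 1 :: l = onesZeros (p + 1) 0 ++ l := by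
  simp [onesZeros, List.replicate_succ']

theorem wordValue_onesZeros_one (p z : ℕ) (l : List ℤ) (h : p + z + 2 ≤ n) :
    wordValue a (onesZeros p (z + 1) ++ 1 :: l) = 0 := by
  rw [← onesZeros_append_zero]
  exact wordValue_zero_one a _ _ (by rw [length_onesZeros]; exact h)

theorem wordSum_onesZeros_one (p z N : ℕ) (h : p + z + 2 ≤ n) :
    wordSum y N (fun l => φ (wordValue a (onesZeros p (z + 1) ++ 1 :: l))) = 0 ∧
      weightedWordSum y hp hm N
        (fun l => φ (wordValue a (onesZeros p (z + 1) ++ 1 :: l))) = 0 := by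
  have : (fun l => φ (wordValue a (onesZeros p (z + 1) ++ 1 :: l))) = fun _ => 0 := by
    funext l
    rw [wordValue_onesZeros_one a p z l h, map_zero]
  rw [this]
  exact wordSum_zero y hp hm N

/-- After -1 only the letter 1 contributes, because -1 0 and -1 -1 have value zero, and the domino
becomes 0 0 with a sign. The weight of the -1 itself belongs to the prefix and is added by the
caller; only the `hp N` of the second domino letter appears here. -/
theorem wordSum_onesZeros_neg (p z N : ℕ) (h : p + z + (N + 2) = n) :
    wordSum y (N + 1) (fun l => φ (wordValue a (onesZeros p z ++ -1 :: l))) =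
        -(y * wordSum y N (fun l => φ (wordValue a (onesZeros p (z + 2) ++ l)))) ∧
      weightedWordSum y hp hm (N + 1) (fun l => φ (wordValue a (onesZeros p z ++ -1 :: l))) =
        -(y * (weightedWordSum y hp hm N (fun l => φ (wordValue a (onesZeros p (z + 2) ++ l))) +
          hp N * wordSum y N (fun l => φ (wordValue a (onesZeros p (z + 2) ++ l))))) := by
  have hl := length_onesZeros p z
  have h0 : (fun l => φ (wordValue a (onesZeros p z ++ -1 :: 0 :: l))) = fun _ => 0 := by
    funext l
    rw [wordValue_neg_zero a _ _ (by omega), map_zero]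
  have h1 : (fun l => φ (wordValue a (onesZeros p z ++ -1 :: 1 :: l))) =
      fun l => -φ (wordValue a (onesZeros p (z + 2) ++ l)) := by
    funext l
    rw [wordValue_neg_one a _ _ (by omega), map_neg, onesZeros_append_zero, onesZeros_append_zero]
  obtain ⟨h2, h3⟩ := wordSum_congr y hp hm N
    (fun l => φ (wordValue a (onesZeros p z ++ -1 :: -1 :: l))) (fun _ => 0) fun l h4 h5 => by
      rw [wordValue_neg_neg a l h5 _ (by omega), map_zero]
  obtain ⟨h6, h7⟩ := wordSum_zero y hp hm N
  obtain ⟨h8, h9⟩ := wordSum_neg y hp hm N fun l => φ (wordValue a (onesZeros p (z + 2) ++ l))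
  simp only [wordSum, weightedWordSum, h0, h1, h2, h3, h6, h7, h8, h9]
  constructor <;> ring

theorem wordValue_onesZeros (p z : ℕ) (h : p + z = n) :
    wordValue a (onesZeros p z) = a (omega n p) := by
  rw [← wordValue_replicate a, onesZeros, show n - p = z by omega]

theorem wordValue_onesZeros_last (p z : ℕ) (h : p + z + 1 = n) :
    wordValue a (onesZeros p z ++ [-1]) = -a (omega n p) := by
  rw [wordValue_neg_last a _ _ (by rw [length_onesZeros]; exact h)]
  rw [show (-(-1) - 1 : ℤ) = 0 by norm_num, onesZeros_append_zero, List.append_nil,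
    wordValue_onesZeros a p (z + 1) (by omega)]

/-- The sums over the words with a given beginning `(1, …, 1, 0, …, 0)` that contains a zero. -/
theorem wordSum_onesZeros (p : ℕ) (N : ℕ) : ∀ z : ℕ, p + (z + 1) + N = n →
    wordSum y N (fun l => φ (wordValue a (onesZeros p (z + 1) ++ l))) =
        signedCount y N * φ (a (omega n p)) ∧
      weightedWordSum y hp hm N (fun l => φ (wordValue a (onesZeros p (z + 1) ++ l))) =
        signedWeight y (dominoWeight hp hm) N * φ (a (omega n p)) := by
  induction N using Nat.twoStepInduction with
  | zero =>
    intro z h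
    simp [wordSum, weightedWordSum, signedCount, signedWeight,
      wordValue_onesZeros a p (z + 1) (by omega)]
  | one =>
    intro z h
    simp only [wordSum, weightedWordSum, signedCount, signedWeight, dominoWeight,
      wordValue_onesZeros_last a p (z + 1) (by omega), wordValue_onesZeros_one a p z [] (by omega),
      onesZeros_append_zero, List.append_nil, wordValue_onesZeros a p (z + 2) (by omega), map_neg,
      map_zero]
    constructor <;> ring
  | more N ih0 ih1 =>
    intro z h
    obtain ⟨h1, h2⟩ := ih1 (z + 1) (by omega)
    obtain ⟨h3, h4⟩ := ih0 (z + 2) (by omega)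
    obtain ⟨h5, h6⟩ := wordSum_onesZeros_one φ y hp hm a p z (N + 1) (by omega)
    obtain ⟨h7, h8⟩ := wordSum_onesZeros_neg φ y hp hm a p (z + 1) N (by omega)
    rw [wordSum, weightedWordSum, signedCount, signedWeight, dominoWeight]
    simp only [onesZeros_append_zero, h1, h2, h5, h6, h7, h8, h3, h4]
    constructor <;> ring

/-- The sums over the words that begin with `(1, …, 1)`, reduced to the words that continue
with `1`. -/
theorem wordSum_ones (p N : ℕ) (h : p + (N + 1) = n) :
    wordSum y (N + 1) (fun l => φ (wordValue a (onesZeros p 0 ++ l))) =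
        signedCount y (N + 1) * φ (a (omega n p)) +
          y * wordSum y N (fun l => φ (wordValue a (onesZeros (p + 1) 0 ++ l))) ∧
      weightedWordSum y hp hm (N + 1) (fun l => φ (wordValue a (onesZeros p 0 ++ l))) =
        signedWeight y (dominoWeight hp hm) (N + 1) * φ (a (omega n p)) +
          y * (weightedWordSum y hp hm N (fun l => φ (wordValue a (onesZeros (p + 1) 0 ++ l))) +
            hp N * wordSum y N (fun l => φ (wordValue a (onesZeros (p + 1) 0 ++ l)))) := by
  obtain ⟨h1, h2⟩ := wordSum_onesZeros φ y hp hm a p N 0 (by omega)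
  cases N with
  | zero =>
    simp only [wordSum, weightedWordSum, signedCount, signedWeight, dominoWeight,
      wordValue_onesZeros_last a p 0 (by omega), onesZeros_append_one, onesZeros_append_zero,
      List.append_nil, wordValue_onesZeros a p (0 + 1) (by omega), map_neg]
    constructor <;> ring
  | succ N =>
    obtain ⟨h3, h4⟩ := wordSum_onesZeros φ y hp hm a p N 1 (by omega)
    obtain ⟨h7, h8⟩ := wordSum_onesZeros_neg φ y hp hm a p 0 N (by omega)
    rw [wordSum, weightedWordSum, signedCount, signedWeight, dominoWeight]
    simp only [onesZeros_append_zero, onesZeros_append_one, h1, h2, h7, h8, h3, h4]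
    constructor <;> ring

/-- The sum over all words that begin with `(1, …, 1)`, the initial ones being included in the
weight. -/
theorem weightedWordSum_ones (c : ℕ → R) (hc : ∀ p < n, c (p + 1) = c p + hp (n - 1 - p)) (N : ℕ) :
    ∀ p, p + N = n →
    weightedWordSum y hp hm N (fun l => φ (wordValue a (onesZeros p 0 ++ l))) +
        c p * wordSum y N (fun l => φ (wordValue a (onesZeros p 0 ++ l))) =
      ∑ i ∈ range (N + 1), y ^ i * (signedWeight y (dominoWeight hp hm) (N - i) +
        c (p + i) * signedCount y (N - i)) * φ (a (omega n (p + i))) := by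
  induction N with
  | zero =>
    intro p h
    simp [wordSum, weightedWordSum, signedWeight, signedCount, wordValue_onesZeros a p 0 h]
  | succ N ih =>
    intro p h
    obtain ⟨h1, h2⟩ := wordSum_ones φ y hp hm a p N h
    have h3 := ih (p + 1) (by omega)
    -- A letter 1 in position p is followed by N letters; absorbing it into the prefix turns `c p`
    -- into `c (p + 1)`.
    have h4 := hc p (by omega)
    rw [show n - 1 - p = N by omega] at h4
    rw [sum_range_succ', h1, h2]
    have h5 : ∀ i ∈ range (N + 1), y ^ (i + 1) * (signedWeight y (dominoWeight hp hm)
        (N + 1 - (i + 1)) + c (p + (i + 1)) * signedCount y (N + 1 - (i + 1))) *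
          φ (a (omega n (p + (i + 1)))) =
        y * (y ^ i * (signedWeight y (dominoWeight hp hm) (N - i) +
          c (p + 1 + i) * signedCount y (N - i)) * φ (a (omega n (p + 1 + i)))) := by
      intro i _
      rw [show N + 1 - (i + 1) = N - i by omega, show p + (i + 1) = p + 1 + i by omega]
      ring
    rw [sum_congr rfl h5, ← mul_sum, ← h3, h4]
    simp only [pow_zero, add_zero, Nat.sub_zero]
    ring

/-- Regrouping of the sum over all words by the defects of the simplified recurrences. -/
theorem weightedWordSum_eq (c : ℕ → R) (hc : ∀ p < n, c (p + 1) = c p + hp (n - 1 - p))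
    (hc0 : c 0 = 0) (b : ℤ → R) (h0 : b 1 = hm 0)
    (hb : ∀ d : ℕ, b (d + 2) - b (d + 1) = hp d + hm (d + 1)) :
    weightedWordSum y hp hm n (fun l => φ (wordValue a l)) =
      ∑ j ∈ range (n + 1), y ^ j * signedCount y (n - j) * (c j * φ (a (omega n j)) -
        ∑ i ∈ range j, φ (a (omega n (j - 1 - i))) *
          if Even i then b (1 + (i / 2 : ℕ)) else b ((n - (j - 1 - i) : ℕ) - (i / 2 : ℕ))) := by
  have h1 := weightedWordSum_ones φ y hp hm a c hc n 0 (by omega)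
  simp only [hc0, zero_mul, add_zero, zero_add] at h1
  have e : (onesZeros 0 0 : List ℤ) = [] := rfl
  simp only [e, List.nil_append] at h1
  rw [h1]
  -- The upper end of the interlaced indices is the length of the tail, so it depends on the number
  -- of initial ones.
  have h2 : ∀ N, signedWeight y (dominoWeight hp hm) N = -interlacedSum y b N 1 N :=
    signedWeight_eq y _ b h0 hb
  simp only [h2, interlacedSum_eq_sum, mul_sub, sum_sub_distrib]
  have h3 : ∀ i, y ^ i * (-∑ j ∈ range (n - i), (y ^ (j + 1) * signedCount y (n - i - 1 - j) *
      if Even j then b (1 + (j / 2 : ℕ)) else b ((n - i : ℕ) - (j / 2 : ℕ))) +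
        c i * signedCount y (n - i)) * φ (a (omega n i)) =
      y ^ i * signedCount y (n - i) * (c i * φ (a (omega n i))) -
        ∑ j ∈ range (n - i), y ^ (i + j + 1) * signedCount y (n - (i + j + 1)) *
          (φ (a (omega n i)) * 
            if Even j then b (1 + (j / 2 : ℕ)) else b ((n - i : ℕ) - (j / 2 : ℕ))) := by
    intro i
    have : ∀ j, y ^ (i + j + 1) * signedCount y (n - (i + j + 1)) *
          (φ (a (omega n i)) * 
            if Even j then b (1 + (j / 2 : ℕ)) else b ((n - i : ℕ) - (j / 2 : ℕ))) =
        y ^ i * φ (a (omega n i)) * (y ^ (j + 1) * signedCount y (n - i - 1 - j) *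
          if Even j then b (1 + (j / 2 : ℕ)) else b ((n - i : ℕ) - (j / 2 : ℕ))) := by
      intro j
      rw [show n - (i + j + 1) = n - i - 1 - j by omega]
      ring
    simp only [this, ← mul_sum]
    ring
  simp only [h3, sum_sub_distrib]
  congr 1
  simp only [mul_sum]
  rw [sum_sigma', sum_sigma']
  -- The term with i initial ones and interlaced index j carries y^(i+j+1); it is filed under the
  -- total exponent i + j + 1.
  refine sum_nbij' (fun x => ⟨x.1 + x.2 + 1, x.2⟩) (fun x => ⟨x.1 - 1 - x.2, x.2⟩) ?_ ?_ ?_ ?_ ?_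
  · rintro ⟨i, j⟩ h
    simp only [mem_sigma, mem_range] at h ⊢
    omega
  · rintro ⟨i, j⟩ h
    simp only [mem_sigma, mem_range] at h ⊢
    omega
  · rintro ⟨i, j⟩ h
    simp only [mem_sigma, mem_range, Sigma.mk.injEq, heq_eq_eq, and_true] at h ⊢
    omega
  · rintro ⟨i, j⟩ h
    simp only [mem_sigma, mem_range, Sigma.mk.injEq, heq_eq_eq, and_true] at h ⊢
    omega
  · rintro ⟨i, j⟩ h
    simp only [show i + j + 1 - 1 - j = i by omega]

end Straightened

/-! ### The orbit sum as a sum over words -/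

section OrbitSum

variable {n : ℕ}

/-- The pairs of a vector with `k` non-zero entries `±1` and of a position of such an entry. -/
def signPairs (n k : ℕ) : Finset ((Fin n → SignType) × Fin n) :=
  univ.filter fun x => #{j | x.1 j ≠ 0} = k ∧ x.1 x.2 ≠ 0

/-- Any bijection from the k-set to the first k positions extends to a permutation; a transposition
within these positions then moves the image of the marked element to the first one. This realizes
every marked word in the orbit of (λ_k, e_1). -/
theorem exists_perm {k : ℕ} (hk : k ≤ n) (hn : 0 < n) (s : Fin n → Prop) [DecidablePred s]
    (hs : #{j | s j} = k) (i : Fin n) (hi : s i) :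
    ∃ σ : Equiv.Perm (Fin n), (∀ j, s j ↔ (σ j : ℕ) < k) ∧ (σ i : ℕ) = 0 := by
  have h1 : Fintype.card {j // s j} = Fintype.card {j : Fin n // (j : ℕ) < k} := by
    rw [Fintype.card_subtype, hs, Fintype.card_subtype, Fin.card_filter_val_lt, min_eq_right hk]
  have e := Fintype.equivOfCardEq h1
  have h2 : ∀ j, s j ↔ (e.extendSubtype j : ℕ) < k := fun j =>
    ⟨fun h => e.extendSubtype_mem j h, fun h => by
      by_contra hc
      exact e.extendSubtype_not_mem j hc h⟩
  have hpos : 0 < k := by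
    have := (h2 i).mp hi
    omega
  refine ⟨Equiv.swap (e.extendSubtype i) ⟨0, hn⟩ * e.extendSubtype, fun j => ?_, by simp⟩
  rw [h2, Equiv.Perm.mul_apply]
  rcases eq_or_ne (e.extendSubtype j) (e.extendSubtype i) with h | h
  · rw [h, Equiv.swap_apply_left]
    simp [hpos, (h2 i).mp hi]
  · rcases eq_or_ne (e.extendSubtype j) ⟨0, hn⟩ with h' | h'
    · rw [h', Equiv.swap_apply_right]
      simp [hpos, (h2 i).mp hi]
    · rw [Equiv.swap_apply_of_ne_of_ne h h']

/-- The orbit of `(e_1 + ⋯ + e_k, e_1)` under signed permutations. -/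
theorem image_act_firstOnes {k : ℕ} (hk1 : 1 ≤ k) (hk : k ≤ n) :
    (univ.image fun w : SignedPerm n => (w.act (firstOnes n k ℚ), w.act (firstOnes n 1 ℤ))) =
      (signPairs n k).image fun x =>
        ((fun j => ((x.1 j : ℤ) : ℚ) : Vec n), (Pi.single x.2 (x.1 x.2 : ℤ) : Fin n → ℤ)) := by
  have hn : 0 < n := by omega
  ext p
  simp only [mem_image, mem_univ, true_and, signPairs, mem_filter]
  have hsgn : ∀ u : ℤˣ, ((SignType.sign (u : ℤ) : SignType) : ℤ) = (u : ℤ) := by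
    intro u
    rcases Int.units_eq_one_or u with h | h <;> simp [h]
  constructor
  · rintro ⟨w, rfl⟩
    refine ⟨(fun j => if (w.2 j : ℕ) < k then SignType.sign ((w.1 j : ℤˣ) : ℤ) else 0,
      w.2.symm ⟨0, hn⟩), ⟨?_, ?_⟩, ?_⟩
    · have : (univ.filter fun j => (if (w.2 j : ℕ) < k then SignType.sign ((w.1 j : ℤˣ) : ℤ) else 0)
          ≠ 0) = univ.filter fun j => (w.2 j : ℕ) < k := by
        ext j
        simp
      have h5 : #{j : Fin n | (j : ℕ) < k} = k := by
        rw [Fin.card_filter_val_lt, min_eq_right hk]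
      conv_rhs => rw [← h5]
      rw [this, ← card_map w.2.toEmbedding]
      congr 1
      ext j
      simp
    · simp
      omega
    · refine Prod.ext ?_ ?_
      · funext j
        by_cases h : (w.2 j : ℕ) < k
        · simp [SignedPerm.act, firstOnes, h, hsgn]
        · simp [SignedPerm.act, firstOnes, h]
      · funext j
        rcases eq_or_ne j (w.2.symm ⟨0, hn⟩) with rfl | h
        · simp [SignedPerm.act, firstOnes, hsgn, show 0 < k by omega]
        · have h' : (w.2 j : ℕ) ≠ 0 := fun h0 => h (by
            rw [Equiv.eq_symm_apply]; exact Fin.ext h0)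
          simp [SignedPerm.act, firstOnes, h, h']
  · rintro ⟨⟨s, i⟩, ⟨hs, hi⟩, rfl⟩
    obtain ⟨σ, h1, h2⟩ := exists_perm hk hn (fun j => s j ≠ 0) hs i hi
    -- The sign chosen where `s` vanishes is immaterial, since it multiplies a zero coordinate.
    refine ⟨(fun j => if s j = -1 then -1 else 1, σ), Prod.ext ?_ ?_⟩
    · funext j
      have := h1 j
      rcases h : s j <;> simp_all [SignedPerm.act, firstOnes]
    · funext j
      rcases eq_or_ne j i with rfl | hj
      · rcases h : s j <;> simp_all [SignedPerm.act, firstOnes]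
      · have h' : (σ j : ℕ) ≠ 0 := fun h0 => hj (σ.injective (Fin.ext (h0.trans h2.symm)))
        simp [SignedPerm.act, firstOnes, hj, h']

theorem signPairs_injOn (n k : ℕ) : Set.InjOn (fun x : (Fin n → SignType) × Fin n =>
    ((fun j => ((x.1 j : ℤ) : ℚ) : Vec n), (Pi.single x.2 (x.1 x.2 : ℤ) : Fin n → ℤ)))
    (signPairs n k) := by
  rintro ⟨s, i⟩ h ⟨s', i'⟩ h' heq
  simp only [Prod.mk.injEq] at heq
  obtain ⟨h1, h2⟩ := heq
  have hinj : Function.Injective fun x : SignType => ((x : ℤ) : ℚ) := by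
    intro x y
    cases x <;> cases y <;> norm_num
  have hss : s = s' := by
    funext j
    exact hinj (congrFun h1 j)
  subst hss
  refine Prod.ext rfl ?_
  by_contra hne
  have h3 := congrFun h2 i
  simp only [Pi.single_eq_same, Pi.single_eq_of_ne (show i ≠ i' from hne)] at h3
  simp only [signPairs, coe_filter, Set.mem_ofPred_eq] at h
  have : s i ≠ 0 := h.2.2
  rcases h4 : s i <;> simp_all

variable {R : Type*} [CommRing R]

theorem sum_signType {M : Type*} [AddCommMonoid M] (f : SignType → M) :
    ∑ c, f c = f 0 + f 1 + f (-1) := by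
  have : (univ : Finset SignType) = {0, 1, -1} := by decide
  rw [this, sum_insert (by decide), sum_insert (by decide), sum_singleton, add_assoc]

theorem sum_signType_succ {M : Type*} [AddCommMonoid M] (N : ℕ) (f : (Fin (N + 1) → SignType) → M) :
    ∑ s, f s = ∑ s : Fin N → SignType, f (Fin.cons 0 s) + ∑ s : Fin N → SignType, f (Fin.cons 1 s) +
      ∑ s : Fin N → SignType, f (Fin.cons (-1) s) := by
  rw [← (Fin.consEquiv fun _ => SignType).sum_comp, Fintype.sum_prod_type, sum_signType]
  rfl

/-- The weight of a letter with `d` letters after it. -/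
def letterWeight (hp hm : ℕ → R) (d : ℕ) : SignType → R
  | 0 => 0
  | 1 => hp d
  | -1 => hm d

/-- Links the recursive sums, which suit straightening, with sums over sign vectors, which come from
the orbit. Position j of a word of length N has N - 1 - j letters after it. -/
theorem wordSum_eq_sum (y : R) (hp hm : ℕ → R) (N : ℕ) : ∀ f : List ℤ → R,
    wordSum y N f = ∑ s : Fin N → SignType,
        y ^ #{j | s j ≠ 0} * f (List.ofFn fun j => (s j : ℤ)) ∧
      weightedWordSum y hp hm N f = ∑ s : Fin N → SignType,
        y ^ #{j | s j ≠ 0} * (∑ j : Fin N, letterWeight hp hm (N - 1 - j) (s j)) *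
          f (List.ofFn fun j => (s j : ℤ)) := by
  induction N with
  | zero => intro f; simp [wordSum, weightedWordSum]
  | succ N ih =>
    intro f
    have hcard : ∀ (c : SignType) (s : Fin N → SignType),
        #{j | (Fin.cons c s : Fin (N + 1) → SignType) j ≠ 0} =
          (if c ≠ 0 then 1 else 0) + #{j | s j ≠ 0} := by
      intro c s
      rw [Fin.card_filter_univ_succ]
      simp
      split_ifs <;> simp [add_comm]
    have hw : ∀ (c : SignType) (s : Fin N → SignType),
        ∑ j : Fin (N + 1), letterWeight hp hm (N + 1 - 1 - j)
          ((Fin.cons c s : Fin (N + 1) → SignType) j) =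
        letterWeight hp hm N c + ∑ j : Fin N, letterWeight hp hm (N - 1 - j) (s j) := by
      intro c s
      rw [Fin.sum_univ_succ]
      simp only [Fin.cons_zero, Fin.cons_succ, Fin.val_zero, Fin.val_succ]
      congr 1
      refine sum_congr rfl fun j _ => ?_
      congr 1
      omega
    rw [wordSum, weightedWordSum, (ih _).1, (ih _).1, (ih _).1, (ih _).2, (ih _).2, (ih _).2,
      sum_signType_succ, sum_signType_succ]
    simp only [hcard, hw, List.ofFn_succ, Fin.cons_zero, Fin.cons_succ]
    have l0 : letterWeight hp hm N 0 = 0 := rfl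
    have l1 : letterWeight hp hm N 1 = hp N := rfl
    have l2 : letterWeight hp hm N (-1) = hm N := rfl
    simp only [l0, l1, l2, mul_sum, ← sum_add_distrib]
    constructor
    · refine sum_congr rfl fun s _ => ?_
      simp
      ring
    · refine sum_congr rfl fun s _ => ?_
      simp [← mul_sum]
      ring

end OrbitSum

/-! ### The minuscule recurrences and the simplified recurrences are equivalent -/

section Equivalence

variable {n : ℕ} (a : DominantWeight n → LaurentSeries ℂ)

theorem q_ne_zero : q ≠ 0 := HahnSeries.single_ne_zero one_ne_zero

theorem q_pow (k : ℕ) : q ^ k = HahnSeries.single (k : ℤ) (1 : ℂ) := by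
  simp [q]

theorem one_sub_q_sq_ne_zero : 1 - q ^ 2 ≠ 0 := by
  intro h
  have := congrArg (fun x : LaurentSeries ℂ => x.coeff 0) h
  rw [q_pow] at this
  simp at this

/-- The contribution of an entry `1` with `d` entries after it. -/
noncomputable def plusWeight (d : ℕ) : LaurentSeries ℂ :=
  q ^ (-(2 * (d : ℤ) + 1)) + q ^ (2 * (d : ℤ) + 2)

/-- The contribution of an entry `-1` with `d` entries after it. -/
noncomputable def minusWeight (d : ℕ) : LaurentSeries ℂ :=
  q ^ (2 * (d : ℤ) + 1) + q ^ (-(2 * (d : ℤ)))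

/-- The coordinate of 2ρ at a position followed by d entries is 2d + 1. -/
theorem letterWeight_eq {i : Fin n} {c : SignType} (hc : c ≠ 0) :
    q ^ (-(twoRho n i * (c : ℤ))) + q ^ (1 + twoRho n i * (c : ℤ)) =
      letterWeight plusWeight minusWeight (n - 1 - i) c := by
  have h : ((n - 1 - i : ℕ) : ℤ) = n - 1 - i := by omega
  rcases c with _ | _ | _
  · exact absurd rfl hc
  · change _ = minusWeight _
    rw [minusWeight, h]
    simp only [twoRho]
    congr 2 <;> simp <;> ring
  · change _ = plusWeight _
    rw [plusWeight, h]
    simp only [twoRho]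
    congr 2 <;> simp <;> ring

/-- The generating polynomial of the minuscule recurrences. -/
noncomputable def orbitPolynomial : Polynomial (LaurentSeries ℂ) :=
  weightedWordSum Polynomial.X (fun d => Polynomial.C (plusWeight d))
    (fun d => Polynomial.C (minusWeight d)) n fun l => Polynomial.C (wordValue a l)

/-- The exponent of y counts the non-zero entries, and a word lies in the orbit of λ_k exactly when
this number is k. -/
theorem minusculeRecurrence_iff {k : ℕ} (hk1 : 1 ≤ k) (hk : k ≤ n) :
    MinusculeRecurrence n a k ↔ (orbitPolynomial a).coeff k = 0 := by
  unfold MinusculeRecurrence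
  rw [image_act_firstOnes hk1 hk, sum_image (signPairs_injOn n k), signPairs, sum_filter,
    Fintype.sum_prod_type, orbitPolynomial, (wordSum_eq_sum _ _ _ _ _).2,
    Polynomial.finsetSum_coeff]
  refine iff_of_eq (congrArg (· = 0) (sum_congr rfl fun s _ => ?_))
  have hC : ∀ (d : ℕ) (c : SignType), letterWeight (fun d => Polynomial.C (plusWeight d))
      (fun d => Polynomial.C (minusWeight d)) d c =
        Polynomial.C (letterWeight plusWeight minusWeight d c) := by
    intro d c
    rcases c with _ | _ | _
    · exact (map_zero Polynomial.C).symm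
    · rfl
    · rfl
  simp only [hC]
  rw [← map_sum, mul_assoc, ← map_mul, Polynomial.coeff_X_pow_mul', Polynomial.coeff_C]
  have hv : wordValue a (List.ofFn fun j => (s j : ℤ)) = extend a fun j => ((s j : ℤ) : ℚ) := by
    unfold wordValue
    congr 1
    funext i
    simp
  have hz : ∀ i : Fin n, ∑ j, twoRho n j * (Pi.single i (s i : ℤ) : Fin n → ℤ) j =
      twoRho n i * (s i : ℤ) := by
    intro i
    rw [sum_eq_single i (fun j _ hj => by simp [hj]) (by simp)]
    simp
  by_cases hs : #{j | s j ≠ 0} = k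
  · simp only [hs, true_and, le_refl, if_true, Nat.sub_self, hv, sum_mul, hz]
    refine sum_congr rfl fun i _ => ?_
    split_ifs with hi
    · rw [letterWeight_eq hi, mul_comm]
    · rw [not_not] at hi
      rw [hi]
      exact (zero_mul _).symm
  · simp only [hs, false_and, if_false, sum_const_zero]
    symm
    split_ifs with h1 h2
    · exact absurd (by omega) hs
    · rfl
    · rfl

/-- The difference of the two sides of the simplified recurrence. -/
noncomputable def defect (k : ℕ) : LaurentSeries ℂ :=
  a (omega n k) * c n k - (∑ i ∈ Icc 1 ((k + 1) / 2), a (omega n (k + 1 - 2 * i)) * b i +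
      ∑ i ∈ Icc 1 (k / 2), a (omega n (k - 2 * i)) * b (n - k + i + 1))

theorem simplifiedRecurrence_iff (k : ℕ) : SimplifiedRecurrence n a k ↔ defect a k = 0 := by
  rw [defect, sub_eq_zero]
  rfl

theorem c_zero : c n 0 = 0 := by simp [c]

/-- Identifies `c n p` as the total `plusWeight` of p initial ones: two geometric sums in closed
form. -/
theorem c_succ {p : ℕ} (hp : p < n) : c n (p + 1) = c n p + plusWeight (n - 1 - p) := by
  have hq := q_ne_zero
  have h1 := one_sub_q_sq_ne_zero
  obtain ⟨d, rfl⟩ : ∃ d, n = p + 1 + d := Nat.exists_eq_add_of_le hp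
  have e1 : p + 1 + d - 1 - p = d := by omega
  rw [c, c, plusWeight, e1]
  have z1 : q ^ (-2 * ((p + 1 + d : ℕ) : ℤ) + 1) = (q ^ p)⁻¹ ^ 2 * (q ^ d)⁻¹ ^ 2 * q⁻¹ := by
    rw [show -2 * ((p + 1 + d : ℕ) : ℤ) + 1 = -(2 * p + 2 * d + 1 : ℕ) by push_cast; ring,
      zpow_neg, zpow_natCast]
    field_simp
    ring
  have z2 : q ^ (4 * ((p + 1 + d : ℕ) : ℤ) - 2 * ((p + 1 : ℕ) : ℤ) + 1) =
      (q ^ p) ^ 2 * (q ^ d) ^ 4 * q ^ 3 := by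
    rw [show 4 * ((p + 1 + d : ℕ) : ℤ) - 2 * ((p + 1 : ℕ) : ℤ) + 1 = (2 * p + 4 * d + 3 : ℕ) by
      push_cast; ring, zpow_natCast]
    ring
  have z3 : q ^ (4 * ((p + 1 + d : ℕ) : ℤ) - 2 * (p : ℤ) + 1) =
      (q ^ p) ^ 2 * (q ^ d) ^ 4 * q ^ 5 := by
    rw [show 4 * ((p + 1 + d : ℕ) : ℤ) - 2 * (p : ℤ) + 1 = (2 * p + 4 * d + 5 : ℕ) by
      push_cast; ring, zpow_natCast]
    ring
  have z4 : q ^ (-(2 * (d : ℤ) + 1)) = (q ^ d)⁻¹ ^ 2 * q⁻¹ := by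
    rw [show -(2 * (d : ℤ) + 1) = -(2 * d + 1 : ℕ) by push_cast; ring, zpow_neg, zpow_natCast]
    field_simp
    ring
  have z5 : q ^ (2 * (d : ℤ) + 2) = (q ^ d) ^ 2 * q ^ 2 := by
    rw [show 2 * (d : ℤ) + 2 = (2 * d + 2 : ℕ) by push_cast; ring, zpow_natCast]
    ring
  rw [z1, z2, z3, z4, z5]
  have hp0 : q ^ p ≠ 0 := pow_ne_zero _ hq
  have hd0 : q ^ d ≠ 0 := pow_ne_zero _ hq
  field_simp
  ring

theorem b_one : b 1 = minusWeight 0 := by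
  have h1 := one_sub_q_sq_ne_zero
  have h2 : q ^ (4 * ((1 : ℕ) : ℤ) - 2) = q ^ 2 := by
    rw [show 4 * ((1 : ℕ) : ℤ) - 2 = (2 : ℕ) by norm_num, zpow_natCast]
  rw [b, minusWeight, h2, div_self h1]
  simp

/-- Identifies `b (d + 1)` as the sum of the domino weights up to d, starting from the weight of a
last -1. -/
theorem b_succ (d : ℕ) : b (d + 2) - b (d + 1) = plusWeight d + minusWeight (d + 1) := by
  have hq := q_ne_zero
  have h1 := one_sub_q_sq_ne_zero
  have hd0 : q ^ d ≠ 0 := pow_ne_zero _ hq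
  have z1 : q ^ (-2 * ((d + 2 : ℕ) : ℤ) + 2) = (q ^ d)⁻¹ ^ 2 * q⁻¹ ^ 2 := by
    rw [show -2 * ((d + 2 : ℕ) : ℤ) + 2 = -(2 * d + 2 : ℕ) by push_cast; ring,
      zpow_neg, zpow_natCast]
    field_simp
    ring
  have z2 : q ^ (4 * ((d + 2 : ℕ) : ℤ) - 2) = (q ^ d) ^ 4 * q ^ 6 := by
    rw [show 4 * ((d + 2 : ℕ) : ℤ) - 2 = (4 * d + 6 : ℕ) by push_cast; ring, zpow_natCast]
    ring
  have z3 : q ^ (-2 * ((d + 1 : ℕ) : ℤ) + 2) = (q ^ d)⁻¹ ^ 2 := by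
    rw [show -2 * ((d + 1 : ℕ) : ℤ) + 2 = -(2 * d : ℕ) by push_cast; ring,
      zpow_neg, zpow_natCast]
    field_simp
    ring
  have z4 : q ^ (4 * ((d + 1 : ℕ) : ℤ) - 2) = (q ^ d) ^ 4 * q ^ 2 := by
    rw [show 4 * ((d + 1 : ℕ) : ℤ) - 2 = (4 * d + 2 : ℕ) by push_cast; ring, zpow_natCast]
    ring
  have z5 : q ^ (-(2 * (d : ℤ) + 1)) = (q ^ d)⁻¹ ^ 2 * q⁻¹ := by
    rw [show -(2 * (d : ℤ) + 1) = -(2 * d + 1 : ℕ) by push_cast; ring, zpow_neg, zpow_natCast]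
    field_simp
    ring
  have z6 : q ^ (2 * (d : ℤ) + 2) = (q ^ d) ^ 2 * q ^ 2 := by
    rw [show 2 * (d : ℤ) + 2 = (2 * d + 2 : ℕ) by push_cast; ring, zpow_natCast]
    ring
  have z7 : q ^ (2 * ((d + 1 : ℕ) : ℤ) + 1) = (q ^ d) ^ 2 * q ^ 3 := by
    rw [show 2 * ((d + 1 : ℕ) : ℤ) + 1 = (2 * d + 3 : ℕ) by push_cast; ring, zpow_natCast]
    ring
  have z8 : q ^ (-(2 * ((d + 1 : ℕ) : ℤ))) = (q ^ d)⁻¹ ^ 2 * q⁻¹ ^ 2 := by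
    rw [show -(2 * ((d + 1 : ℕ) : ℤ)) = -(2 * d + 2 : ℕ) by push_cast; ring, zpow_neg,
      zpow_natCast]
    field_simp
    ring
  rw [b, b, plusWeight, minusWeight, z1, z2, z3, z4, z5, z6, z7, z8]
  field_simp
  ring

/-- Even i take b from the lower end of the interlaced sequence and odd i from the upper end; these
are the two sums of the simplified recurrence. -/
theorem defect_eq {j : ℕ} (hj : j ≤ n) : c n j * a (omega n j) -
    ∑ i ∈ range j, a (omega n (j - 1 - i)) * (if Even i then b (1 + i / 2)
      else b (n - (j - 1 - i) - i / 2)) = defect a j := by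
  rw [defect, mul_comm, sum_range_parity]
  congr 2
  · refine sum_congr rfl fun i hi => ?_
    rw [mem_Icc] at hi
    have e : Even (2 * i - 2) := ⟨i - 1, by omega⟩
    rw [if_pos e]
    congr 3 <;> omega
  · refine sum_congr rfl fun i hi => ?_
    rw [mem_Icc] at hi
    have e : ¬ Even (2 * i - 1) := by
      rw [Nat.not_even_iff_odd]
      exact ⟨i - 1, by omega⟩
    rw [if_neg e]
    congr 3 <;> omega

theorem orbitPolynomial_eq : orbitPolynomial a = ∑ j ∈ range (n + 1),
    Polynomial.X ^ j * signedCount Polynomial.X (n - j) * Polynomial.C (defect a j) := by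
  rw [orbitPolynomial, weightedWordSum_eq Polynomial.C Polynomial.X
    (fun d => Polynomial.C (plusWeight d)) (fun d => Polynomial.C (minusWeight d)) a
    (fun j => Polynomial.C (c n j)) (fun p hp => by rw [c_succ hp, map_add])
    (by rw [c_zero, map_zero]) (fun z => Polynomial.C (b z.toNat))
    (congrArg Polynomial.C b_one) (fun d => ?_)]
  · refine sum_congr rfl fun j hj => congrArg _ ?_
    rw [mem_range] at hj
    rw [← defect_eq a (by omega), map_sub, map_mul, map_sum]
    refine congrArg _ (sum_congr rfl fun i hi => ?_)
    rw [mem_range] at hi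
    -- Only positive indices of b occur, so its extension to ℤ through `toNat` changes nothing, and
    -- the natural subtractions are exact.
    have e1 : ((1 : ℤ) + (i / 2 : ℕ)).toNat = 1 + i / 2 := by omega
    have e2 : (((n - (j - 1 - i) : ℕ) : ℤ) - (i / 2 : ℕ)).toNat = n - (j - 1 - i) - i / 2 := by
      omega
    simp only [e1, e2]
    rw [map_mul, apply_ite Polynomial.C]
  · rw [← map_add, ← b_succ, map_sub]
    rfl

theorem coeff_zero_signedCount (N : ℕ) :
    (signedCount (Polynomial.X : Polynomial (LaurentSeries ℂ)) N).coeff 0 = 1 := by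
  induction N using Nat.twoStepInduction with
  | zero => simp [signedCount]
  | one => simp [signedCount]
  | more N _ ih => simp [signedCount, ih, Polynomial.mul_coeff_zero]

/-- Because `signedCount` has constant term 1, the coefficients are a unitriangular transform of the
defects. -/
theorem coeff_orbitPolynomial {k : ℕ} (hk : k ≤ n) : (orbitPolynomial a).coeff k =
    ∑ j ∈ range k, (signedCount (Polynomial.X : Polynomial (LaurentSeries ℂ)) (n - j)).coeff (k - j)
      * defect a j + defect a k := by
  rw [orbitPolynomial_eq, Polynomial.finsetSum_coeff]
  have h : ∀ j, (Polynomial.X ^ j * signedCount Polynomial.X (n - j) *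
      Polynomial.C (defect a j)).coeff k = if j ≤ k then
        (signedCount (Polynomial.X : Polynomial (LaurentSeries ℂ)) (n - j)).coeff (k - j) *
          defect a j else 0 := by
    intro j
    rw [Polynomial.coeff_mul_C, Polynomial.coeff_X_pow_mul']
    split_ifs <;> simp
  simp only [h]
  rw [← sum_filter, show (range (n + 1)).filter (· ≤ k) = range (k + 1) by
    ext j; simp; omega, sum_range_succ, Nat.sub_self, coeff_zero_signedCount, one_mul]

theorem defect_zero : defect a 0 = 0 := by simp [defect, c_zero]

/-- The minuscule recurrences up to `m` are equivalent to the simplified recurrences up to `m`. -/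
theorem minusculeRecurrence_iff_simplifiedRecurrence {m : ℕ} (hm : m ≤ n) :
    (∀ k, 1 ≤ k → k ≤ m → MinusculeRecurrence n a k) ↔
      ∀ k, 1 ≤ k → k ≤ m → SimplifiedRecurrence n a k := by
  constructor
  · intro h
    -- Solves the unitriangular system from below; it starts because `defect a 0` vanishes for every
    -- family.
    have key : ∀ k, k ≤ m → defect a k = 0 := by
      intro k
      induction k using Nat.strong_induction_on with
      | _ k ih =>
        intro hk
        rcases Nat.eq_zero_or_pos k with rfl | hpos
        · exact defect_zero a
        · have h1 := (minusculeRecurrence_iff a hpos (hk.trans hm)).mp (h k hpos hk)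
          rw [coeff_orbitPolynomial a (hk.trans hm), sum_eq_zero, zero_add] at h1
          · exact h1
          · intro j hj
            rw [mem_range] at hj
            rw [ih j hj (by omega), mul_zero]
    exact fun k _ hk => (simplifiedRecurrence_iff a k).mpr (key k hk)
  · intro h k hk1 hk
    rw [minusculeRecurrence_iff a hk1 (hk.trans hm), coeff_orbitPolynomial a (hk.trans hm)]
    have key : ∀ j, j ≤ m → defect a j = 0 := by
      intro j hj
      rcases Nat.eq_zero_or_pos j with rfl | hpos
      · exact defect_zero a
      · exact (simplifiedRecurrence_iff a j).mp (h j hpos hj)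
    rw [key k hk, add_zero]
    refine sum_eq_zero fun j hj => ?_
    rw [mem_range] at hj
    rw [key j (by omega), mul_zero]

end Equivalence

/-! ### The specialized kernel is a finite product -/

section SpecializedKernel

/-- The substitution `q ↦ -q`, `t ↦ q²` over an arbitrary ring. -/
noncomputable def specializationOver (S : Type*) [CommRing S] : Fin 2 → MvPowerSeries Unit S :=
  ![-(PowerSeries.X : PowerSeries S), (PowerSeries.X : PowerSeries S) ^ 2]

variable {S : Type*} [CommRing S]

theorem hasSubst_specializationOver : MvPowerSeries.HasSubst (specializationOver S) := by
  refine MvPowerSeries.hasSubst_of_constantCoeff_zero fun s => ?_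
  fin_cases s
  · change PowerSeries.constantCoeff (-(PowerSeries.X : PowerSeries S)) = 0
    simp
  · change PowerSeries.constantCoeff ((PowerSeries.X : PowerSeries S) ^ 2) = 0
    simp

/-- The coefficients of the specialized monomials are integers. -/
theorem coeff_specializationOver (S : Type*) [CommRing S] (d : Fin 2 →₀ ℕ) (e : Unit →₀ ℕ) :
    MvPowerSeries.coeff e (d.prod fun s k => specializationOver S s ^ k) =
      ((MvPowerSeries.coeff e (d.prod fun s k => specializationOver ℤ s ^ k) : ℤ) : S) := by
  have h : ∀ s, MvPowerSeries.map (Int.castRingHom S) (specializationOver ℤ s) =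
      specializationOver S s := by
    intro s
    fin_cases s
    · change MvPowerSeries.map (Int.castRingHom S) (-(MvPowerSeries.X ())) = -(MvPowerSeries.X ())
      simp
    · change MvPowerSeries.map (Int.castRingHom S) ((MvPowerSeries.X ()) ^ 2) =
        (MvPowerSeries.X ()) ^ 2
      simp
  have h2 : (d.prod fun s k => specializationOver S s ^ k) = MvPowerSeries.map (Int.castRingHom S)
      (d.prod fun s k => specializationOver ℤ s ^ k) := by
    rw [Finsupp.prod, Finsupp.prod, map_prod]
    simp only [map_pow, h]
  rw [h2, MvPowerSeries.coeff_map, eq_intCast]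

/-- Specialization commutes with additive maps of the coefficients. -/
theorem coeff_subst_specializationOver {S T : Type*} [CommRing S] [CommRing T] (Λ : S →+ T)
    (K : MvPowerSeries (Fin 2) S) (C : MvPowerSeries (Fin 2) T)
    (h : ∀ d, MvPowerSeries.coeff d C = Λ (MvPowerSeries.coeff d K)) (e : Unit →₀ ℕ) :
    MvPowerSeries.coeff e (MvPowerSeries.subst (specializationOver T) C) =
      Λ (MvPowerSeries.coeff e (MvPowerSeries.subst (specializationOver S) K)) := by
  rw [MvPowerSeries.coeff_subst hasSubst_specializationOver,
    MvPowerSeries.coeff_subst hasSubst_specializationOver, AddMonoidHom.map_finsum]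
  · refine finsum_congr fun d => ?_
    rw [coeff_specializationOver T, coeff_specializationOver S, h]
    simp only [smul_eq_mul]
    rw [mul_comm, ← zsmul_eq_mul, mul_comm, ← zsmul_eq_mul, map_zsmul]
  · exact MvPowerSeries.coeff_subst_finite hasSubst_specializationOver K e

variable {n : ℕ}

/-- The substitution as a ring homomorphism on the series over the group algebra. -/
noncomputable def substKernel (n : ℕ) : KernelRing n →+* PowerSeries (GroupAlg n) :=
  (MvPowerSeries.substAlgHom (R := GroupAlg n) (S := GroupAlg n)
    (hasSubst_specializationOver (S := GroupAlg n))).toRingHom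

theorem substKernel_apply (K : KernelRing n) :
    substKernel n K = MvPowerSeries.subst (specializationOver (GroupAlg n)) K :=
  MvPowerSeries.substAlgHom_apply hasSubst_specializationOver K

theorem substKernel_X_zero : substKernel n (MvPowerSeries.X 0) = -PowerSeries.X := by
  rw [substKernel_apply, MvPowerSeries.subst_X hasSubst_specializationOver]
  rfl

theorem substKernel_X_one : substKernel n (MvPowerSeries.X 1) = PowerSeries.X ^ 2 := by
  rw [substKernel_apply, MvPowerSeries.subst_X hasSubst_specializationOver]
  rfl

theorem substKernel_C (g : GroupAlg n) :
    substKernel n (MvPowerSeries.C g) = PowerSeries.C g := by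
  rw [substKernel_apply, MvPowerSeries.subst_C]
  rfl

/-- The factors `1 - e^α (-q)^i` into which the kernel telescopes. -/
noncomputable def telescopeFactor (α : Vec n) (i : ℕ) : PowerSeries (GroupAlg n) :=
  1 - PowerSeries.C (fexp α) * (-PowerSeries.X) ^ i

/-- The specialization turns t q^i into (-q)^(i+2), so each denominator is the numerator of the
following factor. Stated without division. -/
theorem telescopeFactor_mul_substKernel (i : ℕ) (α : Vec n) :
    telescopeFactor α (i + 2) * substKernel n (rootFactor i α) = telescopeFactor α (i + 1) := by
  have h := congrArg (substKernel n) (denominator_mul i α)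
  simp only [map_mul, map_sub, map_one, map_pow, substKernel_C, substKernel_X_zero,
    substKernel_X_one] at h
  rw [telescopeFactor, telescopeFactor, ← h]
  ring

theorem telescopeFactor_mul_prod (N : ℕ) (α : Vec n) :
    telescopeFactor α (N + 1) * ∏ i ∈ range N, substKernel n (rootFactor i α) =
      1 + PowerSeries.C (fexp α) * PowerSeries.X := by
  induction N with
  | zero => simp [telescopeFactor]
  | succ N ih =>
    rw [prod_range_succ, ← ih, ← telescopeFactor_mul_substKernel N α]
    ring

/-- The specialized kernel `∏_α (1 + q e^α)`, as a power series in `q`. -/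
noncomputable def finiteKernel (n : ℕ) : PowerSeries (GroupAlg n) :=
  (1 + PowerSeries.X) ^ n * ∏ α ∈ roots n, (1 + PowerSeries.C (fexp α) * PowerSeries.X)

theorem X_pow_dvd_telescopeFactor_sub_one (α : Vec n) (N : ℕ) :
    PowerSeries.X ^ N ∣ telescopeFactor α N - 1 :=
  ⟨-(PowerSeries.C (fexp α) * (-1) ^ N), by rw [telescopeFactor, neg_pow]; ring⟩

/-- Modulo q^N only the first N factors matter, with N = k + 1. Their product telescopes to the
finite kernel up to the factors 1 - (-q)^(N+1) e^α, which are 1 modulo q^(N+1). -/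
theorem coeff_substKernel_macdonaldKernel (k : ℕ) :
    PowerSeries.coeff k (substKernel n (macdonaldKernel n)) =
      PowerSeries.coeff k (finiteKernel n) := by
  set N := k + 1 with hN
  have h1 : (MvPowerSeries.X 0 ^ N : KernelRing n) ∣
      macdonaldKernel n - ∏ i ∈ range N, kernelFactor n i := by
    rw [MvPowerSeries.X_pow_dvd_iff]
    intro d hd
    rw [map_sub, coeff_prod_kernelFactor n d N hd, sub_self]
  obtain ⟨G, hG⟩ := h1
  have h2 := congrArg (substKernel n) hG
  rw [map_sub, map_mul, map_pow, substKernel_X_zero, map_prod] at h2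
  have h3 : ∏ i ∈ range N, substKernel n (kernelFactor n i) =
      (∏ i ∈ range N, substKernel n (rootFactor i 0)) ^ n *
        ∏ α ∈ roots n, ∏ i ∈ range N, substKernel n (rootFactor i α) := by
    rw [prod_comm, ← prod_pow, ← prod_mul_distrib]
    refine prod_congr rfl fun i _ => ?_
    rw [kernelFactor, map_mul, map_pow, map_prod]
  set E : PowerSeries (GroupAlg n) := telescopeFactor (0 : Vec n) (N + 1) ^ n *
    ∏ α ∈ roots n, telescopeFactor α (N + 1) with hE
  have h4 : E * ∏ i ∈ range N, substKernel n (kernelFactor n i) = finiteKernel n := by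
    rw [h3, hE, finiteKernel, mul_mul_mul_comm, ← mul_pow, ← prod_mul_distrib]
    simp only [telescopeFactor_mul_prod]
    congr 2
    simp [fexp, ← AddMonoidAlgebra.one_def]
  have hpow : ∀ M : ℕ, (PowerSeries.X : PowerSeries (GroupAlg n)) ^ (N + 1) ∣
      telescopeFactor (0 : Vec n) (N + 1) ^ M - 1 := by
    intro M
    induction M with
    | zero => simp
    | succ M ih => rw [pow_succ]; exact dvd_mul_sub_one ih (X_pow_dvd_telescopeFactor_sub_one _ _)
  have h5 : (PowerSeries.X : PowerSeries (GroupAlg n)) ^ (N + 1) ∣ E - 1 :=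
    dvd_mul_sub_one (hpow n) (Finset.prod_induction _
      (fun F => (PowerSeries.X : PowerSeries (GroupAlg n)) ^ (N + 1) ∣ F - 1)
      (fun a b => dvd_mul_sub_one) (by simp) fun α _ => X_pow_dvd_telescopeFactor_sub_one α _)
  have h6 : (PowerSeries.X : PowerSeries (GroupAlg n)) ^ N ∣
      substKernel n (macdonaldKernel n) - finiteKernel n := by
    rw [← h4]
    have e : substKernel n (macdonaldKernel n) -
        E * ∏ i ∈ range N, substKernel n (kernelFactor n i) =
        (-PowerSeries.X) ^ N * substKernel n G -
          (E - 1) * ∏ i ∈ range N, substKernel n (kernelFactor n i) := by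
      rw [← h2]
      ring
    rw [e]
    refine dvd_sub ?_ ?_
    · rw [neg_pow]
      exact Dvd.dvd.mul_right (dvd_mul_left _ _) _
    · exact Dvd.dvd.mul_right ((pow_dvd_pow _ (Nat.le_succ N)).trans h5) _
  have h7 := PowerSeries.X_pow_dvd_iff.mp h6 k (by omega)
  rwa [map_sub, sub_eq_zero] at h7

/-- The coefficients of the expansion of the kernel in terms of Weyl's character formula. -/
theorem coeff_macdonaldCoeff (lam : DominantWeight n) (d : Fin 2 →₀ ℕ) :
    MvPowerSeries.coeff d (macdonaldCoeff n lam) =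
      (MvPowerSeries.coeff d (macdonaldKernel n) * alternant (rho n)).coeff (lam.1 + rho n) := by
  have hρ : algebraMap (GroupAlg n) (FractionRing (GroupAlg n)) (alternant (rho n)) ≠ 0 := by
    rw [Ne, FaithfulSMul.algebraMap_eq_zero_iff]
    exact alternant_rho_ne_zero n
  obtain ⟨hfin, h⟩ := isKernelExpansion_macdonaldCoeff n d
  rw [finsum_eq_sum_of_support_subset (s := hfin.toFinset)] at h
  · simp only [algebraMap_mul_weylCharacter] at h
    rw [← sum_div, ← map_sum, eq_div_iff hρ, ← map_mul] at h
    have h1 := IsFractionRing.injective (GroupAlg n) (FractionRing (GroupAlg n)) h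
    rw [h1, AddMonoidAlgebra.coeff_sum, Finsupp.finsetSum_apply]
    simp only [AddMonoidAlgebra.coeff_smul, Finsupp.smul_apply, coeff_alternant_dominant,
      smul_eq_mul, mul_ite, mul_one, mul_zero, sum_ite_eq']
    by_cases hmu : MvPowerSeries.coeff d (macdonaldCoeff n lam) = 0
    · simp [hmu]
    · rw [if_pos (hfin.mem_toFinset.mpr hmu)]
  · intro mu hl
    rw [Set.Finite.coe_toFinset]
    exact fun h => hl (by
      change algebraMap ℂ _ _ * _ = 0
      rw [h, map_zero, zero_mul])

/-- The specialized coefficients, in terms of the finite product. -/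
theorem specializedCoeff_eq (lam : DominantWeight n) :
    specializedCoeff n lam = ((PowerSeries.mk fun k =>
      (PowerSeries.coeff k (finiteKernel n) * alternant (rho n)).coeff (lam.1 + rho n) :
        PowerSeries ℂ) : LaurentSeries ℂ) := by
  rw [specializedCoeff]
  congr 1
  refine PowerSeries.ext fun k => ?_
  rw [PowerSeries.coeff_mk, ← coeff_substKernel_macdonaldKernel, substKernel_apply]
  -- Reading off a coefficient after multiplication by the denominator is additive but not
  -- multiplicative, so substitution has to commute with additive maps.
  exact coeff_subst_specializationOver (S := GroupAlg n) (T := ℂ)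
    { toFun := fun g => (g * alternant (rho n)).coeff (lam.1 + rho n)
      map_zero' := by simp
      map_add' := fun g h => by simp [add_mul] }
    (macdonaldKernel n) (macdonaldCoeff n lam) (fun d => coeff_macdonaldCoeff lam d) _

end SpecializedKernel

/-! ### The specialized kernel over the Laurent series -/

section LaurentKernel

variable {n : ℕ}

/-- The group algebra over the field of Laurent series in `q`. -/
abbrev LaurentAlg (n : ℕ) := AddMonoidAlgebra (LaurentSeries ℂ) (Vec n)

/-- The specialized kernel times the Weyl denominator, as a polynomial in `q`. -/
noncomputable def kernelPolynomial (n : ℕ) : Polynomial (GroupAlg n) :=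
  (1 + Polynomial.X) ^ n * (∏ α ∈ roots n, (1 + Polynomial.C (fexp α) * Polynomial.X)) *
    Polynomial.C (alternant (rho n))

/-- The interpretation of polynomials in `q` in the group algebra over the Laurent series. -/
noncomputable def toLaurentAlg (n : ℕ) : Polynomial (GroupAlg n) →+* LaurentAlg n :=
  Polynomial.eval₂RingHom (AddMonoidAlgebra.mapRingHom (Vec n)
    (HahnSeries.C : ℂ →+* LaurentSeries ℂ)) (AddMonoidAlgebra.single (0 : Vec n) q)

theorem toLaurentAlg_X : toLaurentAlg n Polynomial.X = AddMonoidAlgebra.single 0 q := by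
  simp [toLaurentAlg]

theorem toLaurentAlg_C (g : GroupAlg n) : toLaurentAlg n (Polynomial.C g) =
    AddMonoidAlgebra.mapRingHom (Vec n) (HahnSeries.C : ℂ →+* LaurentSeries ℂ) g := by
  simp [toLaurentAlg]

/-- A polynomial in q involves only finitely many exponents e^ν, so q may be moved into the
coefficients; a power series over the group algebra need not allow this. -/
theorem coeff_toLaurentAlg (P : Polynomial (GroupAlg n)) (ν : Vec n) :
    (toLaurentAlg n P).coeff ν =
      ((PowerSeries.mk fun k => (P.coeff k).coeff ν : PowerSeries ℂ) : LaurentSeries ℂ) := by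
  induction P using Polynomial.induction_on' with
  | add P Q hP hQ =>
    rw [map_add, AddMonoidAlgebra.coeff_add, Finsupp.add_apply, hP, hQ, ← PowerSeries.coe_add]
    congr 1
  | monomial k g =>
    rw [← Polynomial.C_mul_X_pow_eq_monomial, map_mul, map_pow, toLaurentAlg_X, toLaurentAlg_C,
      AddMonoidAlgebra.single_pow, nsmul_zero, AddMonoidAlgebra.coeff_mul_single_zero]
    have h : (PowerSeries.mk fun j => ((Polynomial.C g * Polynomial.X ^ k).coeff j).coeff ν :
        PowerSeries ℂ) = PowerSeries.C (g.coeff ν) * PowerSeries.X ^ k := by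
      refine PowerSeries.ext fun j => ?_
      rw [PowerSeries.coeff_mk, Polynomial.coeff_C_mul_X_pow, PowerSeries.coeff_C_mul_X_pow]
      split_ifs <;> simp
    rw [h, PowerSeries.coe_mul, PowerSeries.coe_C, PowerSeries.coe_pow, PowerSeries.coe_X]
    simp [q, HahnSeries.C_apply, HahnSeries.single_mul_single]

/-- The Weyl denominator over the Laurent series. -/
noncomputable def laurentAlternant (n : ℕ) : LaurentAlg n :=
  ∑ w : SignedPerm n, AddMonoidAlgebra.single (w.act (rho n)) ((w.sgn : ℤ) : LaurentSeries ℂ)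

/-- The specialized kernel over the Laurent series. -/
noncomputable def laurentKernel (n : ℕ) : LaurentAlg n :=
  (1 + AddMonoidAlgebra.single 0 q) ^ n * ∏ α ∈ roots n, (1 + AddMonoidAlgebra.single α q)

theorem toLaurentAlg_kernelPolynomial :
    toLaurentAlg n (kernelPolynomial n) = laurentKernel n * laurentAlternant n := by
  rw [kernelPolynomial, map_mul, map_mul, map_pow, map_prod, toLaurentAlg_C, map_add, map_one,
    toLaurentAlg_X, laurentKernel, laurentAlternant, alternant, map_sum]
  congr 1
  · congr 1
    refine prod_congr rfl fun α _ => ?_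
    rw [map_add, map_one, map_mul, toLaurentAlg_C, toLaurentAlg_X, fexp]
    simp [AddMonoidAlgebra.single_mul_single]
  · refine sum_congr rfl fun w _ => ?_
    simp [fexp, AddMonoidAlgebra.smul_single]

theorem coeff_kernelPolynomial (k : ℕ) : (kernelPolynomial n).coeff k =
    PowerSeries.coeff k (finiteKernel n) * alternant (rho n) := by
  have h : ((kernelPolynomial n : Polynomial (GroupAlg n)) : PowerSeries (GroupAlg n)) =
      finiteKernel n * PowerSeries.C (alternant (rho n)) := by
    rw [← Polynomial.coeToPowerSeries.ringHom_apply, kernelPolynomial, finiteKernel, map_mul,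
      map_mul, map_pow, map_prod]
    simp
  rw [← Polynomial.coeff_coe, h, PowerSeries.coeff_mul_C]

theorem map_algHom_kernelPolynomial (w : SignedPerm n) :
    (kernelPolynomial n).map w.algHom =
      Polynomial.C (((w.sgn : ℤ) : GroupAlg n)) * kernelPolynomial n := by
  have hr : (roots n).image w.act = roots n := by
    refine Finset.eq_of_subset_of_card_le ?_ ?_
    · intro β hβ
      obtain ⟨α, hα, rfl⟩ := mem_image.mp hβ
      exact w.act_mem_roots hα
    · rw [card_image_of_injective _ w.act_injective]
  have hp : ∏ α ∈ roots n, (1 + Polynomial.C (fexp (w.act α)) * Polynomial.X) =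
      ∏ α ∈ roots n, (1 + Polynomial.C (fexp α) * Polynomial.X) := by
    conv_rhs => rw [← hr, prod_image w.act_injective.injOn]
  have hs : (((w.sgn : ℤ) : ℂ)) • alternant (rho n) =
      ((w.sgn : ℤ) : GroupAlg n) * alternant (rho n) := by
    rcases Int.units_eq_one_or w.sgn with h | h <;> simp [h]
  simp only [kernelPolynomial, Polynomial.map_mul, Polynomial.map_pow, Polynomial.map_add,
    Polynomial.map_one, Polynomial.map_X, Polynomial.map_C, Polynomial.map_prod, w.algHom_fexp,
    w.algHom_alternant, hp, hs]
  rw [Polynomial.C_mul]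
  ring

/-- The Weyl group permutes the roots, hence fixes the product over them, while the denominator is
skew. -/
theorem coeff_laurentKernel_act (w : SignedPerm n) (ν : Vec n) :
    (laurentKernel n * laurentAlternant n).coeff (w.act ν) =
      ((w.sgn : ℤ) : LaurentSeries ℂ) * (laurentKernel n * laurentAlternant n).coeff ν := by
  rw [← toLaurentAlg_kernelPolynomial, coeff_toLaurentAlg, coeff_toLaurentAlg]
  have h : ∀ k, ((kernelPolynomial n).coeff k).coeff (w.act ν) =
      ((w.sgn : ℤ) : ℂ) * ((kernelPolynomial n).coeff k).coeff ν := by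
    intro k
    refine skew_of_algHom _ (fun w => ?_) w ν
    rw [← Polynomial.coeff_map, map_algHom_kernelPolynomial, Polynomial.coeff_C_mul]
    rcases Int.units_eq_one_or w.sgn with h | h <;> simp [h]
  simp only [h]
  rcases Int.units_eq_one_or w.sgn with h | h
  · simp [h]
  · have e : (PowerSeries.mk fun k => (((-1 : ℤˣ) : ℤ) : ℂ) *
        ((kernelPolynomial n).coeff k).coeff ν : PowerSeries ℂ) =
        -PowerSeries.mk fun k => ((kernelPolynomial n).coeff k).coeff ν := by
      refine PowerSeries.ext fun k => ?_
      simp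
    have h3 : (((-1 : ℤˣ) : ℤ) : LaurentSeries ℂ) = -1 := by simp
    rw [h, e, PowerSeries.coe_neg, h3]
    ring

/-- The coefficients of kernel times denominator form a skew function whose values at λ + ρ are the
specialized coefficients, and such a function is determined by these values. -/
theorem extend_specializedCoeff (μ : Vec n) (hμ : ∃ z : Fin n → ℤ, ∀ i, μ i = z i) :
    extend (specializedCoeff n) μ =
      (laurentKernel n * laurentAlternant n).coeff (μ + rho n) := by
  refine extend_eq_of_skew coeff_laurentKernel_act _ (fun lam => ?_) μ hμ
  rw [← toLaurentAlg_kernelPolynomial, coeff_toLaurentAlg, specializedCoeff_eq]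
  simp only [coeff_kernelPolynomial]

end LaurentKernel

/-! ### The Weyl denominator formula in type `B` -/

section Denominator

variable {R : Type*} [CommRing R]

/-- The polynomials with `u^{2k+1} - u^{-(2k+1)} = (u - u^{-1}) p_k(u² + u^{-2})`. -/
noncomputable def oddPolynomial (R : Type*) [CommRing R] : ℕ → Polynomial R
  | 0 => 1
  | 1 => Polynomial.X + 1
  | k + 2 => Polynomial.X * oddPolynomial R (k + 1) - oddPolynomial R k

/-- Monic of degree k is what reduces the determinant of the evaluations to a Vandermonde
determinant. -/
theorem oddPolynomial_monic [Nontrivial R] (k : ℕ) :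
    (oddPolynomial R k).Monic ∧ (oddPolynomial R k).natDegree = k := by
  induction k using Nat.twoStepInduction with
  | zero => simp [oddPolynomial]
  | one =>
    exact ⟨Polynomial.monic_X_add_C 1, Polynomial.natDegree_X_add_C 1⟩
  | more k ih0 ih1 =>
    have h1 : (Polynomial.X * oddPolynomial R (k + 1)).natDegree = k + 2 := by
      rw [Polynomial.natDegree_X_mul ih1.1.ne_zero, ih1.2]
    have h2 : (oddPolynomial R k).natDegree <
        (Polynomial.X * oddPolynomial R (k + 1)).natDegree := by
      rw [h1, ih0.2]
      omega
    refine ⟨?_, ?_⟩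
    · exact (Polynomial.monic_X.mul ih1.1).sub_of_left (Polynomial.degree_lt_degree h2)
    · rw [oddPolynomial, Polynomial.natDegree_sub_eq_left_of_natDegree_lt h2, h1]

/-- The sum `u² + u^{-2}`. -/
def unitSum (u : Rˣ) : R := (u : R) ^ 2 + ((u⁻¹ : Rˣ) : R) ^ 2

/-- The difference `u - u^{-1}`. -/
def unitDiff (u : Rˣ) : R := (u : R) - ((u⁻¹ : Rˣ) : R)

theorem unitDiff_mul_eval (u : Rˣ) (k : ℕ) :
    unitDiff u * (oddPolynomial R k).eval (unitSum u) =
      (u : R) ^ (2 * k + 1) - ((u⁻¹ : Rˣ) : R) ^ (2 * k + 1) := by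
  have hu : (u : R) * ((u⁻¹ : Rˣ) : R) = 1 := by simp
  unfold unitDiff unitSum
  induction k using Nat.twoStepInduction with
  | zero => simp [oddPolynomial]
  | one =>
    simp only [oddPolynomial, Polynomial.eval_add, Polynomial.eval_X, Polynomial.eval_one]
    linear_combination (((u⁻¹ : Rˣ) : R) - u) * hu
  | more k ih0 ih1 =>
    simp only [oddPolynomial, Polynomial.eval_sub, Polynomial.eval_mul, Polynomial.eval_X]
    set v := ((u⁻¹ : Rˣ) : R)
    linear_combination ((u : R) ^ 2 + v ^ 2) * ih1 - ih0 +
      ((u : R) * v + 1) * (((u : R) ^ (2 * k + 1)) - v ^ (2 * k + 1)) * hu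

variable {n : ℕ}

/-- The alternating sum `∑_w (-1)^{ℓ(w)} u^{2wρ}` for a family of units. -/
def unitAlternant (u : Fin n → Rˣ) : R :=
  ∑ w : SignedPerm n, ((w.sgn : ℤ) : R) * ∏ i, ((u i ^ w.act (twoRho n) i : Rˣ) : R)

/-- The sum over the signs factors entry by entry into differences of opposite powers; the sum over
the permutations is the determinant. -/
theorem unitAlternant_eq_det (u : Fin n → Rˣ) : unitAlternant u = (Matrix.of fun i j : Fin n =>
    ((u i ^ twoRho n j : Rˣ) : R) - ((u i ^ (-twoRho n j) : Rˣ) : R)).det := by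
  rw [← Matrix.det_transpose, Matrix.det_apply', unitAlternant, Fintype.sum_prod_type, sum_comm]
  refine sum_congr rfl fun σ _ => ?_
  simp only [Matrix.transpose_apply, Matrix.of_apply]
  have h : ∏ i, (((u i ^ twoRho n (σ i) : Rˣ) : R) - ((u i ^ (-twoRho n (σ i)) : Rˣ) : R)) =
      ∏ i, ∑ e : ℤˣ, ((e : ℤ) : R) * ((u i ^ ((e : ℤ) * twoRho n (σ i)) : Rˣ) : R) := by
    refine prod_congr rfl fun i _ => ?_
    have : (univ : Finset ℤˣ) = {1, -1} := by decide
    rw [this, sum_insert (by decide), sum_singleton]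
    simp [sub_eq_add_neg]
  rw [h, prod_univ_sum, Fintype.piFinset_univ, mul_sum]
  refine sum_congr rfl fun ε _ => ?_
  rw [prod_mul_distrib]
  simp only [SignedPerm.sgn, SignedPerm.act, Int.cast_id]
  push_cast
  ring

/-- The Weyl denominator formula. Each row has the common factor u - u⁻¹, and the quotients are
monic polynomials of successive degrees in u² + u⁻². Since 2ρ decreases, the columns come in reverse
order, whence the sign. -/
theorem unitAlternant_eq [Nontrivial R] (u : Fin n → Rˣ) : unitAlternant u =
    ((Equiv.Perm.sign (Fin.revPerm : Equiv.Perm (Fin n)) : ℤ) : R) * (∏ i, unitDiff (u i)) *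
      ∏ i, ∏ j ∈ Ioi i, (unitSum (u j) - unitSum (u i)) := by
  rw [unitAlternant_eq_det, ← Matrix.det_vandermonde (fun i => unitSum (u i)),
    Matrix.det_eval_matrixOfPolynomials_eq_det_vandermonde (fun i => unitSum (u i))
      (fun j => oddPolynomial R j) (fun j => (oddPolynomial_monic _).2)
      (fun j => (oddPolynomial_monic _).1),
    mul_assoc, ← Matrix.det_mul_column, ← Matrix.det_permute']
  congr 1
  ext i j
  have h : twoRho n j = (2 * (Fin.rev j : ℕ) + 1 : ℕ) := by
    simp only [twoRho, Fin.val_rev]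
    push_cast [Nat.cast_sub (show (j : ℕ) + 1 ≤ n by omega)]
    ring
  simp only [Matrix.of_apply, Matrix.submatrix_apply, id_eq, Fin.revPerm_apply,
    unitDiff_mul_eval, h, zpow_neg, zpow_natCast, Units.val_pow_eq_pow_val, ← inv_pow]

theorem unitAlternant_succ [Nontrivial R] {N : ℕ} (u : Fin (N + 1) → Rˣ) : unitAlternant u =
    ((Equiv.Perm.sign (Fin.revPerm : Equiv.Perm (Fin (N + 1))) : ℤ) : R) *
      (unitDiff (u 0) * ∏ j : Fin N, (unitSum (u j.succ) - unitSum (u 0))) *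
        ((∏ i : Fin N, unitDiff (u i.succ)) *
          ∏ i : Fin N, ∏ j ∈ Ioi i, (unitSum (u j.succ) - unitSum (u i.succ))) := by
  rw [unitAlternant_eq, Fin.prod_univ_succ, Fin.prod_univ_succ, Fin.prod_Ioi_zero]
  simp only [Fin.prod_Ioi_succ]
  ring

/-- The product over the roots of `B_n`. -/
theorem prod_roots {M : Type*} [CommMonoid M] (g : Vec n → M) : ∏ α ∈ roots n, g α =
    (∏ i, (g (Pi.single i 1) * g (-Pi.single i 1))) *
      ∏ i, ∏ j ∈ Ioi i, (g (Pi.single i 1 + Pi.single j 1) * g (Pi.single i 1 - Pi.single j 1) *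
        g (-Pi.single i 1 + Pi.single j 1) * g (-Pi.single i 1 - Pi.single j 1)) := by
  have hu : (univ : Finset ℤˣ) = {1, -1} := by decide
  have hval : ∀ e : ℤˣ, ((e : ℤ) : ℚ) ≠ 0 := by
    intro e
    rcases Int.units_eq_one_or e with h | h <;> simp [h]
  have hinj : ∀ e e' : ℤˣ, ((e : ℤ) : ℚ) = ((e' : ℤ) : ℚ) → e = e' := by
    intro e e' h
    exact Units.ext (by exact_mod_cast h)
  rw [roots, prod_union]
  · congr 1
    · rw [prod_image, Fintype.prod_prod_type]
      · refine prod_congr rfl fun i _ => ?_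
        rw [hu, prod_insert (by decide), prod_singleton]
        simp [Pi.single_neg]
      · rintro ⟨i, e⟩ - ⟨i', e'⟩ - h
        have h0 : i = i' := by
          by_contra hne
          have := congrFun h i
          simp only [Pi.single_eq_same, Pi.single_eq_of_ne (show i ≠ i' from hne)] at this
          exact hval e this
        subst h0
        exact Prod.ext rfl (hinj _ _ (Pi.single_injective i h))
    -- Ordered pairs i ≠ j produce every long root twice; restricting to i < j makes the
    -- parametrization injective.
    · have himg : ((univ.filter fun p : (Fin n × Fin n) × (ℤˣ × ℤˣ) => p.1.1 ≠ p.1.2).image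
          fun p => (Pi.single p.1.1 ((p.2.1 : ℤ) : ℚ) + Pi.single p.1.2 ((p.2.2 : ℤ) : ℚ) :
            Vec n)) =
          (univ.filter fun p : (Fin n × Fin n) × (ℤˣ × ℤˣ) => p.1.1 < p.1.2).image
          fun p => (Pi.single p.1.1 ((p.2.1 : ℤ) : ℚ) + Pi.single p.1.2 ((p.2.2 : ℤ) : ℚ) :
            Vec n) := by
        ext α
        simp only [mem_image, mem_filter, mem_univ, true_and]
        constructor
        · rintro ⟨⟨⟨i, j⟩, e, e'⟩, hne, rfl⟩
          rcases lt_or_gt_of_ne hne with h | h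
          · exact ⟨((i, j), (e, e')), h, rfl⟩
          · exact ⟨((j, i), (e', e)), h, add_comm _ _⟩
        · rintro ⟨p, h, rfl⟩
          exact ⟨p, h.ne, rfl⟩
      rw [himg, prod_image, prod_filter, Fintype.prod_prod_type, Fintype.prod_prod_type]
      · refine prod_congr rfl fun i _ => ?_
        rw [← filter_lt_eq_Ioi, prod_filter]
        refine prod_congr rfl fun j _ => ?_
        split_ifs with h
        · rw [Fintype.prod_prod_type, hu, prod_insert (by decide), prod_singleton,
            prod_insert (by decide), prod_singleton, prod_insert (by decide), prod_singleton]
          simp [Pi.single_neg, sub_eq_add_neg, mul_assoc]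
        · simp
      · rintro ⟨⟨i, j⟩, e, e'⟩ h1 ⟨⟨k, l⟩, d, d'⟩ h2 h
        simp only [coe_filter, mem_univ, true_and, Set.mem_ofPred_eq] at h1 h2
        have hv := fun t => congrFun h t
        simp only [Pi.add_apply] at hv
        have hi := hv i
        have hj := hv j
        have hk := hv k
        have hl := hv l
        have e0 := hval e
        have e1 := hval e'
        have d0 := hval d
        have d1 := hval d'
        have hik : i = k := by
          rcases lt_trichotomy i k with h3 | h3 | h3
          · simp [h1.ne, h3.ne, (h3.trans h2).ne, e0] at hi
          · exact h3
          · simp [h2.ne, h3.ne, (h3.trans h1).ne] at hk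
            exact absurd hk.symm (by simp)
        subst hik
        have hjl : j = l := by
          by_contra hne
          simp [h1.ne', hne, e1] at hj
        subst hjl
        simp [h1.ne, h1.ne'] at hi hj
        exact Prod.ext rfl (Prod.ext (Units.ext hi) (Units.ext hj))
  · rw [disjoint_left]
    intro α h1 h2
    simp only [mem_image, mem_filter, mem_univ, true_and] at h1 h2
    obtain ⟨⟨i, e⟩, rfl⟩ := h1
    obtain ⟨⟨⟨k, l⟩, d, d'⟩, hne, h⟩ := h2
    have hk := congrFun h k
    have hl := congrFun h l
    have d0 := hval d
    have d1 := hval d'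
    simp only at hne
    by_cases hki : k = i
    · subst hki
      simp [Ne.symm hne] at hl
    · simp [hne, hki] at hk

end Denominator

/-! ### Orbit sums as sums over the Weyl group -/

section Orbits

variable {n : ℕ}

theorem SignedPerm.act_left_injective {R : Type*} [CommRing R] (w : SignedPerm n) :
    Function.Injective (w.act : (Fin n → R) → Fin n → R) := by
  intro u v h
  have h' := congrArg w.inv.act h
  have e := fun x : Fin n → R => w.inv.act_act_inv x
  simp only [SignedPerm.inv_inv] at e
  rwa [e, e] at h'

/-- A sum over an orbit of pairs vanishes if the corresponding sum over the Weyl group does. -/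
theorem sum_orbit_eq_zero (u : Vec n) (v : Fin n → ℤ) (G : Vec n × (Fin n → ℤ) → LaurentSeries ℂ)
    (h : ∑ w : SignedPerm n, G (w.act u, w.act v) = 0) :
    ∑ p ∈ univ.image fun w : SignedPerm n => (w.act u, w.act v), G p = 0 := by
  set Φ : SignedPerm n → Vec n × (Fin n → ℤ) := fun w => (w.act u, w.act v) with hΦ
  -- The fibres of the orbit map are the left cosets of the stabilizer of (u, v), so they all have
  -- the same size.
  have hcard : ∀ w₀, #{w | Φ w = Φ w₀} = #{w | Φ w = (u, v)} := by
    intro w₀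
    conv_rhs => rw [← card_image_of_injective _ w₀.comp_injective]
    congr 1
    ext w
    obtain ⟨w', rfl⟩ := w₀.comp_bijective.2 w
    simp only [mem_filter, mem_univ, true_and, mem_image, w₀.comp_injective.eq_iff, exists_eq_right,
      hΦ, SignedPerm.act_comp, Prod.mk.injEq, w₀.act_left_injective.eq_iff]
  have hpos : #{w | Φ w = (u, v)} ≠ 0 := by
    rw [Ne, card_eq_zero, ← Ne, ← nonempty_iff_ne_empty]
    refine ⟨(fun _ => 1, 1), ?_⟩
    simp only [mem_filter, mem_univ, true_and, hΦ, Prod.mk.injEq]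
    constructor <;> funext i <;> simp [SignedPerm.act]
  have h1 : ∑ w : SignedPerm n, G (Φ w) = 0 := h
  rw [sum_comp] at h1
  have h2 : ∑ p ∈ univ.image Φ, #{w | Φ w = p} • G p =
      ∑ p ∈ univ.image Φ, #{w | Φ w = (u, v)} • G p := by
    refine sum_congr rfl fun p hp => ?_
    obtain ⟨w₀, -, rfl⟩ := mem_image.mp hp
    rw [hcard]
  rw [h2, ← smul_sum, nsmul_eq_mul] at h1
  exact (mul_eq_zero.mp h1).resolve_left (Nat.cast_ne_zero.mpr hpos)

end Orbits

/-! ### Twisting the first coordinate -/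

section Twist

variable {N : ℕ}

/-- The automorphism `e^μ ↦ (-q)^{μ_1} e^μ` on the integral weights. -/
noncomputable def twist (N : ℕ) :
    AddMonoidAlgebra (LaurentSeries ℂ) (Fin (N + 1) → ℤ) →ₐ[LaurentSeries ℂ]
      AddMonoidAlgebra (LaurentSeries ℂ) (Fin (N + 1) → ℤ) :=
  AddMonoidAlgebra.lift (LaurentSeries ℂ) _ (Fin (N + 1) → ℤ)
    { toFun := fun μ => AddMonoidAlgebra.single μ.toAdd ((-q) ^ (μ.toAdd 0))
      map_one' := by simp [AddMonoidAlgebra.one_def]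
      map_mul' := fun μ ν => by
        rw [AddMonoidAlgebra.single_mul_single, toAdd_mul, Pi.add_apply,
          zpow_add₀ (neg_ne_zero.mpr q_ne_zero)] }

theorem twist_single (μ : Fin (N + 1) → ℤ) (a : LaurentSeries ℂ) :
    twist N (AddMonoidAlgebra.single μ a) = AddMonoidAlgebra.single μ (a * (-q) ^ (μ 0)) := by
  simp [twist]

theorem coeff_twist (b : AddMonoidAlgebra (LaurentSeries ℂ) (Fin (N + 1) → ℤ))
    (μ : Fin (N + 1) → ℤ) : (twist N b).coeff μ = (-q) ^ (μ 0) * b.coeff μ := by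
  induction b using AddMonoidAlgebra.induction_linear with
  | zero => simp
  | add f g hf hg => simp [hf, hg, mul_add]
  | single ν a =>
    rw [twist_single, AddMonoidAlgebra.coeff_single, AddMonoidAlgebra.coeff_single]
    by_cases h : ν = μ
    · subst h
      rw [Finsupp.single_eq_same, Finsupp.single_eq_same, mul_comm]
    · simp [h]

/-- The inclusion of the group algebra of the integral weights. -/
noncomputable def integralInclusion (N : ℕ) :
    AddMonoidAlgebra (LaurentSeries ℂ) (Fin (N + 1) → ℤ) →+* LaurentAlg (N + 1) :=
  AddMonoidAlgebra.mapDomainRingHom (LaurentSeries ℂ) (intVec (N + 1))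

theorem intVec_injective (n : ℕ) : Function.Injective (intVec n) := by
  intro u v h
  funext i
  have := congrFun h i
  simpa [intVec] using this

/-- `h` arises from `g`, an element with integral exponents, by `e^μ ↦ (-q)^{μ_1} e^μ`. -/
def IsTwist (g h : LaurentAlg (N + 1)) : Prop :=
  ∃ b, integralInclusion N b = g ∧ integralInclusion N (twist N b) = h

namespace IsTwist

variable {g h g' h' : LaurentAlg (N + 1)}

/-- Closure under the ring operations allows a product to be twisted factor by factor. The twist is
a relation rather than an endomorphism of `LaurentAlg`, since (-q)^{μ_1} is an integral power only
for integral μ_1. -/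
theorem mul (h1 : IsTwist g h) (h2 : IsTwist g' h') : IsTwist (g * g') (h * h') := by
  obtain ⟨b, rfl, rfl⟩ := h1
  obtain ⟨b', rfl, rfl⟩ := h2
  exact ⟨b * b', by simp, by simp⟩

theorem add (h1 : IsTwist g h) (h2 : IsTwist g' h') : IsTwist (g + g') (h + h') := by
  obtain ⟨b, rfl, rfl⟩ := h1
  obtain ⟨b', rfl, rfl⟩ := h2
  exact ⟨b + b', by simp, by simp⟩

theorem sub (h1 : IsTwist g h) (h2 : IsTwist g' h') : IsTwist (g - g') (h - h') := by
  obtain ⟨b, rfl, rfl⟩ := h1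
  obtain ⟨b', rfl, rfl⟩ := h2
  exact ⟨b - b', by simp, by simp⟩

theorem one : IsTwist (1 : LaurentAlg (N + 1)) 1 := ⟨1, by simp, by simp⟩

theorem pow (h1 : IsTwist g h) (k : ℕ) : IsTwist (g ^ k) (h ^ k) := by
  obtain ⟨b, rfl, rfl⟩ := h1
  exact ⟨b ^ k, by simp, by simp⟩

theorem prod {ι : Type*} (s : Finset ι) (f f' : ι → LaurentAlg (N + 1))
    (hf : ∀ i, IsTwist (f i) (f' i)) : IsTwist (∏ i ∈ s, f i) (∏ i ∈ s, f' i) := by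
  choose b hb hb' using hf
  exact ⟨∏ i ∈ s, b i, by simp [hb], by simp [hb']⟩

theorem single (z : Fin (N + 1) → ℤ) (a : LaurentSeries ℂ) :
    IsTwist (AddMonoidAlgebra.single (intVec _ z) a)
      (AddMonoidAlgebra.single (intVec _ z) (a * (-q) ^ (z 0))) :=
  ⟨AddMonoidAlgebra.single z a, by simp [integralInclusion], by
    rw [twist_single]; simp [integralInclusion]⟩

theorem coeff (h1 : IsTwist g h) (z : Fin (N + 1) → ℤ) :
    h.coeff (intVec _ z) = (-q) ^ (z 0) * g.coeff (intVec _ z) := by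
  obtain ⟨b, rfl, rfl⟩ := h1
  simp only [integralInclusion, AddMonoidAlgebra.mapDomainRingHom_apply,
    AddMonoidAlgebra.coeff_mapDomain]
  have h2 := fun b : AddMonoidAlgebra (LaurentSeries ℂ) (Fin (N + 1) → ℤ) =>
    Finsupp.mapDomain_apply (f := intVec (N + 1)) (intVec_injective _) b.coeff z
  rw [h2, h2, coeff_twist]

end IsTwist

end Twist

/-! ### The dependence on the first coordinate -/

section Factors

variable {R : Type*} [CommRing R]

/-- The factors that only involve the first coordinate. -/
def headFactor (Q c c' x x' : R) : R :=
  (1 + Q * x) * (1 + Q * x') * (c + c' - c' * x - c * x')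

/-- The factors that involve the first and one other coordinate. -/
def bodyFactor (Q c c' z z' x x' : R) : R :=
  (1 + Q * (x * z)) * (1 + Q * (x * z')) * (1 + Q * (x' * z)) * (1 + Q * (x' * z')) *
    ((z + z' - (x + x')) * (z + z' - (c ^ 2 * x' + c' ^ 2 * x)))

/-- The twist exchanges, up to mutually inverse units, the two kernel factors with the denominator
factor. -/
theorem headFactor_twist {Q Q' x x' : R} (hQ : Q * Q' = 1) (hx : x * x' = 1) :
    headFactor Q Q Q' (-Q * x) (-Q' * x') = headFactor Q Q' Q x x' := by
  have e1 : 1 + Q * (-Q' * x') = 1 - x' := by linear_combination -x' * hQ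
  have e2 : Q + Q' - Q' * (-Q * x) - Q * (-Q' * x') = Q' * ((1 + Q * x) * (1 + Q * x')) := by
    linear_combination (-Q * x * x') * hQ - Q * hx
  have e3 : (1 + Q * (-Q * x)) * (1 - x') * Q' = Q' + Q - Q * x - Q' * x' := by
    linear_combination (-Q * x + Q * x * x') * hQ + Q * hx
  unfold headFactor
  rw [e1, e2]
  linear_combination ((1 + Q * x) * (1 + Q * x')) * e3

/-- Each pair of kernel factors with the same x or x' becomes one of the two denominator
differences, and each difference becomes such a pair. All this holds up to units whose product is 1.
-/
theorem bodyFactor_twist {Q Q' z z' x x' : R} (hQ : Q * Q' = 1) (hx : x * x' = 1)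
    (hz : z * z' = 1) :
    bodyFactor Q Q Q' z z' (-Q * x) (-Q' * x') = bodyFactor Q Q' Q z z' x x' := by
  have e1 : (1 + Q * (-Q' * x' * z)) * (1 + Q * (-Q' * x' * z')) = x' * (x + x' - (z + z')) := by
    have h (y : R) : Q * (-Q' * x' * y) = -(x' * y) := by linear_combination -x' * y * hQ
    rw [h, h]
    linear_combination x' ^ 2 * hz - hx
  have e2 : (1 + Q * (-Q * x * z)) * (1 + Q * (-Q * x * z')) =
      Q ^ 2 * x * (Q' ^ 2 * x' + Q ^ 2 * x - (z + z')) := by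
    linear_combination Q ^ 4 * x ^ 2 * hz - (Q * Q' + 1) * x * x' * hQ - hx
  have e3 : (1 + Q * (x * z)) * (1 + Q * (x * z')) = Q * x * (Q' * x' + Q * x + (z + z')) := by
    linear_combination Q ^ 2 * x ^ 2 * hz - x * x' * hQ - hx
  have e4 : (1 + Q * (x' * z)) * (1 + Q * (x' * z')) = Q * x' * (Q' * x + Q * x' + (z + z')) := by
    linear_combination Q ^ 2 * x' ^ 2 * hz - x * x' * hQ - hx
  have e5 : Q ^ 2 * (-Q' * x') + Q' ^ 2 * (-Q * x) = -(Q * x' + Q' * x) := by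
    linear_combination (-(Q * x' + Q' * x)) * hQ
  have h1 : bodyFactor Q Q Q' z z' (-Q * x) (-Q' * x') =
      ((1 + Q * (-Q * x * z)) * (1 + Q * (-Q * x * z'))) *
      ((1 + Q * (-Q' * x' * z)) * (1 + Q * (-Q' * x' * z'))) *
      ((z + z' - (-Q * x + -Q' * x')) *
        (z + z' - (Q ^ 2 * (-Q' * x') + Q' ^ 2 * (-Q * x)))) := by
    unfold bodyFactor
    ring
  have h2 : bodyFactor Q Q' Q z z' x x' =
      ((1 + Q * (x * z)) * (1 + Q * (x * z'))) * ((1 + Q * (x' * z)) * (1 + Q * (x' * z'))) *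
      ((z + z' - (x + x')) * (z + z' - (Q' ^ 2 * x' + Q ^ 2 * x))) := by
    unfold bodyFactor
    ring
  rw [h1, h2, e1, e2, e3, e4, e5]
  ring

end Factors

/-! ### The minuscule recurrences for the coefficients of the kernel -/

section Units

variable {R : Type*} [CommRing R]

theorem unitDiff_mul (u v : Rˣ) : unitDiff u * unitDiff v =
    ((u * v : Rˣ) : R) - ((u * v⁻¹ : Rˣ) : R) - ((u⁻¹ * v : Rˣ) : R) + ((u⁻¹ * v⁻¹ : Rˣ) : R) := by
  simp only [unitDiff, Units.val_mul]
  ring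

theorem unitSum_eq (u : Rˣ) : unitSum u = ((u * u : Rˣ) : R) + ((u⁻¹ * u⁻¹ : Rˣ) : R) := by
  simp only [unitSum, Units.val_mul]
  ring

theorem intUnit_sq (e : ℤˣ) : ((e : ℤ) : R) ^ 2 = 1 := by
  rcases Int.units_eq_one_or e with h | h <;> simp [h]

theorem intUnit_mul_single {M : Type*} [AddCommMonoid M] (e : ℤˣ) (v : M) (p : R) :
    ((e : ℤ) : AddMonoidAlgebra R M) * AddMonoidAlgebra.single v p =
      AddMonoidAlgebra.single v (((e : ℤ) : R) * p) := by
  rcases Int.units_eq_one_or e with h | h <;> simp [h]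

/-- The two reversal signs cancel, and the factors are sorted by whether they involve the first
variable. -/
theorem unitAlternant_mul_succ [Nontrivial R] {N : ℕ} (u v : Fin (N + 1) → Rˣ) :
    unitAlternant u * unitAlternant v = (unitDiff (u 0) * unitDiff (v 0)) *
      (∏ j : Fin N, ((unitSum (u j.succ) - unitSum (u 0)) *
        (unitSum (v j.succ) - unitSum (v 0)))) *
      ((∏ i : Fin N, (unitDiff (u i.succ) * unitDiff (v i.succ))) *
        ((∏ i : Fin N, ∏ j ∈ Ioi i, (unitSum (u j.succ) - unitSum (u i.succ))) *
          ∏ i : Fin N, ∏ j ∈ Ioi i, (unitSum (v j.succ) - unitSum (v i.succ)))) := by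
  have hs := intUnit_sq (R := R) (Equiv.Perm.sign (Fin.revPerm : Equiv.Perm (Fin (N + 1))))
  rw [unitAlternant_succ, unitAlternant_succ, prod_mul_distrib, prod_mul_distrib]
  set s := ((Equiv.Perm.sign (Fin.revPerm : Equiv.Perm (Fin (N + 1))) : ℤ) : R)
  linear_combination ((unitDiff (u 0) * ∏ j : Fin N, (unitSum (u j.succ) - unitSum (u 0))) *
    ((∏ i : Fin N, unitDiff (u i.succ)) *
      ∏ i : Fin N, ∏ j ∈ Ioi i, (unitSum (u j.succ) - unitSum (u i.succ)))) *
    ((unitDiff (v 0) * ∏ j : Fin N, (unitSum (v j.succ) - unitSum (v 0))) *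
    ((∏ i : Fin N, unitDiff (v i.succ)) *
      ∏ i : Fin N, ∏ j ∈ Ioi i, (unitSum (v j.succ) - unitSum (v i.succ)))) * hs

end Units

/-! ### Weyl denominators over the Laurent series as unit alternants -/

section Alternants

variable {n : ℕ}

/-- The unit `c e^v` of the group algebra. -/
noncomputable def expUnit (v : Vec n) (c : (LaurentSeries ℂ)ˣ) : (LaurentAlg n)ˣ where
  val := AddMonoidAlgebra.single v (c : LaurentSeries ℂ)
  inv := AddMonoidAlgebra.single (-v) ((c⁻¹ : (LaurentSeries ℂ)ˣ) : LaurentSeries ℂ)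
  val_inv := by simp [AddMonoidAlgebra.single_mul_single, AddMonoidAlgebra.one_def]
  inv_val := by simp [AddMonoidAlgebra.single_mul_single, AddMonoidAlgebra.one_def]

theorem expUnit_mul (v v' : Vec n) (c c' : (LaurentSeries ℂ)ˣ) :
    expUnit v c * expUnit v' c' = expUnit (v + v') (c * c') :=
  Units.ext (by simp [expUnit, AddMonoidAlgebra.single_mul_single])

theorem expUnit_inv (v : Vec n) (c : (LaurentSeries ℂ)ˣ) :
    (expUnit v c)⁻¹ = expUnit (-v) c⁻¹ := Units.ext rfl

theorem expUnit_pow (v : Vec n) (c : (LaurentSeries ℂ)ˣ) (k : ℕ) :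
    expUnit v c ^ k = expUnit (k • v) (c ^ k) :=
  Units.ext (by simp [expUnit, AddMonoidAlgebra.single_pow])

theorem expUnit_zpow (v : Vec n) (c : (LaurentSeries ℂ)ˣ) (z : ℤ) :
    expUnit v c ^ z = expUnit (z • v) (c ^ z) := by
  cases z with
  | ofNat k => simp [expUnit_pow]
  | negSucc k =>
    rw [zpow_negSucc, zpow_negSucc, expUnit_pow, expUnit_inv, negSucc_zsmul]

/-- With h = 1/2 this gives the Weyl denominator, with h = -1/2 its conjugate; the scalars c_i
rescale the variables. -/
theorem unitAlternant_expUnit (h : ℚ) (c : Fin n → (LaurentSeries ℂ)ˣ) :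
    unitAlternant (fun i => expUnit (Pi.single i h : Vec n) (c i)) =
      ∑ w : SignedPerm n, AddMonoidAlgebra.single (fun i => ((w.act (twoRho n) i : ℤ) : ℚ) * h)
        (((w.sgn : ℤ) : LaurentSeries ℂ) *
          ∏ i, ((c i ^ w.act (twoRho n) i : (LaurentSeries ℂ)ˣ) : LaurentSeries ℂ)) := by
  refine sum_congr rfl fun w _ => ?_
  simp only [expUnit_zpow]
  have h1 : ∀ (v : Vec n) (d : (LaurentSeries ℂ)ˣ), ((expUnit v d : (LaurentAlg n)ˣ) :
      LaurentAlg n) = AddMonoidAlgebra.single v (d : LaurentSeries ℂ) := fun _ _ => rfl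
  simp only [h1]
  rw [AddMonoidAlgebra.prod_single]
  have h2 : ∑ i, w.act (twoRho n) i • (Pi.single i h : Vec n) =
      fun i => ((w.act (twoRho n) i : ℤ) : ℚ) * h := by
    funext j
    rw [Finset.sum_apply, sum_eq_single j]
    · simp
    · intro i _ hij
      simp [hij.symm]
    · simp
  rw [h2]
  exact intUnit_mul_single _ _ _

theorem act_rho (w : SignedPerm n) (i : Fin n) :
    w.act (rho n) i = ((w.act (twoRho n) i : ℤ) : ℚ) * (1 / 2) := by
  simp only [SignedPerm.act, rho]
  push_cast
  simp
  ring

theorem laurentAlternant_eq : laurentAlternant n =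
    unitAlternant (fun i => expUnit (Pi.single i (1 / 2) : Vec n) 1) := by
  rw [unitAlternant_expUnit, laurentAlternant]
  refine sum_congr rfl fun w _ => ?_
  congr 1
  · funext i
    exact act_rho w i
  · simp

variable {N : ℕ}

/-- The conjugate of the Weyl denominator, with its first variable scaled by `c`. -/
noncomputable def scaledAlternant (N : ℕ) (c : (LaurentSeries ℂ)ˣ) : LaurentAlg (N + 1) :=
  ∑ w : SignedPerm (N + 1), AddMonoidAlgebra.single (-w.act (rho (N + 1)))
    (((w.sgn : ℤ) : LaurentSeries ℂ) *
      ((c ^ w.act (twoRho (N + 1)) 0 : (LaurentSeries ℂ)ˣ) : LaurentSeries ℂ))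

theorem scaledAlternant_eq (c : (LaurentSeries ℂ)ˣ) : scaledAlternant N c =
    unitAlternant (fun i => expUnit (Pi.single i (-(1 / 2)) : Vec (N + 1))
      (if i = 0 then c else 1)) := by
  rw [unitAlternant_expUnit, scaledAlternant]
  refine sum_congr rfl fun w _ => ?_
  congr 1
  · funext i
    rw [Pi.neg_apply, act_rho]
    ring
  · rw [Fin.prod_univ_succ]
    simp [Fin.succ_ne_zero]

/-- The exponential `e^{e_i}`. -/
noncomputable def expPos (i : Fin n) : LaurentAlg n :=
  AddMonoidAlgebra.single (Pi.single i 1 : Vec n) 1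

/-- The exponential `e^{-e_i}`. -/
noncomputable def expNeg (i : Fin n) : LaurentAlg n :=
  AddMonoidAlgebra.single (-Pi.single i 1 : Vec n) 1

/-- A Laurent series as a constant of the group algebra. -/
noncomputable def const (n : ℕ) (c : LaurentSeries ℂ) : LaurentAlg n :=
  AddMonoidAlgebra.single 0 c

theorem expPos_mul_expNeg (i : Fin n) : expPos i * expNeg i = 1 := by
  simp [expPos, expNeg, AddMonoidAlgebra.single_mul_single, AddMonoidAlgebra.one_def]

theorem const_mul_const (c c' : LaurentSeries ℂ) : const n c * const n c' = const n (c * c') := by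
  simp [const, AddMonoidAlgebra.single_mul_single]

theorem half_single (i : Fin n) :
    (Pi.single i (1 / 2) + Pi.single i (1 / 2) : Vec n) = Pi.single i 1 := by
  rw [← Pi.single_add]
  norm_num

theorem unitSum_expUnit (i : Fin n) (c : (LaurentSeries ℂ)ˣ) :
    unitSum (expUnit (Pi.single i (1 / 2) : Vec n) c) =
      const n (c : LaurentSeries ℂ) ^ 2 * expPos i +
        const n ((c⁻¹ : (LaurentSeries ℂ)ˣ) : LaurentSeries ℂ) ^ 2 * expNeg i := by
  rw [unitSum_eq, expUnit_inv, expUnit_mul, expUnit_mul, ← neg_add, half_single]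
  simp [expUnit, const, expPos, expNeg, AddMonoidAlgebra.single_mul_single, pow_two]

theorem unitSum_expUnit_neg (i : Fin n) (c : (LaurentSeries ℂ)ˣ) :
    unitSum (expUnit (Pi.single i (-(1 / 2)) : Vec n) c) =
      const n (c : LaurentSeries ℂ) ^ 2 * expNeg i +
        const n ((c⁻¹ : (LaurentSeries ℂ)ˣ) : LaurentSeries ℂ) ^ 2 * expPos i := by
  have h := unitSum_expUnit i c⁻¹
  rw [inv_inv] at h
  rw [Pi.single_neg, ← inv_inv (expUnit (-Pi.single i (1 / 2) : Vec n) c), expUnit_inv, neg_neg,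
    add_comm, ← h, unitSum_eq, unitSum_eq, inv_inv, add_comm]

/-- A single difference has half-integral exponents. They become integral only in the product of the
two denominators, so it is the product that can be twisted. -/
theorem unitDiff_mul_unitDiff (i : Fin n) (c : (LaurentSeries ℂ)ˣ) :
    unitDiff (expUnit (Pi.single i (1 / 2) : Vec n) 1) *
        unitDiff (expUnit (Pi.single i (-(1 / 2)) : Vec n) c) =
      const n (c : LaurentSeries ℂ) + const n ((c⁻¹ : (LaurentSeries ℂ)ˣ) : LaurentSeries ℂ) -
        const n ((c⁻¹ : (LaurentSeries ℂ)ˣ) : LaurentSeries ℂ) * expPos i -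
        const n (c : LaurentSeries ℂ) * expNeg i := by
  rw [unitDiff_mul]
  simp only [expUnit_inv, expUnit_mul, Pi.single_neg, neg_neg]
  have e : (-Pi.single i (1 / 2) + -Pi.single i (1 / 2) : Vec n) = -Pi.single i 1 := by
    rw [← neg_add, half_single]
  rw [half_single, e]
  simp [expUnit, const, expPos, expNeg, AddMonoidAlgebra.single_mul_single]
  ring

end Alternants

/-! ### Splitting off the first coordinate from the kernel and the denominators -/

section Product

variable {N : ℕ}

/-- The part of the kernel that does not involve the first coordinate. -/
noncomputable def tailKernel (N : ℕ) : LaurentAlg (N + 1) :=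
  (∏ i : Fin N, ((1 + const (N + 1) q * expPos i.succ) * (1 + const (N + 1) q * expNeg i.succ))) *
    ∏ i : Fin N, ∏ j ∈ Ioi i, ((1 + const (N + 1) q * (expPos i.succ * expPos j.succ)) *
      (1 + const (N + 1) q * (expPos i.succ * expNeg j.succ)) *
      (1 + const (N + 1) q * (expNeg i.succ * expPos j.succ)) *
      (1 + const (N + 1) q * (expNeg i.succ * expNeg j.succ)))

theorem laurentKernel_succ : laurentKernel (N + 1) = (1 + const (N + 1) q) ^ (N + 1) *
    ((1 + const (N + 1) q * expPos 0) * (1 + const (N + 1) q * expNeg 0) *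
      ∏ j : Fin N, ((1 + const (N + 1) q * (expPos 0 * expPos j.succ)) *
        (1 + const (N + 1) q * (expPos 0 * expNeg j.succ)) *
        (1 + const (N + 1) q * (expNeg 0 * expPos j.succ)) *
        (1 + const (N + 1) q * (expNeg 0 * expNeg j.succ)))) * tailKernel N := by
  have h1 : ∀ v : Vec (N + 1), (1 : LaurentAlg (N + 1)) + AddMonoidAlgebra.single v q =
      1 + const (N + 1) q * AddMonoidAlgebra.single v 1 := by
    intro v
    simp [const, AddMonoidAlgebra.single_mul_single]
  have h2 : ∀ u v : Vec (N + 1), (AddMonoidAlgebra.single (u + v) 1 : LaurentAlg (N + 1)) =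
      AddMonoidAlgebra.single u 1 * AddMonoidAlgebra.single v 1 := by
    intro u v
    simp [AddMonoidAlgebra.single_mul_single]
  rw [laurentKernel, prod_roots]
  simp only [h1, sub_eq_add_neg, h2]
  rw [Fin.prod_univ_succ, Fin.prod_univ_succ, Fin.prod_Ioi_zero]
  simp only [Fin.prod_Ioi_succ]
  rw [tailKernel]
  simp only [expPos, expNeg, const, AddMonoidAlgebra.single_mul_single, mul_one, add_zero, zero_add]
  ring

/-- The part of the product of two Weyl denominators that does not involve the first
coordinate. -/
noncomputable def tailSquare (N : ℕ) : LaurentAlg (N + 1) :=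
  (∏ i : Fin N, (2 - expPos i.succ - expNeg i.succ)) *
    (∏ i : Fin N, ∏ j ∈ Ioi i, (expPos j.succ + expNeg j.succ -
      (expPos i.succ + expNeg i.succ))) ^ 2

theorem const_one (n : ℕ) : const n 1 = 1 := rfl

/-- The product whose coefficients give the two parts of the minuscule recurrence. -/
theorem kernel_mul_alternants (c : (LaurentSeries ℂ)ˣ) :
    laurentKernel (N + 1) * laurentAlternant (N + 1) * scaledAlternant N c =
      (1 + const (N + 1) q) ^ (N + 1) * tailKernel N * tailSquare N *
      (headFactor (const (N + 1) q) (const (N + 1) c)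
        (const (N + 1) ((c⁻¹ : (LaurentSeries ℂ)ˣ) : LaurentSeries ℂ)) (expPos 0) (expNeg 0) *
      ∏ j : Fin N, bodyFactor (const (N + 1) q) (const (N + 1) c)
        (const (N + 1) ((c⁻¹ : (LaurentSeries ℂ)ˣ) : LaurentSeries ℂ)) (expPos j.succ)
          (expNeg j.succ) (expPos 0) (expNeg 0)) := by
  have h1 : ∀ j : Fin (N + 1), (expNeg j + expPos j : LaurentAlg (N + 1)) = expPos j + expNeg j :=
    fun j => add_comm _ _
  rw [laurentKernel_succ, laurentAlternant_eq, scaledAlternant_eq, mul_assoc,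
    unitAlternant_mul_succ]
  simp only [unitSum_expUnit, unitSum_expUnit_neg, unitDiff_mul_unitDiff, Fin.succ_ne_zero,
    if_false, if_true, inv_one, Units.val_one, const_one, one_pow, one_mul, h1]
  have h3 : (∏ i : Fin N, ((1 : LaurentAlg (N + 1)) + 1 - expPos i.succ - expNeg i.succ)) =
      ∏ i : Fin N, (2 - expPos i.succ - expNeg i.succ) :=
    prod_congr rfl fun i _ => by ring
  rw [h3, tailSquare, headFactor]
  simp only [bodyFactor, prod_mul_distrib]
  ring

end Product

/-! ### The twist symmetry and the resulting recurrences -/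

section Recurrence

variable {N : ℕ}

theorem isTwist_const (c : LaurentSeries ℂ) :
    IsTwist (const (N + 1) c) (const (N + 1) c) := by
  simpa [const] using IsTwist.single (N := N) 0 c

theorem intVec_single {n : ℕ} (i : Fin n) (c : ℤ) :
    intVec n (Pi.single i c) = Pi.single i (c : ℚ) := by
  funext j
  by_cases hj : j = i
  · subst hj
    simp [intVec]
  · simp [intVec, hj]

theorem isTwist_single (i : Fin (N + 1)) (c : ℤ) :
    IsTwist (AddMonoidAlgebra.single (Pi.single i (c : ℚ) : Vec (N + 1)) 1)
      (const (N + 1) ((-q) ^ ((Pi.single i c : Fin (N + 1) → ℤ) 0)) *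
        AddMonoidAlgebra.single (Pi.single i (c : ℚ) : Vec (N + 1)) 1) := by
  have h := IsTwist.single (N := N) (Pi.single i c) 1
  rw [intVec_single, one_mul] at h
  rwa [const, AddMonoidAlgebra.single_mul_single, zero_add, mul_one]

theorem isTwist_expPos (i : Fin (N + 1)) : IsTwist (expPos i)
    (const (N + 1) ((-q) ^ ((Pi.single i 1 : Fin (N + 1) → ℤ) 0)) * expPos i) := by
  have h := isTwist_single i 1
  rwa [Int.cast_one] at h

theorem isTwist_expNeg (i : Fin (N + 1)) : IsTwist (expNeg i)
    (const (N + 1) ((-q) ^ ((Pi.single i (-1) : Fin (N + 1) → ℤ) 0)) * expNeg i) := by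
  have h := isTwist_single i (-1)
  rwa [Int.cast_neg, Int.cast_one, Pi.single_neg] at h

theorem isTwist_expPos_succ (i : Fin N) : IsTwist (expPos i.succ) (expPos i.succ) := by
  have h := isTwist_expPos i.succ
  rwa [Pi.single_eq_of_ne (Fin.succ_ne_zero i).symm, zpow_zero, const_one, one_mul] at h

theorem isTwist_expNeg_succ (i : Fin N) : IsTwist (expNeg i.succ) (expNeg i.succ) := by
  have h := isTwist_expNeg i.succ
  rwa [Pi.single_eq_of_ne (Fin.succ_ne_zero i).symm, zpow_zero, const_one, one_mul] at h

theorem const_neg {n : ℕ} (c : LaurentSeries ℂ) : const n (-c) = -const n c :=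
  AddMonoidAlgebra.single_neg _ _

theorem isTwist_expPos_zero :
    IsTwist (expPos 0) (-const (N + 1) q * expPos 0) := by
  have h := isTwist_expPos (N := N) 0
  rwa [Pi.single_eq_same, zpow_one, const_neg] at h

theorem isTwist_expNeg_zero :
    IsTwist (expNeg 0) (-const (N + 1) q⁻¹ * expNeg 0) := by
  have h := isTwist_expNeg (N := N) 0
  have e : (-q)⁻¹ = -q⁻¹ :=
    inv_eq_of_mul_eq_one_right (by linear_combination mul_inv_cancel₀ q_ne_zero)
  rwa [Pi.single_eq_same, zpow_neg_one, e, const_neg] at h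

theorem isTwist_tailKernel : IsTwist (tailKernel N) (tailKernel N) := by
  have hq := isTwist_const (N := N) q
  have hp := isTwist_expPos_succ (N := N)
  have hn := isTwist_expNeg_succ (N := N)
  refine .mul (.prod _ _ _ fun i => ?_) (.prod _ _ _ fun i => .prod _ _ _ fun j => ?_)
  · exact (IsTwist.one.add (hq.mul (hp i))).mul (IsTwist.one.add (hq.mul (hn i)))
  · exact (((IsTwist.one.add (hq.mul ((hp i).mul (hp j)))).mul
      (IsTwist.one.add (hq.mul ((hp i).mul (hn j))))).mul
      (IsTwist.one.add (hq.mul ((hn i).mul (hp j))))).mul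
      (IsTwist.one.add (hq.mul ((hn i).mul (hn j))))

theorem isTwist_tailSquare : IsTwist (tailSquare N) (tailSquare N) := by
  have h2 : IsTwist (2 : LaurentAlg (N + 1)) 2 := by
    have h := (IsTwist.one (N := N)).add .one
    rwa [one_add_one_eq_two] at h
  have hp := isTwist_expPos_succ (N := N)
  have hn := isTwist_expNeg_succ (N := N)
  exact .mul (.prod _ _ _ fun i => (h2.sub (hp i)).sub (hn i))
    (.pow (.prod _ _ _ fun i => .prod _ _ _ fun j =>
      ((hp j).add (hn j)).sub ((hp i).add (hn i))) 2)

theorem IsTwist.headFactor {Q c c' x x' y y' : LaurentAlg (N + 1)} (hQ : IsTwist Q Q)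
    (hc : IsTwist c c) (hc' : IsTwist c' c') (hx : IsTwist x y) (hx' : IsTwist x' y') :
    IsTwist (headFactor Q c c' x x') (headFactor Q c c' y y') :=
  ((IsTwist.one.add (hQ.mul hx)).mul (IsTwist.one.add (hQ.mul hx'))).mul
    (((hc.add hc').sub (hc'.mul hx)).sub (hc.mul hx'))

theorem IsTwist.bodyFactor {Q c c' z z' x x' y y' : LaurentAlg (N + 1)} (hQ : IsTwist Q Q)
    (hc : IsTwist c c) (hc' : IsTwist c' c') (hz : IsTwist z z) (hz' : IsTwist z' z')
    (hx : IsTwist x y) (hx' : IsTwist x' y') :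
    IsTwist (bodyFactor Q c c' z z' x x') (bodyFactor Q c c' z z' y y') :=
  ((((IsTwist.one.add (hQ.mul (hx.mul hz))).mul (IsTwist.one.add (hQ.mul (hx.mul hz')))).mul
    (IsTwist.one.add (hQ.mul (hx'.mul hz)))).mul (IsTwist.one.add (hQ.mul (hx'.mul hz')))).mul
    (((hz.add hz').sub (hx.add hx')).mul
      ((hz.add hz').sub (((hc.pow 2).mul hx').add ((hc'.pow 2).mul hx))))

/-- The variable `q` as a unit. -/
noncomputable def qUnit : (LaurentSeries ℂ)ˣ := Units.mk0 q q_ne_zero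

theorem val_qUnit_zpow (z : ℤ) : ((qUnit ^ z : (LaurentSeries ℂ)ˣ) : LaurentSeries ℂ) = q ^ z := by
  rw [Units.val_zpow_eq_zpow_val, qUnit, Units.val_mk0]

/-- Factors without the first coordinate are fixed by the twist; the others are matched by
`headFactor_twist` and `bodyFactor_twist`. -/
theorem isTwist_kernel_mul_alternants :
    IsTwist (laurentKernel (N + 1) * laurentAlternant (N + 1) * scaledAlternant N qUnit)
      (laurentKernel (N + 1) * laurentAlternant (N + 1) * scaledAlternant N qUnit⁻¹) := by
  have e1 : (qUnit : LaurentSeries ℂ) = q := rfl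
  have e2 : ((qUnit⁻¹ : (LaurentSeries ℂ)ˣ) : LaurentSeries ℂ) = q⁻¹ := rfl
  have hQ : const (N + 1) q * const (N + 1) q⁻¹ = 1 := by
    rw [const_mul_const, mul_inv_cancel₀ q_ne_zero, const_one]
  have hx := expPos_mul_expNeg (0 : Fin (N + 1))
  rw [kernel_mul_alternants, kernel_mul_alternants, inv_inv, e1, e2, ← headFactor_twist hQ hx,
    prod_congr rfl fun j _ => (bodyFactor_twist hQ hx (expPos_mul_expNeg j.succ)).symm]
  have hq := isTwist_const (N := N) q
  have hq' := isTwist_const (N := N) q⁻¹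
  exact ((((IsTwist.one.add hq).pow _).mul isTwist_tailKernel).mul isTwist_tailSquare).mul
    ((hq.headFactor hq hq' isTwist_expPos_zero isTwist_expNeg_zero).mul
      (.prod _ _ _ fun j => hq.bodyFactor hq hq' (isTwist_expPos_succ j) (isTwist_expNeg_succ j)
        isTwist_expPos_zero isTwist_expNeg_zero))

/-- Multiplication by e^{-wρ} shifts exponents, so an alternating sum of the coefficients at μ + wρ
is a single coefficient of a product. -/
theorem coeff_mul_scaledAlternant (F : LaurentAlg (N + 1)) (c : (LaurentSeries ℂ)ˣ)
    (μ : Vec (N + 1)) : (F * scaledAlternant N c).coeff μ =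
      ∑ w : SignedPerm (N + 1), F.coeff (μ + w.act (rho (N + 1))) *
        (((w.sgn : ℤ) : LaurentSeries ℂ) *
          ((c ^ w.act (twoRho (N + 1)) 0 : (LaurentSeries ℂ)ˣ) : LaurentSeries ℂ)) := by
  rw [scaledAlternant, mul_sum, AddMonoidAlgebra.coeff_sum, Finsupp.finsetSum_apply]
  simp only [AddMonoidAlgebra.coeff_mul_single_apply, neg_neg]

/-- The pairing (2ρ, w e_1) equals (w⁻¹ 2ρ, e_1). -/
theorem sum_twoRho_act (w : SignedPerm (N + 1)) :
    ∑ i, twoRho (N + 1) i * w.act (firstOnes (N + 1) 1 ℤ) i =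
      w.inv.act (twoRho (N + 1)) 0 := by
  rw [sum_eq_single (w.2.symm 0)]
  · simp [SignedPerm.act, SignedPerm.inv, firstOnes, mul_comm]
  · intro i _ hi
    have h : w.2 i ≠ 0 := fun h => hi (by rw [← h]; simp)
    simp [SignedPerm.act, firstOnes, h]
  · simp

/-- The specialized coefficients of the kernel satisfy the minuscule recurrences. -/
theorem minusculeRecurrence_specializedCoeff {k : ℕ} (hk : 1 ≤ k) :
    MinusculeRecurrence (N + 1) (specializedCoeff (N + 1)) k := by
  set F := laurentKernel (N + 1) * laurentAlternant (N + 1) with hF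
  set lam := firstOnes (N + 1) k ℚ with hlam
  have hint : lam = intVec (N + 1) (firstOnes (N + 1) k ℤ) := by
    funext i
    by_cases h : (i : ℕ) < k <;> simp [hlam, intVec, firstOnes, h]
  refine sum_orbit_eq_zero lam _ (fun p => extend (specializedCoeff (N + 1)) p.1 *
    (q ^ (-(∑ i, twoRho (N + 1) i * p.2 i)) + q ^ (1 + ∑ i, twoRho (N + 1) i * p.2 i))) ?_
  -- Skewness moves w from λ to ρ as its inverse; λ then stays fixed and the sum can be read as a
  -- coefficient at λ.
  have h1 : ∀ w : SignedPerm (N + 1), extend (specializedCoeff (N + 1)) (w.act lam) =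
      ((w.sgn : ℤ) : LaurentSeries ℂ) * F.coeff (lam + w.inv.act (rho (N + 1))) := by
    intro w
    rw [extend_specializedCoeff, ← coeff_laurentKernel_act, SignedPerm.act_add,
      SignedPerm.act_act_inv]
    refine ⟨w.act (firstOnes (N + 1) k ℤ), fun i => ?_⟩
    simp [hint, SignedPerm.act, intVec]
  -- The first coordinate of λ is 1 because k ≥ 1, so the twist contributes exactly the factor -q.
  have h2 := isTwist_kernel_mul_alternants.coeff (firstOnes (N + 1) k ℤ)
  rw [← hint, coeff_mul_scaledAlternant, coeff_mul_scaledAlternant] at h2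
  have h3 : firstOnes (N + 1) k ℤ 0 = 1 := by
    simp [firstOnes, Nat.pos_of_ne_zero (by omega : k ≠ 0)]
  rw [h3, zpow_one] at h2
  simp only [inv_zpow', val_qUnit_zpow, ← hF] at h2
  simp only [sum_twoRho_act, h1]
  have h4 := (SignedPerm.inv_bijective (n := N + 1)).sum_comp fun v : SignedPerm (N + 1) =>
    ((v.sgn : ℤ) : LaurentSeries ℂ) * F.coeff (lam + v.act (rho (N + 1))) *
      (q ^ (-v.act (twoRho (N + 1)) 0) + q ^ (1 + v.act (twoRho (N + 1)) 0))
  simp only [SignedPerm.sgn_inv] at h4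
  rw [h4]
  have h5 : ∀ v : SignedPerm (N + 1),
      ((v.sgn : ℤ) : LaurentSeries ℂ) * F.coeff (lam + v.act (rho (N + 1))) *
        (q ^ (-v.act (twoRho (N + 1)) 0) + q ^ (1 + v.act (twoRho (N + 1)) 0)) =
      F.coeff (lam + v.act (rho (N + 1))) *
        (((v.sgn : ℤ) : LaurentSeries ℂ) * q ^ (-v.act (twoRho (N + 1)) 0)) +
      q * (F.coeff (lam + v.act (rho (N + 1))) *
        (((v.sgn : ℤ) : LaurentSeries ℂ) * q ^ (v.act (twoRho (N + 1)) 0))) := by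
    intro v
    rw [zpow_add₀ q_ne_zero, zpow_one]
    ring
  rw [sum_congr rfl fun v _ => h5 v, sum_add_distrib, ← mul_sum, h2]
  ring

end Recurrence

end TypeB

theorem proposition4p3 (n m : ℕ) (hm : 1 ≤ m) (hmn : m ≤ n) :
    (TypeB.specializedCoeff n (TypeB.omega n m) * TypeB.c n m =
      ∑ i ∈ Finset.Icc 1 ((m + 1) / 2),
          TypeB.specializedCoeff n (TypeB.omega n (m + 1 - 2 * i)) * TypeB.b i +
        ∑ i ∈ Finset.Icc 1 (m / 2),
          TypeB.specializedCoeff n (TypeB.omega n (m - 2 * i)) * TypeB.b (n - m + i + 1)) ∧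
    ∀ a : TypeB.DominantWeight n → LaurentSeries ℂ,
      (∀ k, 1 ≤ k → k ≤ m → TypeB.MinusculeRecurrence n a k) ↔
        ∀ k, 1 ≤ k → k ≤ m → TypeB.SimplifiedRecurrence n a k := by
  refine ⟨?_, fun a => TypeB.minusculeRecurrence_iff_simplifiedRecurrence a hmn⟩
  -- The twist needs a first coordinate, which 1 ≤ m ≤ n provides.
  obtain ⟨N, rfl⟩ : ∃ N, n = N + 1 := ⟨n - 1, by omega⟩
  exact (TypeB.minusculeRecurrence_iff_simplifiedRecurrence _ hmn).mp
    (fun k hk _ => TypeB.minusculeRecurrence_specializedCoeff hk) m hm le_rfl
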